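/- Let $p>3$ be a prime and let $w$ be a generator of $\mathbb F_p^*$ (as an exponent, $w$ denotes its representative in $\{0,\dots,p-1\}$). Write $[x,y]=x^{-1}y^{-1}xy$. In the presentations below all $p$-th powers of generators and all commutators of generators that are not mentioned are trivial. The lower exponent-$p$ central series of a group $H$ is $\gamma_0(H)=H$, $\gamma_{i+1}(H)=\langle [h,g]k^p \mid h,k\in\gamma_i(H),\ g\in H\rangle$; the $p$-class of a finite $p$-group is the least $c$ with $\gamma_c(H)=1$. A finite $p$-group $H$ is an immediate descendant of a finite $p$-group $G$ of $p$-class $c$ if $H/\gamma_c(H)\cong G$, $H$ and $G$ have the same minimal number of generators, and $H$ has $p$-class $c+1$. Let $G=\langle a_1,a_2,a_3,a_4\mid [a_2,a_1]=a_4\rangle$, which is isomorphic to the direct product of $C_p$ and the Heisenberg group of unitriangular $3\times3$ matrices over $\mathbb F_p$ (GAP type $(p^4,12)$). (1) The following ten groups have order $p^5$, are immediate descendants of $G$, are pairwise non-isomorphic, and every immediate descendant of $G$ of order $p^5$ is isomorphic to one of them; each is of the form $\langle g_1,\dots,g_5\mid [g_2,g_1]=g_4,\dots\rangle$ with the following further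 relations: $$\begin{aligned} G_1&: [g_4,g_2]=g_5; & G_6&: [g_4,g_2]=g_5,\ [g_3,g_1]=g_5;\\ G_2&: [g_4,g_2]=g_5,\ g_3^p=g_5; & G_7&: [g_4,g_2]=g_5,\ [g_3,g_1]=g_5,\ g_3^p=g_5;\\ G_3&: [g_4,g_2]=g_5,\ g_2^p=g_5; & G_8&: [g_4,g_2]=g_5,\ [g_3,g_1]=g_5,\ g_2^p=g_5;\\ G_4&: [g_4,g_2]=g_5,\ g_1^p=g_5; & G_9&: [g_4,g_2]=g_5,\ [g_3,g_1]=g_5,\ g_1^p=g_5;\\ G_5&: [g_4,g_2]=g_5^w,\ g_1^p=g_5; & G_{10}&: [g_4,g_2]=g_5^w,\ [g_3,g_1]=g_5^w,\ g_1^p=g_5. \end{aligned}$$ (2) Let $F$ be free of rank $3$, let $F\to G$ send the free generators to $a_1,a_2,a_3$, let $R$ be its kernel, $R^*=[R,F]R^p$, $P=F/R^*$ and $M=R/R^*$. In $P$, denote the images of the free generators again by $a_1,a_2,a_3$ and put $a_4=[a_2,a_1]$. Then there is an isomorphism $\mathbb F_p^7\cong M$ carrying the standard basis to $a_5=[a_4,a_1]$,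 $a_6=[a_4,a_2]$, $a_7=[a_3,a_1]$, $a_8=[a_3,a_2]$, $a_9=a_1^p$, $a_{10}=a_2^p$, $a_{11}=a_3^p$. Every $\alpha\in\mathrm{Aut}(G)$ acts on $M$, through any endomorphism of $P$ lifting $\alpha$, by a unique matrix $M_\alpha$ over $\mathbb F_p$ (row $j$ holds the exponents of the image of the $j$-th basis element). Let $A=\{kM_\alpha^{T}\mid k\in\mathbb F_p^*,\ \alpha\in\mathrm{Aut}(G)\}$ act on row vectors in $\mathbb F_p^7$ from the right. Then every nonzero vector lies in exactly one of the following sixteen orbits $B_i$, which have the indicated lengths: $$\begin{array}{llll} B_1=(0,1,0,0,0,0,0)^A: & p(p^2-1) & B_9=(0,1,1,0,1,0,0)^A: & \tfrac12p^2(p-1)^2(p^2-1)\\ B_2=(0,1,0,0,0,0,1)^A: & p^3(p-1)(p^2-1) & B_{10}=(0,1,1,0,w,0,0)^A: & \tfrac12p^2(p-1)^2(p^2-1)\\ B_3=(0,1,0,0,0,1,0)^A: & p(p-1)(p^2-1) & B_{11}=(0,0,0,0,0,0,1)^A: & p^2(p-1)\\ B_4=(0,1,0,0,1,0,0)^A: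 & \tfrac12p^2(p-1)(p^2-1) & B_{12}=(0,0,0,0,0,1,0)^A: & p^2-1\\ B_5=(0,1,0,0,w,0,0)^A: & \tfrac12p^2(p-1)(p^2-1) & B_{13}=(0,0,0,1,0,0,0)^A: & p^2-1\\ B_6=(0,1,1,0,0,0,0)^A: & p(p-1)(p^2-1) & B_{14}=(0,0,0,1,0,0,1)^A: & p^2(p-1)(p^2-1)\\ B_7=(0,1,1,0,0,0,1)^A: & p^3(p-1)^2(p^2-1) & B_{15}=(0,0,0,1,0,1,0)^A: & (p-1)(p^2-1)\\ B_8=(0,1,1,0,0,1,0)^A: & p(p-1)^2(p^2-1) & B_{16}=(0,0,0,1,1,0,0)^A: & p(p-1)(p^2-1) \end{array}$$ -/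

import Mathlib

namespace PGroupDescendants

open Matrix

/-- The commutator `[x, y] = x⁻¹ y⁻¹ x y`. -/
def comm {G : Type*} [Group G] (x y : G) : G := x⁻¹ * y⁻¹ * x * y

/-- The lower exponent-`p` central series: `γ₀(G) = G` and
`γ_{i+1}(G) = ⟨[h, g] k ^ p ∣ h, k ∈ γ_i(G), g ∈ G⟩`. -/
def lowerPCentral (p : ℕ) (G : Type*) [Group G] : ℕ → Subgroup G
  | 0 => ⊤
  | i + 1 => Subgroup.closure
      {x | ∃ h ∈ lowerPCentral p G i, ∃ k ∈ lowerPCentral p G i, ∃ g : G, x = comm h g * k ^ p}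

theorem normal_closure_of_conj {G : Type*} [Group G] {s : Set G}
    (hs : ∀ x ∈ s, ∀ g : G, g * x * g⁻¹ ∈ s) : (Subgroup.closure s).Normal := by
  refine ⟨fun n hn g => ?_⟩
  induction hn using Subgroup.closure_induction with
  | mem x hx => exact Subgroup.subset_closure (hs x hx g)
  | one => simp
  | mul x y _ _ hx hy => simpa [mul_assoc] using mul_mem hx hy
  | inv x _ hx => simpa [mul_assoc] using inv_mem hx

theorem conj_comm {G : Type*} [Group G] (g x y : G) :
    g * comm x y * g⁻¹ = comm (g * x * g⁻¹) (g * y * g⁻¹) := by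
  simp [comm, mul_assoc]

instance lowerPCentral_normal (p : ℕ) (G : Type*) [Group G] (i : ℕ) :
    (lowerPCentral p G i).Normal := by
  induction i with
  | zero => rw [lowerPCentral]; infer_instance
  | succ i ih =>
    rw [lowerPCentral]
    refine normal_closure_of_conj ?_
    rintro _ ⟨h, hh, k, hk, g, rfl⟩ a
    refine ⟨a * h * a⁻¹, ih.conj_mem h hh a, a * k * a⁻¹, ih.conj_mem k hk a, a * g * a⁻¹, ?_⟩
    rw [← conj_comm, conj_pow]
    simp [mul_assoc]

/-- `G` has `p`-class `c`: the series `γ_i(G)` reaches the trivial group at `i = c` for the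
first time. -/
def HasPClass (p : ℕ) (G : Type*) [Group G] (c : ℕ) : Prop :=
  IsLeast {i | lowerPCentral p G i = ⊥} c

/-- For finite `p`-groups `G` of `p`-class `c` and `H`: the group `H` is an immediate descendant
of `G` if `H ⧸ γ_c(H)` is isomorphic to `G`, both groups have the same minimal number of
generators, and `H` has `p`-class `c + 1`. -/
structure IsImmediateDescendant (p : ℕ) (H G : Type*) [Group H] [Group G] : Prop where
  finite_base : Finite G
  pGroup_base : IsPGroup p G
  finite : Finite H
  pGroup : IsPGroup p H
  rank_eq : Group.rank H = Group.rank G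
  exists_class : ∃ c : ℕ, HasPClass p G c ∧ HasPClass p H (c + 1) ∧
    Nonempty ((H ⧸ lowerPCentral p H c) ≃* G)

/-- The relators of a power-commutator presentation on generators indexed by `Fin n`:
`g_i ^ p = pw i` for all `i`, and `[g_j, g_i] = cm j i` for all `i < j`. -/
def pcRelators (p n : ℕ) (pw : Fin n → FreeGroup (Fin n))
    (cm : Fin n → Fin n → FreeGroup (Fin n)) : Set (FreeGroup (Fin n)) :=
  {r | ∃ i, r = FreeGroup.of i ^ p * (pw i)⁻¹} ∪
  {r | ∃ i j, i < j ∧ r = comm (FreeGroup.of j) (FreeGroup.of i) * (cm j i)⁻¹}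

/-- The group given by a power-commutator presentation. -/
abbrev PCGroup (p n : ℕ) (pw : Fin n → FreeGroup (Fin n))
    (cm : Fin n → Fin n → FreeGroup (Fin n)) : Type :=
  PresentedGroup (pcRelators p n pw cm)

/-- The group `⟨a₁, a₂, a₃, a₄ ∣ [a₂, a₁] = a₄⟩` (all other commutators of generators, and all
`p`-th powers of generators, are trivial). The generator `a_i` has index `i - 1`. -/
abbrev BaseGroup (p : ℕ) : Type :=
  PCGroup p 4 (fun _ => 1) (fun j i => if j = 1 ∧ i = 0 then FreeGroup.of 3 else 1)

/-- The Heisenberg group of unitriangular `3 × 3` matrices over `ZMod p`. -/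
def heisenberg (p : ℕ) : Subgroup (GL (Fin 3) (ZMod p)) where
  carrier := {A | (∀ i, A.1 i i = 1) ∧ ∀ i j, j < i → A.1 i j = 0}
  one_mem' := by
    refine ⟨fun i => by simp, fun i j h => ?_⟩
    simp [Matrix.one_apply_ne h.ne']
  mul_mem' := by
    rintro A B ⟨hA, hA'⟩ ⟨hB, hB'⟩
    refine ⟨fun i => ?_, fun i j h => ?_⟩
    · fin_cases i <;>
        simp [Matrix.mul_apply, Fin.sum_univ_three, hA, hB, hA' 1 0 (by decide),
          hA' 2 0 (by decide), hA' 2 1 (by decide), hB' 1 0 (by decide), hB' 2 0 (by decide),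
          hB' 2 1 (by decide)]
    · fin_cases i <;> fin_cases j <;> first
        | exact absurd h (by decide)
        | simp [Matrix.mul_apply, Fin.sum_univ_three, hA' 1 0 (by decide),
            hA' 2 0 (by decide), hA' 2 1 (by decide), hB' 1 0 (by decide), hB' 2 0 (by decide),
            hB' 2 1 (by decide)]
  inv_mem' := by
    rintro A ⟨hA, hA'⟩
    have key : ∀ i j, (∑ k, A.1 i k * (A⁻¹).1 k j) = (1 : Matrix (Fin 3) (Fin 3) (ZMod p)) i j := by
      intro i j
      rw [← Matrix.mul_apply, ← Units.val_mul, mul_inv_cancel, Units.val_one]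
    have h2 : ∀ j, (A⁻¹).1 2 j = (1 : Matrix (Fin 3) (Fin 3) (ZMod p)) 2 j := by
      intro j
      have := key 2 j
      simpa [Fin.sum_univ_three, hA, hA' 2 0 (by decide), hA' 2 1 (by decide)] using this
    have h1 : ∀ j, (A⁻¹).1 1 j + A.1 1 2 * (A⁻¹).1 2 j
        = (1 : Matrix (Fin 3) (Fin 3) (ZMod p)) 1 j := by
      intro j
      have := key 1 j
      simpa [Fin.sum_univ_three, hA, hA' 1 0 (by decide)] using this
    have h0 := key 0 0
    have h10 := h1 0
    have h11 := h1 1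
    have h20 := h2 0
    have h21 := h2 1
    have h22 := h2 2
    simp only [Fin.sum_univ_three, hA, one_mul, Matrix.one_apply] at h0 h10 h11 h20 h21 h22
    simp at h20 h21 h22
    simp [h20, h21] at h10 h11 h0
    refine ⟨fun i => ?_, fun i j h => ?_⟩
    · fin_cases i
      · simpa [h10, h20] using h0
      · simpa using h11
      · simpa using h22
    · fin_cases i <;> fin_cases j <;> first
        | exact absurd h (by decide)
        | simpa using h10
        | simpa using h20
        | simpa using h21

/-- The exponents occurring in the ten presentations. The row `(a, b, c₁, c₂, c₃)` stands for
`⟨g₁, …, g₅ ∣ [g₂, g₁] = g₄, [g₄, g₂] = g₅ ^ a, [g₃, g₁] = g₅ ^ b,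
g₁ ^ p = g₅ ^ c₁, g₂ ^ p = g₅ ^ c₂, g₃ ^ p = g₅ ^ c₃⟩`. -/
def exponents (w : ℕ) : Fin 10 → Fin 5 → ℕ :=
  ![![1, 0, 0, 0, 0],
    ![1, 0, 0, 0, 1],
    ![1, 0, 0, 1, 0],
    ![1, 0, 1, 0, 0],
    ![w, 0, 1, 0, 0],
    ![1, 1, 0, 0, 0],
    ![1, 1, 0, 0, 1],
    ![1, 1, 0, 1, 0],
    ![1, 1, 1, 0, 0],
    ![w, w, 1, 0, 0]]

/-- The ten groups of the list (the generator `g_i` has index `i - 1`). -/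
abbrev Descendant (p w : ℕ) (t : Fin 10) : Type :=
  PCGroup p 5
    (fun i =>
      if i = 0 then FreeGroup.of 4 ^ exponents w t 2
      else if i = 1 then FreeGroup.of 4 ^ exponents w t 3
      else if i = 2 then FreeGroup.of 4 ^ exponents w t 4
      else 1)
    (fun j i =>
      if j = 1 ∧ i = 0 then FreeGroup.of 3
      else if j = 3 ∧ i = 1 then FreeGroup.of 4 ^ exponents w t 0
      else if j = 2 ∧ i = 0 then FreeGroup.of 4 ^ exponents w t 1
      else 1)

section Cover

variable (p : ℕ) {F G : Type*} [Group F] [Group G] (θ : F →* G)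

/-- `R* = [R, F] R ^ p`, where `R` is the kernel of `θ : F → G`. -/
def relStar : Subgroup F :=
  Subgroup.closure ({x | ∃ r ∈ θ.ker, ∃ f : F, x = comm r f} ∪ {x | ∃ r ∈ θ.ker, x = r ^ p})

instance relStar_normal : (relStar p θ).Normal := by
  refine normal_closure_of_conj ?_
  rintro _ (⟨r, hr, f, rfl⟩ | ⟨r, hr, rfl⟩) g
  · exact Or.inl ⟨g * r * g⁻¹, θ.normal_ker.conj_mem r hr g, g * f * g⁻¹, conj_comm g r f⟩
  · exact Or.inr ⟨g * r * g⁻¹, θ.normal_ker.conj_mem r hr g, conj_pow.symm⟩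

/-- The `p`-cover `F ⧸ R*` (for `F` free of rank the minimal number of generators of `G` and `θ`
surjective). -/
abbrev PCover : Type _ := F ⧸ relStar p θ

/-- The `p`-multiplicator `R ⧸ R*`, as a subgroup of the `p`-cover. -/
def multiplicator : Subgroup (PCover p θ) := θ.ker.map (QuotientGroup.mk' (relStar p θ))

/-- The endomorphism `αs` of the `p`-cover is an extension of the automorphism `α` of `G`, i.e. it
replaces, in every word, each generator `x` of `F` by a word `u` with `θ u = α (θ x)`. -/
def IsExtension (α : MulAut G) (αs : PCover p θ →* PCover p θ) : Prop :=
  ∀ x y : F, αs (QuotientGroup.mk x) = QuotientGroup.mk y → θ y = α (θ x)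

end Cover

/-- The homomorphism from the free group of rank 3 to `BaseGroup p` that sends the free generators
to `a₁, a₂, a₃`. -/
def baseMap (p : ℕ) : FreeGroup (Fin 3) →* BaseGroup p :=
  FreeGroup.lift fun i => PresentedGroup.of i.castSucc

/-- The generators `a₁, a₂, a₃` of the `p`-cover of `BaseGroup p`. -/
def coverGen (p : ℕ) (i : Fin 3) : PCover p (baseMap p) := QuotientGroup.mk (FreeGroup.of i)

/-- The elements `a₅ = [a₄, a₁]`, `a₆ = [a₄, a₂]`, `a₇ = [a₃, a₁]`, `a₈ = [a₃, a₂]`, `a₉ = a₁ ^ p`,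
`a₁₀ = a₂ ^ p`, `a₁₁ = a₃ ^ p` of the `p`-cover, where `a₄ = [a₂, a₁]`. -/
def multGen (p : ℕ) : Fin 7 → PCover p (baseMap p) :=
  let a₁ := coverGen p 0
  let a₂ := coverGen p 1
  let a₃ := coverGen p 2
  let a₄ := comm a₂ a₁
  ![comm a₄ a₁, comm a₄ a₂, comm a₃ a₁, comm a₃ a₂, a₁ ^ p, a₂ ^ p, a₃ ^ p]

/-- `M` is the matrix by which `α` acts on the multiplicator through extension automorphisms, with
respect to the generators `a₅, …, a₁₁` (row `j` holds the exponents of the image of the `j`-th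
generator). -/
def IsActionMatrix (p : ℕ) (α : MulAut (BaseGroup p)) (M : Matrix (Fin 7) (Fin 7) (ZMod p)) :
    Prop :=
  ∃ αs : PCover p (baseMap p) →* PCover p (baseMap p), IsExtension p (baseMap p) α αs ∧
    ∀ j, αs (multGen p j) = (List.ofFn fun k => multGen p k ^ (M j k).val).prod

/-- The matrices of the dual action (by transposes) of the automorphism group of `BaseGroup p`,
enlarged by the nonzero scalars. -/
def scaledDual (p : ℕ) : Set (Matrix (Fin 7) (Fin 7) (ZMod p)) :=
  {N | ∃ k : (ZMod p)ˣ, ∃ α : MulAut (BaseGroup p), ∃ M, IsActionMatrix p α M ∧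
    N = (k : ZMod p) • Mᵀ}

/-- The orbit of the row vector `v` under `scaledDual p`. -/
def dualOrbit (p : ℕ) (v : Fin 7 → ZMod p) : Set (Fin 7 → ZMod p) :=
  {u | ∃ N ∈ scaledDual p, u = v ᵥ* N}

/-- The sixteen representatives of the orbits of nonzero vectors. -/
def orbitRep (p : ℕ) (w : ZMod p) : Fin 16 → Fin 7 → ZMod p :=
  ![![0, 1, 0, 0, 0, 0, 0],
    ![0, 1, 0, 0, 0, 0, 1],
    ![0, 1, 0, 0, 0, 1, 0],
    ![0, 1, 0, 0, 1, 0, 0],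
    ![0, 1, 0, 0, w, 0, 0],
    ![0, 1, 1, 0, 0, 0, 0],
    ![0, 1, 1, 0, 0, 0, 1],
    ![0, 1, 1, 0, 0, 1, 0],
    ![0, 1, 1, 0, 1, 0, 0],
    ![0, 1, 1, 0, w, 0, 0],
    ![0, 0, 0, 0, 0, 0, 1],
    ![0, 0, 0, 0, 0, 1, 0],
    ![0, 0, 0, 1, 0, 0, 0],
    ![0, 0, 0, 1, 0, 0, 1],
    ![0, 0, 0, 1, 0, 1, 0],
    ![0, 0, 0, 1, 1, 0, 0]]

/-- The lengths of the sixteen orbits, as polynomials in `p`. -/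
def orbitLength (p : ℚ) : Fin 16 → ℚ :=
  ![p * (p ^ 2 - 1),
    p ^ 3 * (p - 1) * (p ^ 2 - 1),
    p * (p - 1) * (p ^ 2 - 1),
    1 / 2 * p ^ 2 * (p - 1) * (p ^ 2 - 1),
    1 / 2 * p ^ 2 * (p - 1) * (p ^ 2 - 1),
    p * (p - 1) * (p ^ 2 - 1),
    p ^ 3 * (p - 1) ^ 2 * (p ^ 2 - 1),
    p * (p - 1) ^ 2 * (p ^ 2 - 1),
    1 / 2 * p ^ 2 * (p - 1) ^ 2 * (p ^ 2 - 1),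
    1 / 2 * p ^ 2 * (p - 1) ^ 2 * (p ^ 2 - 1),
    p ^ 2 * (p - 1),
    p ^ 2 - 1,
    p ^ 2 - 1,
    p ^ 2 * (p - 1) * (p ^ 2 - 1),
    (p - 1) * (p ^ 2 - 1),
    p * (p - 1) * (p ^ 2 - 1)]

end PGroupDescendants

set_option linter.unusedSectionVars false

namespace PGroupDescendants

open scoped Matrix

/-! The proof follows the p-group generation method. Write P for the p-cover of G, M for its
multiplicator, and N for the third term of the lower exponent-p series of P (index 2). An immediate
descendant of G of order p^5 is a quotient P/U, where U has index p in M and does not contain N. Two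
such quotients are isomorphic exactly when the subgroups U are conjugate under Aut(G). Each U is the
kernel of a nonzero linear form v on M, unique up to a scalar. This turns both claims into one orbit
problem for row vectors. The two directions of the correspondence are
`IsImmediateDescendant.isFormQuotient` and `IsFormQuotient.isImmediateDescendant`. The isomorphism
criterion is `IsFormQuotient.of_mem_dualOrbit` together with `IsFormQuotient.mem_dualOrbit`.

To find M, note that seven words define G on three generators. Their images a₅, …, a₁₁ are central
of order dividing p, so they span M (`range_multHom`). They are independent because two quotients of
P detect them (`multHom_eq_of_coords`). A group of exponent p, built from a nilpotent Lie algebra by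
the Baker-Campbell-Hausdorff formula, sees a₅, …, a₈. The abelian group (Z/p²)³ sees a₉, a₁₀, a₁₁.
The same two quotients give the matrix of an automorphism on M (`extension_multGen`), and they show
that N is spanned by a₅ and a₆ (`mem_lowerPCentral_two_cover_iff`). The relevant forms are therefore
those with (v₀, v₁) ≠ 0.

For the orbits, split v into e = (v₀, v₁), f = (v₂, v₃), c = (v₄, v₅) and v₆, and write x∧y = x₁y₂ -
x₂y₁. With A in GL₂, nonzero k and z, and arbitrary s and y, the action is e ↦ k det(A) Ae, f ↦
k(sAe + zAf), c ↦ k(Ac + v₆y), v₆ ↦ kzv₆. Vanishing of e and of v₆ is invariant. If e ≠ 0, then F =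
f∧e is multiplied by k² det(A)² z, so only its vanishing matters. If also v₆ = 0, then C = c∧e is
multiplied by the square (k det A)², so its square class is an invariant; this is the source of the
generator w. If e = 0, the vanishing of f takes the place of that of F and c∧f that of C, but c∧f
can be rescaled freely. These data separate the sixteen orbits (`mem_dualOrbit_orbitRep`). The
lengths are counted by expanding f and c in a basis containing e, or c in a basis containing f when
e = 0. -/

/-- The group on `K ^ 4` attached by the Baker-Campbell-Hausdorff formula to the Lie algebra with
the single nonzero bracket `[e₂, e₁] = e₄`. -/
@[ext] structure BaseModel (K : Type*) where
  x₁ : K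
  x₂ : K
  x₃ : K
  x₄ : K

/-- The group on `K ^ 8` attached by the Baker-Campbell-Hausdorff formula to the Lie algebra with
`[e₂, e₁] = e₄`, `[e₄, e₁] = e₅`, `[e₄, e₂] = e₆`, `[e₃, e₁] = e₇`, `[e₃, e₂] = e₈`. -/
@[ext] structure CoverModel (K : Type*) where
  x₁ : K
  x₂ : K
  x₃ : K
  x₄ : K
  x₅ : K
  x₆ : K
  x₇ : K
  x₈ : K

theorem two_ne_zero_of_twelve (K : Type*) [Field K] [NeZero (12 : K)] : (2 : K) ≠ 0 := by
  intro h
  apply NeZero.ne (12 : K)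
  linear_combination 6 * h

/-! ### Explicit coordinate models of G and of a class 3 quotient of its p-cover -/

namespace BaseModel

section

variable {K : Type*} [Field K]

instance : Mul (BaseModel K) :=
  ⟨fun x y => ⟨x.x₁ + y.x₁, x.x₂ + y.x₂, x.x₃ + y.x₃,
    x.x₄ + y.x₄ + 2⁻¹ * (x.x₂ * y.x₁ - x.x₁ * y.x₂)⟩⟩

instance : One (BaseModel K) := ⟨⟨0, 0, 0, 0⟩⟩

instance : Inv (BaseModel K) := ⟨fun x => ⟨-x.x₁, -x.x₂, -x.x₃, -x.x₄⟩⟩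

theorem mul_def (x y : BaseModel K) : x * y = ⟨x.x₁ + y.x₁, x.x₂ + y.x₂, x.x₃ + y.x₃,
    x.x₄ + y.x₄ + 2⁻¹ * (x.x₂ * y.x₁ - x.x₁ * y.x₂)⟩ := rfl

theorem one_def : (1 : BaseModel K) = ⟨0, 0, 0, 0⟩ := rfl

theorem inv_def (x : BaseModel K) : x⁻¹ = ⟨-x.x₁, -x.x₂, -x.x₃, -x.x₄⟩ := rfl

instance : Group (BaseModel K) :=
  Group.ofLeftAxioms
    (by intro x y z; ext <;> simp only [mul_def] <;> ring)
    (by intro x; ext <;> simp [mul_def, one_def])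
    (by intro x; ext <;> simp only [mul_def, one_def, inv_def] <;> ring)

/-- An element and its powers have proportional coordinates, so every bracket correction in the
product vanishes. -/
theorem pow_def (x : BaseModel K) (n : ℕ) :
    x ^ n = ⟨n * x.x₁, n * x.x₂, n * x.x₃, n * x.x₄⟩ := by
  induction n with
  | zero => simp [one_def]
  | succ n ih => rw [pow_succ, ih]; ext <;> simp only [mul_def] <;> push_cast <;> ring

theorem zpow_def (x : BaseModel K) (n : ℤ) :
    x ^ n = ⟨n * x.x₁, n * x.x₂, n * x.x₃, n * x.x₄⟩ := by
  obtain ⟨n, rfl | rfl⟩ := n.eq_nat_or_neg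
  · simp [pow_def]
  · simp [pow_def, inv_def]

theorem comm_def [NeZero (12 : K)] (x y : BaseModel K) :
    comm x y = ⟨0, 0, 0, x.x₂ * y.x₁ - x.x₁ * y.x₂⟩ := by
  have h2 := two_ne_zero_of_twelve K
  ext <;> simp only [comm, mul_def, inv_def]
  · ring
  · ring
  · ring
  · field_simp
    ring

end

theorem pow_char {p : ℕ} [Fact p.Prime] (x : BaseModel (ZMod p)) : x ^ p = 1 := by
  simp [pow_def, one_def]

/-- The coordinates as an equivalence. -/
def equivProd (K : Type*) : BaseModel K ≃ K × K × K × K where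
  toFun x := (x.x₁, x.x₂, x.x₃, x.x₄)
  invFun x := ⟨x.1, x.2.1, x.2.2.1, x.2.2.2⟩
  left_inv _ := rfl
  right_inv _ := rfl

theorem card_zmod (p : ℕ) [Fact p.Prime] : Nat.card (BaseModel (ZMod p)) = p ^ 4 := by
  rw [Nat.card_congr (equivProd (ZMod p))]
  simp only [Nat.card_prod, Nat.card_zmod]
  ring

end BaseModel

namespace CoverModel

section

variable {K : Type*} [Field K]

instance : Mul (CoverModel K) :=
  ⟨fun x y => ⟨x.x₁ + y.x₁, x.x₂ + y.x₂, x.x₃ + y.x₃,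
    x.x₄ + y.x₄ + 2⁻¹ * (x.x₂ * y.x₁ - x.x₁ * y.x₂),
    x.x₅ + y.x₅ + 2⁻¹ * (x.x₄ * y.x₁ - x.x₁ * y.x₄)
      + 12⁻¹ * (x.x₂ * y.x₁ - x.x₁ * y.x₂) * (y.x₁ - x.x₁),
    x.x₆ + y.x₆ + 2⁻¹ * (x.x₄ * y.x₂ - x.x₂ * y.x₄)
      + 12⁻¹ * (x.x₂ * y.x₁ - x.x₁ * y.x₂) * (y.x₂ - x.x₂),
    x.x₇ + y.x₇ + 2⁻¹ * (x.x₃ * y.x₁ - x.x₁ * y.x₃),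
    x.x₈ + y.x₈ + 2⁻¹ * (x.x₃ * y.x₂ - x.x₂ * y.x₃)⟩⟩

instance : One (CoverModel K) := ⟨⟨0, 0, 0, 0, 0, 0, 0, 0⟩⟩

instance : Inv (CoverModel K) :=
  ⟨fun x => ⟨-x.x₁, -x.x₂, -x.x₃, -x.x₄, -x.x₅, -x.x₆, -x.x₇, -x.x₈⟩⟩

theorem mul_def (x y : CoverModel K) : x * y = ⟨x.x₁ + y.x₁, x.x₂ + y.x₂, x.x₃ + y.x₃,
    x.x₄ + y.x₄ + 2⁻¹ * (x.x₂ * y.x₁ - x.x₁ * y.x₂),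
    x.x₅ + y.x₅ + 2⁻¹ * (x.x₄ * y.x₁ - x.x₁ * y.x₄)
      + 12⁻¹ * (x.x₂ * y.x₁ - x.x₁ * y.x₂) * (y.x₁ - x.x₁),
    x.x₆ + y.x₆ + 2⁻¹ * (x.x₄ * y.x₂ - x.x₂ * y.x₄)
      + 12⁻¹ * (x.x₂ * y.x₁ - x.x₁ * y.x₂) * (y.x₂ - x.x₂),
    x.x₇ + y.x₇ + 2⁻¹ * (x.x₃ * y.x₁ - x.x₁ * y.x₃),
    x.x₈ + y.x₈ + 2⁻¹ * (x.x₃ * y.x₂ - x.x₂ * y.x₃)⟩ := rfl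

theorem one_def : (1 : CoverModel K) = ⟨0, 0, 0, 0, 0, 0, 0, 0⟩ := rfl

theorem inv_def (x : CoverModel K) :
    x⁻¹ = ⟨-x.x₁, -x.x₂, -x.x₃, -x.x₄, -x.x₅, -x.x₆, -x.x₇, -x.x₈⟩ := rfl

theorem twelve_facts [NeZero (12 : K)] :
    (12 : K) * 12⁻¹ = 1 ∧ (2 : K)⁻¹ = 6 * 12⁻¹ := by
  have h2 := two_ne_zero_of_twelve K
  have h12 := NeZero.ne (12 : K)
  have h : (12 : K) * 12⁻¹ = 1 := mul_inv_cancel₀ h12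
  refine ⟨h, ?_⟩
  apply mul_left_cancel₀ h2
  rw [mul_inv_cancel₀ h2]
  linear_combination -h

instance [NeZero (12 : K)] : Group (CoverModel K) :=
  Group.ofLeftAxioms
    (by
      obtain ⟨h, h'⟩ := twelve_facts (K := K)
      -- With s = 1/12 and 1/2 = 6s, associativity is a polynomial identity in s up to the relation
      -- 12s = 1, which is needed only in the two coordinates of class 3.
      obtain ⟨s, hs⟩ : ∃ s, s = (12 : K)⁻¹ := ⟨_, rfl⟩
      rw [← hs] at h h'
      intro x y z
      ext <;> simp only [mul_def, h', ← hs]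
      · ring
      · ring
      · ring
      · ring
      · linear_combination 3 * s * ((x.x₂ * y.x₁ - x.x₁ * y.x₂) * z.x₁
          + x.x₁ * (y.x₂ * z.x₁ - y.x₁ * z.x₂)) * h
      · linear_combination 3 * s * ((x.x₂ * y.x₁ - x.x₁ * y.x₂) * z.x₂
          + x.x₂ * (y.x₂ * z.x₁ - y.x₁ * z.x₂)) * h
      · ring
      · ring)
    (by intro x; ext <;> simp [mul_def, one_def])
    (by intro x; ext <;> simp only [mul_def, one_def, inv_def] <;> ring)

theorem pow_def [NeZero (12 : K)] (x : CoverModel K) (n : ℕ) :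
    x ^ n = ⟨n * x.x₁, n * x.x₂, n * x.x₃, n * x.x₄, n * x.x₅, n * x.x₆, n * x.x₇, n * x.x₈⟩ := by
  induction n with
  | zero => simp [one_def]
  | succ n ih => rw [pow_succ, ih]; ext <;> simp only [mul_def] <;> push_cast <;> ring

/-- The remaining four coordinates are left out: when a further commutator is taken, only x₃ and x₄
of the inner one matter. -/
theorem comm_def [NeZero (12 : K)] (x y : CoverModel K) :
    (comm x y).x₁ = 0 ∧ (comm x y).x₂ = 0 ∧ (comm x y).x₃ = 0 ∧
    (comm x y).x₄ = x.x₂ * y.x₁ - x.x₁ * y.x₂ := by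
  have h2 := two_ne_zero_of_twelve K
  refine ⟨?_, ?_, ?_, ?_⟩ <;> simp only [comm, mul_def, inv_def]
  · ring
  · ring
  · ring
  · field_simp
    ring

/-- Without e₁ and e₂ components, the bracket of x with anything is central, so the group commutator
is exactly the Lie bracket. -/
theorem comm_of_x₁_x₂ [NeZero (12 : K)] (x y : CoverModel K) (h₁ : x.x₁ = 0) (h₂ : x.x₂ = 0) :
    comm x y = ⟨0, 0, 0, 0, x.x₄ * y.x₁, x.x₄ * y.x₂, x.x₃ * y.x₁, x.x₃ * y.x₂⟩ := by
  have h2 := two_ne_zero_of_twelve K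
  ext <;> simp only [comm, mul_def, inv_def, h₁, h₂]
  · ring
  · ring
  · ring
  · ring
  · field_simp
    ring
  · field_simp
    ring
  · field_simp
    ring
  · field_simp
    ring

end

theorem pow_char {p : ℕ} [Fact p.Prime] [NeZero (12 : ZMod p)] (x : CoverModel (ZMod p)) :
    x ^ p = 1 := by
  simp [pow_def, one_def]

/-- The projection of the cover model onto the base model. -/
def toBase {K : Type*} [Field K] [NeZero (12 : K)] : CoverModel K →* BaseModel K where
  toFun x := ⟨x.x₁, x.x₂, x.x₃, x.x₄⟩
  map_one' := rfl
  map_mul' _ _ := rfl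

theorem toBase_apply {K : Type*} [Field K] [NeZero (12 : K)] (x : CoverModel K) :
    toBase x = ⟨x.x₁, x.x₂, x.x₃, x.x₄⟩ := rfl

end CoverModel


/-! ### Groups given by power-commutator presentations -/

section Presented

theorem comm_eq_one_iff {G : Type*} [Group G] (x y : G) : comm x y = 1 ↔ Commute x y := by
  rw [commute_iff_eq, comm, mul_assoc, mul_eq_one_iff_inv_eq]
  simp only [mul_inv_rev, inv_inv]
  exact eq_comm

theorem map_comm {G H : Type*} [Group G] [Group H] (f : G →* H) (x y : G) :
    f (comm x y) = comm (f x) (f y) := by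
  simp [comm]

/-- The homomorphism out of a group given by a power-commutator presentation. -/
theorem PCGroup.exists_lift {p n : ℕ} {pw : Fin n → FreeGroup (Fin n)}
    {cm : Fin n → Fin n → FreeGroup (Fin n)} {H : Type*} [Group H] (h : Fin n → H)
    (hpow : ∀ i, h i ^ p = FreeGroup.lift h (pw i))
    (hcomm : ∀ i j, i < j → comm (h j) (h i) = FreeGroup.lift h (cm j i)) :
    ∃ f : PCGroup p n pw cm →* H, ∀ i, f (PresentedGroup.of i) = h i := by
  have key : ∀ r ∈ pcRelators p n pw cm, FreeGroup.lift h r = 1 := by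
    rintro r (⟨i, rfl⟩ | ⟨i, j, hij, rfl⟩)
    · simp [hpow]
    · simp [map_comm, hcomm i j hij]
  exact ⟨PresentedGroup.toGroup key, fun i => PresentedGroup.toGroup.of key⟩

theorem PCGroup.pow_eq {p n : ℕ} (pw : Fin n → FreeGroup (Fin n))
    (cm : Fin n → Fin n → FreeGroup (Fin n)) (i : Fin n) :
    (PresentedGroup.of i : PCGroup p n pw cm) ^ p = PresentedGroup.mk _ (pw i) := by
  have : PresentedGroup.mk (pcRelators p n pw cm) (FreeGroup.of i ^ p * (pw i)⁻¹) = 1 :=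
    PresentedGroup.one_of_mem (Or.inl ⟨i, rfl⟩)
  rw [map_mul, map_inv, mul_inv_eq_one, map_pow] at this
  exact this

theorem PCGroup.comm_eq {p n : ℕ} (pw : Fin n → FreeGroup (Fin n))
    (cm : Fin n → Fin n → FreeGroup (Fin n)) {i j : Fin n} (hij : i < j) :
    comm (PresentedGroup.of j : PCGroup p n pw cm) (PresentedGroup.of i) =
      PresentedGroup.mk _ (cm j i) := by
  have : PresentedGroup.mk (pcRelators p n pw cm)
      (comm (FreeGroup.of j) (FreeGroup.of i) * (cm j i)⁻¹) = 1 :=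
    PresentedGroup.one_of_mem (Or.inr ⟨i, j, hij, rfl⟩)
  rw [map_mul, map_inv, mul_inv_eq_one, map_comm] at this
  exact this

theorem PCGroup.induction {p n : ℕ} {pw : Fin n → FreeGroup (Fin n)}
    {cm : Fin n → Fin n → FreeGroup (Fin n)} (S : Subgroup (PCGroup p n pw cm))
    (h : ∀ i, PresentedGroup.of i ∈ S) : S = ⊤ := by
  rw [eq_top_iff, ← PresentedGroup.closure_range_of, Subgroup.closure_le]
  rintro _ ⟨i, rfl⟩
  exact h i

theorem PCGroup.commute_of_gens {p n : ℕ} {pw : Fin n → FreeGroup (Fin n)}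
    {cm : Fin n → Fin n → FreeGroup (Fin n)} {z : PCGroup p n pw cm}
    (h : ∀ i, Commute z (PresentedGroup.of i)) (x : PCGroup p n pw cm) : Commute z x := by
  have : Subgroup.centralizer {z} = ⊤ := PCGroup.induction _ fun i => by
    rw [Subgroup.mem_centralizer_singleton_iff]
    exact (h i).eq.symm
  have hx : x ∈ Subgroup.centralizer {z} := this ▸ Subgroup.mem_top x
  exact (Subgroup.mem_centralizer_singleton_iff.1 hx).symm

end Presented

/-! ### Normal forms in the base group -/

section Base

variable (p : ℕ)

/-- The generators of the base group. -/
def baseGen (i : Fin 4) : BaseGroup p := PresentedGroup.of i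

theorem baseGen_pow (i : Fin 4) : baseGen p i ^ p = 1 := by
  have := PCGroup.pow_eq (p := p) (fun _ : Fin 4 => (1 : FreeGroup (Fin 4)))
    (fun j i => if j = 1 ∧ i = 0 then FreeGroup.of 3 else 1) i
  exact this.trans (map_one _)

theorem comm_baseGen {i j : Fin 4} (h : i < j) : comm (baseGen p j) (baseGen p i) =
    if j = 1 ∧ i = 0 then baseGen p 3 else 1 := by
  have := PCGroup.comm_eq (p := p) (fun _ : Fin 4 => (1 : FreeGroup (Fin 4)))
    (fun j i => if j = 1 ∧ i = 0 then FreeGroup.of 3 else 1) h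
  refine this.trans ?_
  split_ifs <;> rfl

theorem commute_baseGen {i j : Fin 4} (h : i < j) (h' : ¬(j = 1 ∧ i = 0)) :
    Commute (baseGen p j) (baseGen p i) :=
  (comm_eq_one_iff _ _).1 (by rw [comm_baseGen p h, if_neg h'])

theorem commute_baseGen_two (x : BaseGroup p) : Commute (baseGen p 2) x := by
  refine PCGroup.commute_of_gens (fun i => ?_) x
  fin_cases i
  · exact commute_baseGen p (i := 0) (by decide) (by decide)
  · exact commute_baseGen p (i := 1) (by decide) (by decide)
  · exact Commute.refl _
  · exact (commute_baseGen p (i := 2) (j := 3) (by decide) (by decide)).symm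

theorem commute_baseGen_three (x : BaseGroup p) : Commute (baseGen p 3) x := by
  refine PCGroup.commute_of_gens (fun i => ?_) x
  fin_cases i
  · exact commute_baseGen p (i := 0) (by decide) (by decide)
  · exact commute_baseGen p (i := 1) (by decide) (by decide)
  · exact commute_baseGen p (i := 2) (by decide) (by decide)
  · exact Commute.refl _

theorem baseGen_one_mul_zero :
    baseGen p 1 * baseGen p 0 = baseGen p 0 * baseGen p 1 * baseGen p 3 := by
  have h := comm_baseGen p (i := 0) (j := 1) (by decide)
  rw [if_pos ⟨rfl, rfl⟩, comm] at h
  rw [← h]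
  group

theorem baseGen_one_zpow_mul_zero (j : ℤ) : baseGen p 1 ^ j * baseGen p 0 =
    baseGen p 0 * baseGen p 1 ^ j * baseGen p 3 ^ j := by
  have h : (baseGen p 0)⁻¹ * baseGen p 1 * baseGen p 0 = baseGen p 1 * baseGen p 3 := by
    rw [mul_assoc, baseGen_one_mul_zero]
    group
  have h2 : ((baseGen p 0)⁻¹ * baseGen p 1 * baseGen p 0) ^ j
      = (baseGen p 0)⁻¹ * baseGen p 1 ^ j * baseGen p 0 := by
    simpa using conj_zpow (a := (baseGen p 0)⁻¹) (b := baseGen p 1) (i := j)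
  rw [h, (commute_baseGen_three p _).symm.mul_zpow] at h2
  rw [mul_assoc, h2]
  group

/-- Conjugating a₁ by a₂ʲ multiplies it by the central element a₄ʲ; the formula is the e-th power of
this relation. -/
theorem baseGen_one_zpow_mul_zero_zpow (j e : ℤ) : baseGen p 1 ^ j * baseGen p 0 ^ e =
    baseGen p 0 ^ e * baseGen p 1 ^ j * baseGen p 3 ^ (j * e) := by
  have h : baseGen p 1 ^ j * baseGen p 0 * (baseGen p 1 ^ j)⁻¹ =
      baseGen p 0 * baseGen p 3 ^ j := by
    rw [baseGen_one_zpow_mul_zero, mul_assoc, mul_assoc,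
      ((commute_baseGen_three p (baseGen p 1 ^ j)⁻¹).zpow_left j).eq]
    group
  have h2 := conj_zpow (a := baseGen p 1 ^ j) (b := baseGen p 0) (i := e)
  rw [h, (((commute_baseGen_three p _).zpow_left j).symm).mul_zpow, ← zpow_mul,
    eq_mul_inv_iff_mul_eq, mul_assoc, ((commute_baseGen_three p _).zpow_left _).eq,
    ← mul_assoc] at h2
  exact h2.symm

/-- Every element of the base group is a product of powers of the generators. -/
theorem baseGroup_normalForm (x : BaseGroup p) : ∃ i j k l : ℤ,
    x = baseGen p 0 ^ i * baseGen p 1 ^ j * baseGen p 2 ^ k * baseGen p 3 ^ l := by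
  have c2 := commute_baseGen_two p
  have c3 := commute_baseGen_three p
  -- Normal forms are stable under right multiplication by any power of a generator; the exponents 1
  -- and -1 then give the induction over words.
  have step : ∀ (e : ℤ) (g : Fin 4) (x : BaseGroup p), (∃ i j k l : ℤ,
      x = baseGen p 0 ^ i * baseGen p 1 ^ j * baseGen p 2 ^ k * baseGen p 3 ^ l) →
      ∃ i j k l : ℤ, x * baseGen p g ^ e =
        baseGen p 0 ^ i * baseGen p 1 ^ j * baseGen p 2 ^ k * baseGen p 3 ^ l := by
    rintro e g x ⟨i, j, k, l, rfl⟩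
    fin_cases g
    · refine ⟨i + e, j, k, j * e + l, ?_⟩
      change _ * _ ^ k * _ ^ l * baseGen p 0 ^ e = _
      rw [mul_assoc, ((c3 (baseGen p 0 ^ e)).zpow_left l).eq, ← mul_assoc,
        mul_assoc _ (_ ^ k), ((c2 (baseGen p 0 ^ e)).zpow_left k).eq, ← mul_assoc,
        mul_assoc _ (_ ^ j), baseGen_one_zpow_mul_zero_zpow, zpow_add, zpow_add]
      simp only [mul_assoc]
      congr 3
      rw [← mul_assoc, ((c3 (baseGen p 2 ^ k)).zpow_left (j * e)).eq, mul_assoc]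
    · refine ⟨i, j + e, k, l, ?_⟩
      change _ * _ ^ k * _ ^ l * baseGen p 1 ^ e = _
      rw [mul_assoc, ((c3 (baseGen p 1 ^ e)).zpow_left l).eq, ← mul_assoc,
        mul_assoc _ (_ ^ k), ((c2 (baseGen p 1 ^ e)).zpow_left k).eq, ← mul_assoc,
        mul_assoc _ (_ ^ j), ← zpow_add]
    · refine ⟨i, j, k + e, l, ?_⟩
      change _ * _ ^ k * _ ^ l * baseGen p 2 ^ e = _
      rw [mul_assoc, ((c3 (baseGen p 2 ^ e)).zpow_left l).eq, ← mul_assoc,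
        mul_assoc _ (_ ^ k), ← zpow_add]
    · refine ⟨i, j, k, l + e, ?_⟩
      change _ * baseGen p 3 ^ e = _
      rw [mul_assoc, ← zpow_add]
  have hx : x ∈ Subgroup.closure (Set.range (baseGen p)) :=
    (PresentedGroup.closure_range_of _ : Subgroup.closure (Set.range (baseGen p)) = ⊤) ▸
      Subgroup.mem_top x
  induction hx using Subgroup.closure_induction_right with
  | one => exact ⟨0, 0, 0, 0, by simp⟩
  | mul_right x hx y hy ih =>
    obtain ⟨g, rfl⟩ := hy
    simpa using step 1 g x ih
  | mul_inv_cancel x hx y hy ih =>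
    obtain ⟨g, rfl⟩ := hy
    simpa using step (-1) g x ih

/-- Homomorphisms out of the base group. -/
theorem BaseGroup.exists_lift {H : Type*} [Group H] (h : Fin 4 → H)
    (hpow : ∀ i, h i ^ p = 1) (h10 : comm (h 1) (h 0) = h 3) (h20 : comm (h 2) (h 0) = 1)
    (h30 : comm (h 3) (h 0) = 1) (h21 : comm (h 2) (h 1) = 1) (h31 : comm (h 3) (h 1) = 1)
    (h32 : comm (h 3) (h 2) = 1) : ∃ f : BaseGroup p →* H, ∀ i, f (baseGen p i) = h i := by
  refine PCGroup.exists_lift h (fun i => by simpa using hpow i) fun i j hij => ?_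
  fin_cases i <;> fin_cases j <;> first
    | exact absurd hij (by decide)
    | simpa

end Base

/-! ### Identification of the base group with its model and with C_p × Heisenberg -/

section BaseEquiv

variable (p : ℕ) [Fact p.Prime] [NeZero (12 : ZMod p)]

namespace BaseModel

/-- The images of the generators of the base group. -/
def gen : Fin 4 → BaseModel (ZMod p) :=
  ![⟨1, 0, 0, 0⟩, ⟨0, 1, 0, 0⟩, ⟨0, 0, 1, 0⟩, ⟨0, 0, 0, 1⟩]

end BaseModel

theorem exists_baseHom : ∃ f : BaseGroup p →* BaseModel (ZMod p),
    ∀ i, f (baseGen p i) = BaseModel.gen p i :=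
  BaseGroup.exists_lift p _ (fun i => BaseModel.pow_char _)
    (by simp [BaseModel.comm_def, BaseModel.gen]) (by simp [BaseModel.comm_def, BaseModel.gen]; rfl)
    (by simp [BaseModel.comm_def, BaseModel.gen]; rfl)
    (by simp [BaseModel.comm_def, BaseModel.gen]; rfl)
    (by simp [BaseModel.comm_def, BaseModel.gen]; rfl)
    (by simp [BaseModel.comm_def, BaseModel.gen]; rfl)

/-- The coordinates determine the exponents of a normal form modulo p, and the generators have
trivial p-th power, so the map to the model is injective. -/
theorem exists_baseEquiv : ∃ f : BaseGroup p ≃* BaseModel (ZMod p),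
    ∀ i, f (baseGen p i) = BaseModel.gen p i := by
  obtain ⟨f, hf⟩ := exists_baseHom p
  -- The correction by ij/2 is the bracket term in the product of a₁ⁱ and a₂ʲ.
  have key : ∀ i j k l : ℤ, f (baseGen p 0 ^ i * baseGen p 1 ^ j * baseGen p 2 ^ k *
      baseGen p 3 ^ l) = ⟨i, j, k, l - 2⁻¹ * (i * j)⟩ := by
    intro i j k l
    simp only [map_mul, map_zpow, hf, BaseModel.zpow_def]
    ext <;> simp [BaseModel.gen, BaseModel.mul_def]
    ring
  have hinj : Function.Injective f := by
    rw [injective_iff_map_eq_one]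
    intro x hx
    obtain ⟨i, j, k, l, rfl⟩ := baseGroup_normalForm p x
    rw [key, BaseModel.one_def] at hx
    simp only [BaseModel.mk.injEq] at hx
    obtain ⟨hi, hj, hk, hl⟩ := hx
    rw [hi] at hl
    have hl : ((l : ℤ) : ZMod p) = 0 := by simpa using hl
    have one : ∀ (g : Fin 4) (n : ℤ), (n : ZMod p) = 0 → baseGen p g ^ n = 1 := by
      intro g n hn
      obtain ⟨m, rfl⟩ := (ZMod.intCast_zmod_eq_zero_iff_dvd _ p).1 hn
      rw [zpow_mul, zpow_natCast, baseGen_pow, one_zpow]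
    simp [one, hi, hj, hk, hl]
  have hsurj : Function.Surjective f := by
    rintro ⟨a, b, c, d⟩
    obtain ⟨i, rfl⟩ := ZMod.intCast_surjective a
    obtain ⟨j, rfl⟩ := ZMod.intCast_surjective b
    obtain ⟨k, rfl⟩ := ZMod.intCast_surjective c
    obtain ⟨l, hl⟩ := ZMod.intCast_surjective (d + 2⁻¹ * (i * j) : ZMod p)
    refine ⟨_, (key i j k l).trans ?_⟩
    rw [hl]
    ext <;> simp
  exact ⟨MulEquiv.ofBijective f ⟨hinj, hsurj⟩, hf⟩

/-- The coordinates on the base group. -/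
noncomputable def baseEquiv : BaseGroup p ≃* BaseModel (ZMod p) := (exists_baseEquiv p).choose

theorem baseEquiv_gen (i : Fin 4) : baseEquiv p (baseGen p i) = BaseModel.gen p i :=
  (exists_baseEquiv p).choose_spec i

/-- The unitriangular matrix of an element of the base model. -/
def BaseModel.toMatrix (x : BaseModel (ZMod p)) : Matrix (Fin 3) (Fin 3) (ZMod p) :=
  !![1, x.x₂, x.x₄ + 2⁻¹ * (x.x₁ * x.x₂); 0, 1, x.x₁; 0, 0, 1]

/-- The matrix is exp N for the strictly upper triangular N with entries x₂, x₄, x₁ (N²/2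
contributes x₁x₂/2), so this is the Baker-Campbell-Hausdorff formula in class 2. -/
theorem BaseModel.toMatrix_mul (x y : BaseModel (ZMod p)) :
    (x * y).toMatrix p = x.toMatrix p * y.toMatrix p := by
  have h2 := two_ne_zero_of_twelve (ZMod p)
  ext i j
  fin_cases i <;> fin_cases j <;>
    simp [BaseModel.toMatrix, BaseModel.mul_def, Matrix.mul_apply, Fin.sum_univ_three]
  · ring
  · field_simp
    ring
  · ring

theorem base_equiv_prod : Nonempty (BaseGroup p ≃* Multiplicative (ZMod p) × heisenberg p) := by
  let u : BaseModel (ZMod p) →* GL (Fin 3) (ZMod p) := MonoidHom.toHomUnits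
    { toFun := BaseModel.toMatrix p
      map_one' := by
        ext i j
        fin_cases i <;> fin_cases j <;> simp [BaseModel.toMatrix, BaseModel.one_def]
      map_mul' := BaseModel.toMatrix_mul p }
  have hu : ∀ x, (u x).1 = x.toMatrix p := fun x => rfl
  let v : BaseModel (ZMod p) →* heisenberg p := u.codRestrict _ fun x => by
    refine ⟨fun i => ?_, fun i j h => ?_⟩
    · change x.toMatrix p i i = 1
      fin_cases i <;> simp [BaseModel.toMatrix]
    · change x.toMatrix p i j = 0
      fin_cases i <;> fin_cases j <;> first
        | exact absurd h (by decide)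
        | simp [BaseModel.toMatrix]
  let c : BaseModel (ZMod p) →* Multiplicative (ZMod p) :=
    { toFun := fun x => Multiplicative.ofAdd x.x₃
      map_one' := rfl
      map_mul' := fun _ _ => rfl }
  have hv : ∀ x, (v x).1.1 = x.toMatrix p := fun x => rfl
  refine ⟨(baseEquiv p).trans (MulEquiv.ofBijective (c.prod v) ⟨?_, ?_⟩)⟩
  · rw [injective_iff_map_eq_one]
    intro x hx
    have h1 : x.x₃ = 0 := congrArg Prod.fst hx
    have h2 : x.toMatrix p = 1 := by
      have : v x = 1 := congrArg Prod.snd hx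
      rw [← hv, this]
      rfl
    have h3 := congrFun (congrFun h2 0) 1
    have h4 := congrFun (congrFun h2 1) 2
    have h5 := congrFun (congrFun h2 0) 2
    simp [BaseModel.toMatrix] at h3 h4 h5
    simp [h3] at h5
    ext <;> assumption
  · rintro ⟨a, ⟨A, hA⟩⟩
    obtain ⟨hA1, hA2⟩ := hA
    refine ⟨⟨A.1 1 2, A.1 0 1, a.toAdd, A.1 0 2 - 2⁻¹ * (A.1 1 2 * A.1 0 1)⟩, ?_⟩
    refine Prod.ext rfl (Subtype.ext (Units.ext ?_))
    refine (hv _).trans ?_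
    ext i j
    fin_cases i <;> fin_cases j <;> simp [BaseModel.toMatrix, hA1, hA2]

theorem card_baseGroup : Nat.card (BaseGroup p) = p ^ 4 := by
  rw [Nat.card_congr (baseEquiv p).toEquiv, BaseModel.card_zmod]

end BaseEquiv

/-! ### Central elements of order dividing p as a vector space -/

section TorsionCenter

/-- The central elements whose `p`-th power is trivial. -/
def torsionCenter (p : ℕ) (H : Type*) [Group H] : Subgroup H where
  carrier := {z | (∀ x, Commute z x) ∧ z ^ p = 1}
  one_mem' := ⟨fun x => Commute.one_left x, one_pow p⟩
  mul_mem' := by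
    rintro a b ⟨ha, ha'⟩ ⟨hb, hb'⟩
    exact ⟨fun x => (ha x).mul_left (hb x), by rw [(ha b).mul_pow, ha', hb', one_mul]⟩
  inv_mem' := by
    rintro a ⟨ha, ha'⟩
    exact ⟨fun x => (ha x).inv_left, by rw [inv_pow, ha', inv_one]⟩

variable {p : ℕ} {H : Type*} [Group H]

theorem normal_of_le_torsionCenter {T : Subgroup H} (h : T ≤ torsionCenter p H) : T.Normal :=
  ⟨fun n hn g => by rw [← ((h hn).1 g).eq, mul_inv_cancel_right]; exact hn⟩

/-- The product of powers `∏ z k ^ v k` of elements of the torsion center. -/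
noncomputable def tupleHom [NeZero p] {n : ℕ} (z : Fin n → H)
    (hz : ∀ k, z k ∈ torsionCenter p H) : Multiplicative (Fin n → ZMod p) →* H where
  toFun v := (List.ofFn fun k => z k ^ (v.toAdd k).val).prod
  map_one' := by
    refine List.prod_eq_one fun x hx => ?_
    obtain ⟨k, rfl⟩ := (List.mem_ofFn' _ _).1 hx
    simp
  map_mul' u v := by
    induction n with
    | zero => simp
    | succ n ih =>
      have h1 := ih (fun k => z k.succ) (fun k => hz _)
        (Multiplicative.ofAdd fun k => u.toAdd k.succ) (Multiplicative.ofAdd fun k => v.toAdd k.succ)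
      simp only [List.ofFn_succ, List.prod_cons]
      refine (congrArg _ h1).trans ?_
      -- Representatives in {0, …, p-1} add only modulo p, which is harmless because the p-th power
      -- of `z 0` is trivial.
      have h2 : z 0 ^ ((u * v).toAdd 0).val = z 0 ^ (u.toAdd 0).val * z 0 ^ (v.toAdd 0).val := by
        rw [← pow_add, toAdd_mul, Pi.add_apply, ZMod.val_add]
        exact (pow_eq_pow_mod _ (hz 0).2).symm
      rw [h2, mul_assoc, mul_assoc]
      congr 1
      rw [← mul_assoc, ← mul_assoc]
      congr 1
      exact ((hz 0).1 _).pow_left _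

theorem tupleHom_apply [NeZero p] {n : ℕ} (z : Fin n → H) (hz : ∀ k, z k ∈ torsionCenter p H)
    (v : Fin n → ZMod p) : tupleHom z hz (Multiplicative.ofAdd v) =
      (List.ofFn fun k => z k ^ (v k).val).prod := rfl

theorem tupleHom_single [Fact p.Prime] {n : ℕ} (z : Fin n → H)
    (hz : ∀ k, z k ∈ torsionCenter p H) (j : Fin n) :
    tupleHom z hz (Multiplicative.ofAdd (Pi.single j 1)) = z j := by
  rw [tupleHom_apply]
  induction n with
  | zero => exact j.elim0
  | succ n ih =>
    rw [List.ofFn_succ, List.prod_cons]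
    induction j using Fin.cases with
    | zero =>
      rw [Pi.single_eq_same, ZMod.val_one, pow_one]
      convert mul_one _
      refine List.prod_eq_one fun x hx => ?_
      obtain ⟨k, rfl⟩ := (List.mem_ofFn' _ _).1 hx
      simp
    | succ j =>
      rw [Pi.single_eq_of_ne (Fin.succ_ne_zero j).symm, ZMod.val_zero, pow_zero, one_mul]
      refine Eq.trans ?_ (ih (fun k => z k.succ) (fun k => hz _) j)
      congr 2
      funext k
      simp [Pi.single_apply]

theorem tuple_hom_ext [NeZero p] {n : ℕ} {f g : Multiplicative (Fin n → ZMod p) →* H}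
    (h : ∀ j, f (Multiplicative.ofAdd (Pi.single j 1)) = g (Multiplicative.ofAdd (Pi.single j 1))) :
    f = g := by
  refine MonoidHom.ext fun v => ?_
  have hv : v ∈ f.eqLocus g := by
    have : v = ∏ j, Multiplicative.ofAdd (Pi.single j (1 : ZMod p)) ^ (v.toAdd j).val := by
      apply Multiplicative.toAdd.injective
      rw [toAdd_prod]
      ext k
      simp only [toAdd_pow, toAdd_ofAdd, Finset.sum_apply, Pi.smul_apply]
      simp [Pi.single_apply]
    rw [this]
    exact Subgroup.prod_mem _ fun j _ => Subgroup.pow_mem _ (h j) _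
  exact hv

end TorsionCenter

/-! ### The p-cover: universal property and spanning set of the multiplicator -/

section CoverGeneral

/-- The seven words defining the base group as a quotient of a free group of rank 3. -/
def relTuple (p : ℕ) {H : Type*} [Group H] (h : Fin 3 → H) : Fin 7 → H :=
  ![comm (comm (h 1) (h 0)) (h 0), comm (comm (h 1) (h 0)) (h 1), comm (h 2) (h 0),
    comm (h 2) (h 1), h 0 ^ p, h 1 ^ p, h 2 ^ p]

variable (p : ℕ)

theorem multGen_eq : multGen p = relTuple p (coverGen p) := rfl

theorem map_relTuple {H H' : Type*} [Group H] [Group H'] (f : H →* H') (h : Fin 3 → H)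
    (j : Fin 7) : f (relTuple p h j) = relTuple p (fun i => f (h i)) j := by
  fin_cases j <;> simp [relTuple, map_comm]

/-- Conjugation by y sends x to x[x, y], and both elements have trivial p-th power; since the
factors commute, [x, y] also has trivial p-th power. -/
theorem comm_pow_eq_one {H : Type*} [Group H] {x y : H} (hc : Commute (comm x y) x)
    (hx : x ^ p = 1) : comm x y ^ p = 1 := by
  have h1 : y⁻¹ * x * y = x * comm x y := by simp only [comm]; group
  have h2 : (y⁻¹ * x * y) ^ p = 1 := by
    have := conj_pow (a := y⁻¹) (b := x) (i := p)
    rw [inv_inv] at this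
    rw [this, hx]
    simp
  rwa [h1, hc.symm.mul_pow, hx, one_mul] at h2

theorem comm_eq_one_of_commute {H : Type*} [Group H] {a b c : H} (hac : Commute a c)
    (hbc : Commute b c) : Commute (comm a b) c := by
  unfold comm
  exact ((hac.inv_left.mul_left hbc.inv_left).mul_left hac).mul_left hbc

/-- The seven words imply the rest of the presentation: a₄ commutes with a₃ because a₁ and a₂ do,
and its p-th power is trivial by `comm_pow_eq_one`. -/
theorem exists_hom_of_relTuple_eq_one {H : Type*} [Group H] (h : Fin 3 → H)
    (hr : ∀ j, relTuple p h j = 1) :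
    ∃ f : BaseGroup p →* H, ∀ i, f (baseGen p i) = ![h 0, h 1, h 2, comm (h 1) (h 0)] i := by
  have h0 : Commute (comm (h 1) (h 0)) (h 0) := (comm_eq_one_iff _ _).1 (hr 0)
  have h1 : Commute (comm (h 1) (h 0)) (h 1) := (comm_eq_one_iff _ _).1 (hr 1)
  have h2 : Commute (h 2) (h 0) := (comm_eq_one_iff _ _).1 (hr 2)
  have h3 : Commute (h 2) (h 1) := (comm_eq_one_iff _ _).1 (hr 3)
  have h4 : h 0 ^ p = 1 := hr 4
  have h5 : h 1 ^ p = 1 := hr 5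
  have h6 : h 2 ^ p = 1 := hr 6
  refine BaseGroup.exists_lift p _ (fun i => ?_) rfl ?_ ?_ ?_ ?_ ?_
  · fin_cases i
    · exact h4
    · exact h5
    · exact h6
    · exact comm_pow_eq_one p h1 h5
  · exact hr 2
  · exact hr 0
  · exact hr 3
  · exact hr 1
  · exact (comm_eq_one_iff _ _).2 (comm_eq_one_of_commute h3.symm h2.symm)

theorem baseMap_of (i : Fin 3) : baseMap p (FreeGroup.of i) = baseGen p i.castSucc := by
  simp [baseMap, baseGen]

theorem comm_baseGen_one_zero : comm (baseGen p 1) (baseGen p 0) = baseGen p 3 := by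
  rw [comm_baseGen p (by decide), if_pos ⟨rfl, rfl⟩]

theorem baseMap_surjective : Function.Surjective (baseMap p) := by
  rw [← MonoidHom.range_eq_top]
  refine PCGroup.induction _ fun i => ?_
  have h : ∀ i : Fin 3, baseGen p i.castSucc ∈ (baseMap p).range := fun i => ⟨_, baseMap_of p i⟩
  change baseGen p i ∈ _
  fin_cases i
  · exact h 0
  · exact h 1
  · exact h 2
  · change baseGen p 3 ∈ _
    rw [← comm_baseGen_one_zero]
    exact ⟨comm (FreeGroup.of 1) (FreeGroup.of 0), by
      rw [map_comm, baseMap_of, baseMap_of]; rfl⟩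

/-- The kernel of `baseMap` is the normal closure of the seven words. -/
theorem map_mem_of_relTuple_mem {H : Type*} [Group H] (φ : FreeGroup (Fin 3) →* H)
    (T : Subgroup H) [T.Normal] (hT : ∀ j, relTuple p (fun i => φ (FreeGroup.of i)) j ∈ T)
    {r : FreeGroup (Fin 3)} (hr : r ∈ (baseMap p).ker) : φ r ∈ T := by
  obtain ⟨f, hf⟩ := exists_hom_of_relTuple_eq_one p
    (fun i => QuotientGroup.mk' T (φ (FreeGroup.of i))) fun j => by
      rw [← map_relTuple]
      exact (QuotientGroup.eq_one_iff _).2 (hT j)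
  have : f.comp (baseMap p) = (QuotientGroup.mk' T).comp φ := by
    ext i
    rw [MonoidHom.comp_apply, baseMap_of, hf]
    fin_cases i <;> rfl
  rw [← QuotientGroup.eq_one_iff]
  have h2 := DFunLike.congr_fun this r
  rw [MonoidHom.comp_apply, MonoidHom.mem_ker.1 hr, map_one] at h2
  exact h2.symm

theorem relStar_le_ker {H : Type*} [Group H] (φ : FreeGroup (Fin 3) →* H)
    (h : ∀ r ∈ (baseMap p).ker, φ r ∈ torsionCenter p H) : relStar p (baseMap p) ≤ φ.ker := by
  unfold relStar
  rw [Subgroup.closure_le]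
  rintro _ (⟨r, hr, f, rfl⟩ | ⟨r, hr, rfl⟩)
  · simp only [SetLike.mem_coe, MonoidHom.mem_ker, map_comm]
    exact (comm_eq_one_iff _ _).2 ((h r hr).1 _)
  · simp only [SetLike.mem_coe, MonoidHom.mem_ker, map_pow]
    exact (h r hr).2

theorem relStar_le_ker_baseMap : relStar p (baseMap p) ≤ (baseMap p).ker :=
  relStar_le_ker p _ fun r hr => by rw [MonoidHom.mem_ker.1 hr]; exact one_mem _

theorem cover_exists_lift {H : Type*} [Group H] (h : Fin 3 → H)
    (hr : ∀ r ∈ (baseMap p).ker, FreeGroup.lift h r ∈ torsionCenter p H) :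
    ∃ f : PCover p (baseMap p) →* H, ∀ i, f (coverGen p i) = h i :=
  ⟨QuotientGroup.lift _ (FreeGroup.lift h) (relStar_le_ker p _ hr), fun i => by
    change FreeGroup.lift h (FreeGroup.of i) = h i
    simp⟩

/-- The torsion center is normal and R is the normal closure of the seven words, so testing these
words is enough. Homomorphisms to concrete groups are obtained in this way. -/
theorem cover_exists_lift_of_relTuple {H : Type*} [Group H] (h : Fin 3 → H)
    (hr : ∀ j, relTuple p h j ∈ torsionCenter p H) :
    ∃ f : PCover p (baseMap p) →* H, ∀ i, f (coverGen p i) = h i := by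
  have : (torsionCenter p H).Normal := normal_of_le_torsionCenter le_rfl
  exact cover_exists_lift p h fun r hr' => map_mem_of_relTuple_mem p _ _ (by simpa using hr) hr'

theorem cover_hom_ext {H : Type*} [Group H] {f g : PCover p (baseMap p) →* H}
    (h : ∀ i, f (coverGen p i) = g (coverGen p i)) : f = g := by
  apply QuotientGroup.monoidHom_ext
  ext i
  exact h i

/-- The projection of the `p`-cover onto the base group. -/
def baseProj : PCover p (baseMap p) →* BaseGroup p :=
  QuotientGroup.lift _ (baseMap p) (relStar_le_ker_baseMap p)

theorem baseProj_coverGen (i : Fin 3) : baseProj p (coverGen p i) = baseGen p i.castSucc :=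
  baseMap_of p i

theorem baseProj_surjective : Function.Surjective (baseProj p) := fun x => by
  obtain ⟨y, rfl⟩ := baseMap_surjective p x
  exact ⟨QuotientGroup.mk y, rfl⟩

theorem multiplicator_eq_ker : multiplicator p (baseMap p) = (baseProj p).ker := by
  ext x
  constructor
  · rintro ⟨r, hr, rfl⟩
    exact hr
  · intro hx
    obtain ⟨y, rfl⟩ := QuotientGroup.mk_surjective x
    exact ⟨y, hx, rfl⟩

theorem multiplicator_le_torsionCenter :
    multiplicator p (baseMap p) ≤ torsionCenter p (PCover p (baseMap p)) := by
  rintro _ ⟨r, hr, rfl⟩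
  refine ⟨fun x => ?_, ?_⟩
  · obtain ⟨y, rfl⟩ := QuotientGroup.mk_surjective x
    rw [← comm_eq_one_iff]
    change comm (QuotientGroup.mk' _ r) (QuotientGroup.mk' (relStar p (baseMap p)) y) = 1
    rw [← map_comm]
    exact (QuotientGroup.eq_one_iff _).2 (Subgroup.subset_closure (Or.inl ⟨r, hr, y, rfl⟩))
  · rw [← map_pow]
    exact (QuotientGroup.eq_one_iff _).2 (Subgroup.subset_closure (Or.inr ⟨r, hr, rfl⟩))

theorem relTuple_baseGen (j : Fin 7) : relTuple p (fun i => baseGen p i.castSucc) j = 1 := by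
  fin_cases j
  · exact (congrArg (comm · _) (comm_baseGen_one_zero p)).trans
      ((comm_eq_one_iff _ _).2 (commute_baseGen_three p _))
  · exact (congrArg (comm · _) (comm_baseGen_one_zero p)).trans
      ((comm_eq_one_iff _ _).2 (commute_baseGen_three p _))
  · exact (comm_eq_one_iff _ _).2 (commute_baseGen_two p _)
  · exact (comm_eq_one_iff _ _).2 (commute_baseGen_two p _)
  · exact baseGen_pow p _
  · exact baseGen_pow p _
  · exact baseGen_pow p _

theorem multGen_mem (j : Fin 7) : multGen p j ∈ multiplicator p (baseMap p) := by
  rw [multiplicator_eq_ker, MonoidHom.mem_ker, multGen_eq, map_relTuple]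
  simp only [baseProj_coverGen]
  exact relTuple_baseGen p j

theorem multGen_mem_torsionCenter (j : Fin 7) :
    multGen p j ∈ torsionCenter p (PCover p (baseMap p)) :=
  multiplicator_le_torsionCenter p (multGen_mem p j)

variable [Fact p.Prime]

/-- The homomorphism `v ↦ ∏ a_{j+5} ^ v_j` onto the multiplicator. -/
noncomputable def multHom : Multiplicative (Fin 7 → ZMod p) →* PCover p (baseMap p) :=
  tupleHom (multGen p) (multGen_mem_torsionCenter p)

theorem multHom_single (j : Fin 7) :
    multHom p (Multiplicative.ofAdd (Pi.single j 1)) = multGen p j := tupleHom_single _ _ j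

theorem multHom_mem (v : Multiplicative (Fin 7 → ZMod p)) :
    multHom p v ∈ multiplicator p (baseMap p) := by
  refine list_prod_mem fun x hx => ?_
  obtain ⟨k, rfl⟩ := (List.mem_ofFn' _ _).1 hx
  exact pow_mem (multGen_mem p k) _

/-- The span of the seven elements is central, hence normal, and contains the images of the words
that generate R as a normal subgroup. This bounds the multiplicator from above. -/
theorem range_multHom : (multHom p).range = multiplicator p (baseMap p) := by
  apply le_antisymm
  · rintro _ ⟨v, rfl⟩
    exact multHom_mem p v
  · rintro _ ⟨r, hr, rfl⟩
    have hn : (multHom p).range.Normal := normal_of_le_torsionCenter (p := p) (by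
      rintro _ ⟨v, rfl⟩
      exact multiplicator_le_torsionCenter p (multHom_mem p v))
    refine map_mem_of_relTuple_mem p _ _ (fun j => ?_) hr
    exact ⟨_, multHom_single p j⟩

end CoverGeneral

/-! ### Independence of the seven generators of the multiplicator -/

section CoverCoordinates

variable (p : ℕ) [Fact p.Prime] [NeZero (12 : ZMod p)]

/-- The generators of the cover model. -/
def CoverModel.gen : Fin 3 → CoverModel (ZMod p) :=
  ![⟨1, 0, 0, 0, 0, 0, 0, 0⟩, ⟨0, 1, 0, 0, 0, 0, 0, 0⟩, ⟨0, 0, 1, 0, 0, 0, 0, 0⟩]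

theorem CoverModel.comm_comm (x y z : CoverModel (ZMod p)) : comm (comm y x) z =
    ⟨0, 0, 0, 0, (y.x₂ * x.x₁ - y.x₁ * x.x₂) * z.x₁, (y.x₂ * x.x₁ - y.x₁ * x.x₂) * z.x₂, 0, 0⟩ := by
  obtain ⟨h1, h2, h3, h4⟩ := CoverModel.comm_def y x
  rw [CoverModel.comm_of_x₁_x₂ _ _ h1 h2, h3, h4]
  simp

/-- The tuple is kept general, with a condition on the third entry only, because the same formula is
applied to the images of the generators under automorphisms. -/
theorem CoverModel.relTuple_eq (n : Fin 3 → CoverModel (ZMod p)) (h₁ : (n 2).x₁ = 0)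
    (h₂ : (n 2).x₂ = 0) : relTuple p n =
    ![⟨0, 0, 0, 0, ((n 1).x₂ * (n 0).x₁ - (n 1).x₁ * (n 0).x₂) * (n 0).x₁,
        ((n 1).x₂ * (n 0).x₁ - (n 1).x₁ * (n 0).x₂) * (n 0).x₂, 0, 0⟩,
      ⟨0, 0, 0, 0, ((n 1).x₂ * (n 0).x₁ - (n 1).x₁ * (n 0).x₂) * (n 1).x₁,
        ((n 1).x₂ * (n 0).x₁ - (n 1).x₁ * (n 0).x₂) * (n 1).x₂, 0, 0⟩,
      ⟨0, 0, 0, 0, (n 2).x₄ * (n 0).x₁, (n 2).x₄ * (n 0).x₂, (n 2).x₃ * (n 0).x₁,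
        (n 2).x₃ * (n 0).x₂⟩,
      ⟨0, 0, 0, 0, (n 2).x₄ * (n 1).x₁, (n 2).x₄ * (n 1).x₂, (n 2).x₃ * (n 1).x₁,
        (n 2).x₃ * (n 1).x₂⟩, 1, 1, 1] := by
  simp only [relTuple, CoverModel.comm_comm, CoverModel.pow_char,
    CoverModel.comm_of_x₁_x₂ _ _ h₁ h₂]

theorem CoverModel.mem_torsionCenter (x : CoverModel (ZMod p)) (h₁ : x.x₁ = 0) (h₂ : x.x₂ = 0)
    (h₃ : x.x₃ = 0) (h₄ : x.x₄ = 0) : x ∈ torsionCenter p (CoverModel (ZMod p)) :=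
  ⟨fun y => (comm_eq_one_iff _ _).1 (by
    rw [CoverModel.comm_of_x₁_x₂ _ _ h₁ h₂, h₃, h₄]
    simp [CoverModel.one_def]), CoverModel.pow_char x⟩

theorem exists_coverHom : ∃ f : PCover p (baseMap p) →* CoverModel (ZMod p),
    ∀ i, f (coverGen p i) = CoverModel.gen p i := by
  refine cover_exists_lift_of_relTuple p _ fun j => ?_
  rw [CoverModel.relTuple_eq p _ rfl rfl]
  fin_cases j
  all_goals first
    | exact one_mem _
    | exact CoverModel.mem_torsionCenter p _ rfl rfl rfl rfl

/-- The homomorphism from the `p`-cover to the cover model. -/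
noncomputable def coverHom : PCover p (baseMap p) →* CoverModel (ZMod p) :=
  (exists_coverHom p).choose

theorem coverHom_coverGen (i : Fin 3) : coverHom p (coverGen p i) = CoverModel.gen p i :=
  (exists_coverHom p).choose_spec i

theorem comm_eq_one_of_commGroup {A : Type*} [CommGroup A] (x y : A) : comm x y = 1 :=
  (comm_eq_one_iff _ _).2 (Commute.all x y)

theorem relTuple_commGroup {A : Type*} [CommGroup A] (h : Fin 3 → A) :
    relTuple p h = ![1, 1, 1, 1, h 0 ^ p, h 1 ^ p, h 2 ^ p] := by
  simp [relTuple, comm_eq_one_of_commGroup]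

/-- The cover model has exponent p and loses a₉, a₁₀, a₁₁; this abelian quotient of exponent p²
retains them. -/
theorem exists_abelHom : ∃ f : PCover p (baseMap p) →* Multiplicative (Fin 3 → ZMod (p ^ 2)),
    ∀ i, f (coverGen p i) = Multiplicative.ofAdd (Pi.single i 1) := by
  refine cover_exists_lift_of_relTuple p _ fun j => ⟨fun x => Commute.all _ _, ?_⟩
  have key : ∀ x : Multiplicative (Fin 3 → ZMod (p ^ 2)), (x ^ p) ^ p = 1 := fun x => by
    rw [← pow_mul, ← pow_two]
    apply Multiplicative.toAdd.injective
    ext i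
    simp
  rw [relTuple_commGroup]
  fin_cases j <;> first
    | exact one_pow p
    | exact key _

/-- The homomorphism from the `p`-cover to its largest homocyclic abelian quotient. -/
noncomputable def abelHom : PCover p (baseMap p) →* Multiplicative (Fin 3 → ZMod (p ^ 2)) :=
  (exists_abelHom p).choose

theorem abelHom_coverGen (i : Fin 3) :
    abelHom p (coverGen p i) = Multiplicative.ofAdd (Pi.single i 1) :=
  (exists_abelHom p).choose_spec i

theorem toBase_coverHom (x : PCover p (baseMap p)) :
    CoverModel.toBase (coverHom p x) = baseEquiv p (baseProj p x) := by
  have : CoverModel.toBase.comp (coverHom p) = (baseEquiv p).toMonoidHom.comp (baseProj p) := by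
    refine cover_hom_ext p fun i => ?_
    simp only [MonoidHom.comp_apply, coverHom_coverGen, baseProj_coverGen,
      MulEquiv.coe_toMonoidHom, baseEquiv_gen, CoverModel.toBase_apply]
    fin_cases i <;> rfl
  exact DFunLike.congr_fun this x

/-- The first three coordinates of the base model. -/
def BaseModel.abel {K : Type*} [Field K] : BaseModel K →* Multiplicative (Fin 3 → K) where
  toFun x := Multiplicative.ofAdd ![x.x₁, x.x₂, x.x₃]
  map_one' := by
    apply Multiplicative.toAdd.injective
    ext i
    fin_cases i <;> rfl
  map_mul' x y := by
    apply Multiplicative.toAdd.injective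
    ext i
    fin_cases i <;> rfl

/-- Together with `mul_p_eq`, this shows that the p-th power of an element of the cover, seen in
(Z/p²)³, depends only on its image in the base group. -/
theorem castHom_abelHom (x : PCover p (baseMap p)) (i : Fin 3) :
    ZMod.castHom (dvd_pow_self p two_ne_zero) (ZMod p) ((abelHom p x).toAdd i) =
      (BaseModel.abel (baseEquiv p (baseProj p x))).toAdd i := by
  let c : (Fin 3 → ZMod (p ^ 2)) →+ (Fin 3 → ZMod p) :=
    (ZMod.castHom (dvd_pow_self p two_ne_zero) (ZMod p)).toAddMonoidHom.compLeft (Fin 3)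
  have : (AddMonoidHom.toMultiplicative c).comp (abelHom p) =
      BaseModel.abel.comp ((baseEquiv p).toMonoidHom.comp (baseProj p)) := by
    refine cover_hom_ext p fun i => ?_
    simp only [MonoidHom.comp_apply, abelHom_coverGen, baseProj_coverGen,
      MulEquiv.coe_toMonoidHom, baseEquiv_gen]
    apply Multiplicative.toAdd.injective
    ext k
    fin_cases i <;> fin_cases k <;> simp [c, BaseModel.abel, BaseModel.gen]
  have h2 := DFunLike.congr_fun this x
  exact congrFun (congrArg Multiplicative.toAdd h2) i

theorem coverHom_multGen : (fun j => coverHom p (multGen p j)) =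
    ![⟨0, 0, 0, 0, 1, 0, 0, 0⟩, ⟨0, 0, 0, 0, 0, 1, 0, 0⟩, ⟨0, 0, 0, 0, 0, 0, 1, 0⟩,
      ⟨0, 0, 0, 0, 0, 0, 0, 1⟩, 1, 1, 1] := by
  funext j
  rw [multGen_eq, map_relTuple]
  simp only [coverHom_coverGen]
  rw [CoverModel.relTuple_eq p _ rfl rfl]
  simp [CoverModel.gen]

theorem coverHom_multHom (v : Fin 7 → ZMod p) : coverHom p (multHom p (Multiplicative.ofAdd v)) =
    ⟨0, 0, 0, 0, v 0, v 1, v 2, v 3⟩ := by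
  have hj := fun j => congrFun (coverHom_multGen p) j
  rw [multHom, tupleHom_apply, map_list_prod, List.map_ofFn]
  simp [Function.comp_def, hj, List.ofFn_succ, CoverModel.mul_def, CoverModel.pow_def,
    CoverModel.one_def]

theorem abelHom_multGen : (fun j => abelHom p (multGen p j)) =
    (![1, 1, 1, 1, Multiplicative.ofAdd (Pi.single (0 : Fin 3) (p : ZMod (p ^ 2))),
      Multiplicative.ofAdd (Pi.single (1 : Fin 3) (p : ZMod (p ^ 2))),
      Multiplicative.ofAdd (Pi.single (2 : Fin 3) (p : ZMod (p ^ 2)))] :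
      Fin 7 → Multiplicative (Fin 3 → ZMod (p ^ 2))) := by
  have key : ∀ i : Fin 3, (Multiplicative.ofAdd (Pi.single i 1 : Fin 3 → ZMod (p ^ 2))) ^ p =
      Multiplicative.ofAdd (Pi.single i (p : ZMod (p ^ 2))) := fun i => by
    rw [← ofAdd_nsmul, ← Pi.single_smul]
    simp
  funext j
  rw [multGen_eq, map_relTuple, relTuple_commGroup]
  simp only [abelHom_coverGen, key]

theorem abelHom_multHom (v : Fin 7 → ZMod p) :
    (abelHom p (multHom p (Multiplicative.ofAdd v))).toAdd =
      ![(v 4).val * (p : ZMod (p ^ 2)), (v 5).val * (p : ZMod (p ^ 2)),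
        (v 6).val * (p : ZMod (p ^ 2))] := by
  have hj := fun j => congrFun (abelHom_multGen p) j
  rw [multHom, tupleHom_apply, map_list_prod, List.map_ofFn]
  ext i
  fin_cases i <;>
    simp [Function.comp_def, hj, List.ofFn_succ, -ZMod.natCast_val]

theorem val_mul_injective {a b : ZMod p}
    (h : (a.val * p : ZMod (p ^ 2)) = b.val * p) : a = b := by
  have hp := (Fact.out : p.Prime).pos
  have h1 : ((a.val * p : ℕ) : ZMod (p ^ 2)) = (b.val * p : ℕ) := by push_cast; exact h
  rw [ZMod.natCast_eq_natCast_iff, pow_two] at h1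
  have h2 := Nat.ModEq.mul_right_cancel' hp.ne' h1
  rw [← ZMod.natCast_eq_natCast_iff] at h2
  simpa using h2

theorem mul_p_eq (t : ZMod (p ^ 2)) : (p : ZMod (p ^ 2)) * t =
    (ZMod.castHom (dvd_pow_self p two_ne_zero) (ZMod p) t).val * p := by
  have hp := (Fact.out : p.Prime).pos
  obtain ⟨n, rfl⟩ := ZMod.natCast_zmod_surjective t
  rw [map_natCast, ZMod.val_natCast, ← Nat.cast_mul, ← Nat.cast_mul,
    ZMod.natCast_eq_natCast_iff, pow_two, mul_comm p n]
  exact (Nat.ModEq.mul_right' p (Nat.mod_modEq n p)).symm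

/-- The cover model reads off the first four exponents and the abelian quotient the last three, so
the multiplicator has full dimension 7. -/
theorem multHom_eq_of_coords {u v : Fin 7 → ZMod p}
    (h : coverHom p (multHom p (Multiplicative.ofAdd u)) =
      coverHom p (multHom p (Multiplicative.ofAdd v)))
    (h' : abelHom p (multHom p (Multiplicative.ofAdd u)) =
      abelHom p (multHom p (Multiplicative.ofAdd v))) : u = v := by
  have h' := congrArg Multiplicative.toAdd h'
  rw [coverHom_multHom, coverHom_multHom] at h
  rw [abelHom_multHom, abelHom_multHom] at h'
  simp only [CoverModel.mk.injEq, true_and] at h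
  have h4 := val_mul_injective p (congrFun h' 0)
  have h5 := val_mul_injective p (congrFun h' 1)
  have h6 := val_mul_injective p (congrFun h' 2)
  ext j
  fin_cases j
  · exact h.1
  · exact h.2.1
  · exact h.2.2.1
  · exact h.2.2.2
  · exact h4
  · exact h5
  · exact h6

theorem multHom_injective : Function.Injective (multHom p) := fun u v h => by
  have := multHom_eq_of_coords p (u := u.toAdd) (v := v.toAdd)
    (congrArg (coverHom p) h) (congrArg (abelHom p) h)
  exact this

/-- The multiplicator as a vector space. -/
noncomputable def multEquiv :
    Multiplicative (Fin 7 → ZMod p) ≃* multiplicator p (baseMap p) :=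
  MulEquiv.ofBijective ((multHom p).codRestrict _ (multHom_mem p))
    ⟨fun _ _ h => multHom_injective p (congrArg Subtype.val h), fun x => by
      have : x.1 ∈ (multHom p).range := by rw [range_multHom]; exact x.2
      obtain ⟨v, hv⟩ := this
      exact ⟨v, Subtype.ext hv⟩⟩

end CoverCoordinates

/-! ### The matrix of an automorphism on the multiplicator -/

section Action

variable (p : ℕ) [Fact p.Prime] [NeZero (12 : ZMod p)]

theorem isExtension_iff (α : MulAut (BaseGroup p))
    (αs : PCover p (baseMap p) →* PCover p (baseMap p)) :
    IsExtension p (baseMap p) α αs ↔ ∀ x, baseProj p (αs x) = α (baseProj p x) := by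
  constructor
  · intro h x
    obtain ⟨x, rfl⟩ := QuotientGroup.mk_surjective x
    obtain ⟨y, hy⟩ := QuotientGroup.mk_surjective (αs (QuotientGroup.mk x))
    rw [← hy]
    exact h x y hy.symm
  · intro h x y hxy
    have := h (QuotientGroup.mk x)
    rw [hxy] at this
    exact this

/-- Every choice of preimages defines an extension of an automorphism. -/
theorem exists_extension (α : MulAut (BaseGroup p)) (q : Fin 3 → PCover p (baseMap p))
    (hq : ∀ i, baseProj p (q i) = α (baseGen p i.castSucc)) :
    ∃ αs : PCover p (baseMap p) →* PCover p (baseMap p), (∀ i, αs (coverGen p i) = q i) ∧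
      ∀ x, baseProj p (αs x) = α (baseProj p x) := by
  have h1 : (baseProj p).comp (FreeGroup.lift q) = α.toMonoidHom.comp (baseMap p) := by
    ext i
    simp [hq, baseMap_of]
  obtain ⟨f, hf⟩ := cover_exists_lift p q fun r hr => by
    apply multiplicator_le_torsionCenter
    rw [multiplicator_eq_ker, MonoidHom.mem_ker]
    refine (DFunLike.congr_fun h1 r).trans ?_
    rw [MonoidHom.comp_apply, MonoidHom.mem_ker.1 hr, map_one]
  refine ⟨f, hf, fun x => ?_⟩
  have h2 : (baseProj p).comp f = α.toMonoidHom.comp (baseProj p) :=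
    cover_hom_ext p fun i => by simp [hf, hq, baseProj_coverGen]
  exact DFunLike.congr_fun h2 x

/-- The matrix of an automorphism in terms of the coordinates of the images of the generators. -/
def tupleMatrix (n : Fin 3 → BaseModel (ZMod p)) : Matrix (Fin 7) (Fin 7) (ZMod p) :=
  let d := (n 1).x₂ * (n 0).x₁ - (n 1).x₁ * (n 0).x₂
  !![d * (n 0).x₁, d * (n 0).x₂, 0, 0, 0, 0, 0;
     d * (n 1).x₁, d * (n 1).x₂, 0, 0, 0, 0, 0;
     (n 2).x₄ * (n 0).x₁, (n 2).x₄ * (n 0).x₂, (n 2).x₃ * (n 0).x₁, (n 2).x₃ * (n 0).x₂, 0, 0, 0;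
     (n 2).x₄ * (n 1).x₁, (n 2).x₄ * (n 1).x₂, (n 2).x₃ * (n 1).x₁, (n 2).x₃ * (n 1).x₂, 0, 0, 0;
     0, 0, 0, 0, (n 0).x₁, (n 0).x₂, (n 0).x₃;
     0, 0, 0, 0, (n 1).x₁, (n 1).x₂, (n 1).x₃;
     0, 0, 0, 0, 0, 0, (n 2).x₃]

/-- The images of the generators under an automorphism, in coordinates. -/
noncomputable def autTuple (α : MulAut (BaseGroup p)) (i : Fin 3) : BaseModel (ZMod p) :=
  baseEquiv p (α (baseGen p i.castSucc))

/-- The generator a₃ is central, hence so is its image, and an element of the model commuting with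
the first two basis elements has x₁ = x₂ = 0. -/
theorem autTuple_two (α : MulAut (BaseGroup p)) :
    (autTuple p α 2).x₁ = 0 ∧ (autTuple p α 2).x₂ = 0 := by
  have key : ∀ y : BaseModel (ZMod p), comm (autTuple p α 2) y = 1 := fun y => by
    obtain ⟨x, rfl⟩ := (baseEquiv p).surjective y
    obtain ⟨x, rfl⟩ := α.surjective x
    rw [comm_eq_one_iff]
    exact ((commute_baseGen_two p x).map α.toMonoidHom).map (baseEquiv p).toMonoidHom
  have h1 := congrArg BaseModel.x₄ (key ⟨0, 1, 0, 0⟩)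
  have h2 := congrArg BaseModel.x₄ (key ⟨1, 0, 0, 0⟩)
  simp [BaseModel.comm_def, BaseModel.one_def] at h1 h2
  exact ⟨h1, h2⟩

/-- The image lies in the multiplicator, so it is determined by its coordinates in the two detecting
quotients. There the seven words depend only on the images modulo the multiplicator, which makes the
answer independent of the chosen lift. -/
theorem extension_multGen {α : MulAut (BaseGroup p)}
    {αs : PCover p (baseMap p) →* PCover p (baseMap p)}
    (h : ∀ x, baseProj p (αs x) = α (baseProj p x)) (j : Fin 7) :
    αs (multGen p j) = multHom p (Multiplicative.ofAdd (tupleMatrix p (autTuple p α) j)) := by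
  obtain ⟨h₁, h₂⟩ := autTuple_two p α
  have hmem : αs (multGen p j) ∈ (multHom p).range := by
    rw [range_multHom, multiplicator_eq_ker, MonoidHom.mem_ker, h]
    have := multGen_mem p j
    rw [multiplicator_eq_ker, MonoidHom.mem_ker] at this
    rw [this, map_one]
  obtain ⟨u, hu⟩ := hmem
  have hn : ∀ i, CoverModel.toBase (coverHom p (αs (coverGen p i))) = autTuple p α i := fun i => by
    rw [toBase_coverHom, h, baseProj_coverGen, autTuple]
  have hx1 := fun i => congrArg BaseModel.x₁ (hn i)
  have hx2 := fun i => congrArg BaseModel.x₂ (hn i)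
  have hx3 := fun i => congrArg BaseModel.x₃ (hn i)
  have hx4 := fun i => congrArg BaseModel.x₄ (hn i)
  simp only [CoverModel.toBase_apply] at hx1 hx2 hx3 hx4
  have ha : ∀ i k, (p : ZMod (p ^ 2)) * (abelHom p (αs (coverGen p i))).toAdd k =
      ((BaseModel.abel (autTuple p α i)).toAdd k).val * p := fun i k => by
    rw [mul_p_eq, castHom_abelHom, h, baseProj_coverGen, autTuple]
  rw [← hu]
  congr 1
  apply multHom_eq_of_coords p (u := u.toAdd) (v := tupleMatrix p (autTuple p α) j)
  · rw [coverHom_multHom p (tupleMatrix p _ _)]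
    refine (congrArg (coverHom p) hu).trans ?_
    rw [multGen_eq, map_relTuple, map_relTuple, CoverModel.relTuple_eq p _ ((hx1 2).trans h₁)
      ((hx2 2).trans h₂)]
    simp only [hx1, hx2, hx3, hx4]
    fin_cases j <;> simp [tupleMatrix, CoverModel.one_def]
  · apply Multiplicative.toAdd.injective
    rw [abelHom_multHom p (tupleMatrix p _ _)]
    refine (congrArg (fun t => (abelHom p t).toAdd) hu).trans ?_
    simp only [multGen_eq, map_relTuple, relTuple_commGroup]
    ext k
    have ha' := fun i => ha i k
    fin_cases j <;> fin_cases k <;>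
      simp [tupleMatrix, ha, BaseModel.abel, h₁, h₂]

theorem isActionMatrix_iff (α : MulAut (BaseGroup p)) (M : Matrix (Fin 7) (Fin 7) (ZMod p)) :
    IsActionMatrix p α M ↔ M = tupleMatrix p (autTuple p α) := by
  constructor
  · rintro ⟨αs, h, hM⟩
    rw [isExtension_iff] at h
    funext j
    have h1 := hM j
    rw [extension_multGen p h] at h1
    exact (multHom_injective p h1).symm
  · rintro rfl
    choose q hq using fun i : Fin 3 => baseProj_surjective p (α (baseGen p i.castSucc))
    obtain ⟨αs, -, h⟩ := exists_extension p α q hq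
    exact ⟨αs, (isExtension_iff p α αs).2 h, fun j => extension_multGen p h j⟩

end Action

/-! ### The automorphisms of the base group and the dual action in coordinates -/

section Automorphisms

variable (p : ℕ) [Fact p.Prime] [NeZero (12 : ZMod p)]

instance : Finite (BaseModel (ZMod p)) := Finite.of_equiv _ (BaseModel.equivProd (ZMod p)).symm

/-- Normalising the x₄ coordinates of the first two images to zero loses no matrix, because
`tupleMatrix` does not involve them. The automorphism is then linear in the coordinates. -/
theorem exists_aut (n : Fin 3 → BaseModel (ZMod p)) (h₀ : (n 0).x₄ = 0) (h₁ : (n 1).x₄ = 0)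
    (h₂ : (n 2).x₁ = 0) (h₂' : (n 2).x₂ = 0) (hz : (n 2).x₃ ≠ 0)
    (hd : (n 1).x₂ * (n 0).x₁ - (n 1).x₁ * (n 0).x₂ ≠ 0) :
    ∃ α : MulAut (BaseGroup p), autTuple p α = n := by
  let g : BaseModel (ZMod p) →* BaseModel (ZMod p) :=
    { toFun := fun x => ⟨x.x₁ * (n 0).x₁ + x.x₂ * (n 1).x₁, x.x₁ * (n 0).x₂ + x.x₂ * (n 1).x₂,
        x.x₁ * (n 0).x₃ + x.x₂ * (n 1).x₃ + x.x₃ * (n 2).x₃,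
        x.x₃ * (n 2).x₄ + x.x₄ * ((n 1).x₂ * (n 0).x₁ - (n 1).x₁ * (n 0).x₂)⟩
      map_one' := by ext <;> simp [BaseModel.one_def]
      map_mul' := fun x y => by ext <;> simp only [BaseModel.mul_def] <;> ring }
  have hg : Function.Injective g := by
    rw [injective_iff_map_eq_one]
    intro x hx
    have e1 : x.x₁ * (n 0).x₁ + x.x₂ * (n 1).x₁ = 0 := congrArg BaseModel.x₁ hx
    have e2 : x.x₁ * (n 0).x₂ + x.x₂ * (n 1).x₂ = 0 := congrArg BaseModel.x₂ hx
    have e3 : x.x₁ * (n 0).x₃ + x.x₂ * (n 1).x₃ + x.x₃ * (n 2).x₃ = 0 := congrArg BaseModel.x₃ hx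
    have e4 : x.x₃ * (n 2).x₄ + x.x₄ * ((n 1).x₂ * (n 0).x₁ - (n 1).x₁ * (n 0).x₂) = 0 :=
      congrArg BaseModel.x₄ hx
    have f1 : x.x₁ = 0 := mul_right_cancel₀ hd (by linear_combination (n 1).x₂ * e1 - (n 1).x₁ * e2)
    have f2 : x.x₂ = 0 := mul_right_cancel₀ hd (by linear_combination (n 0).x₁ * e2 - (n 0).x₂ * e1)
    have f3 : x.x₃ = 0 := by simpa [f1, f2, hz] using e3
    have f4 : x.x₄ = 0 := by simpa [f3, hd] using e4
    ext <;> assumption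
  let γ : BaseModel (ZMod p) ≃* BaseModel (ZMod p) :=
    MulEquiv.ofBijective g ⟨hg, Finite.surjective_of_injective hg⟩
  refine ⟨((baseEquiv p).trans γ).trans (baseEquiv p).symm, funext fun i => ?_⟩
  have : autTuple p (((baseEquiv p).trans γ).trans (baseEquiv p).symm) i =
      g (BaseModel.gen p i.castSucc) := by
    simp only [autTuple, MulEquiv.trans_apply, MulEquiv.apply_symm_apply, baseEquiv_gen]
    rfl
  rw [this]
  fin_cases i <;> ext <;> simp [g, BaseModel.gen, h₀, h₁, h₂, h₂']

/-- The image of a₄ = [a₂, a₁] is the commutator of the images, that is, a₄ raised to the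
determinant; a zero determinant would make α kill a₄. -/
theorem autTuple_det (α : MulAut (BaseGroup p)) :
    (autTuple p α 1).x₂ * (autTuple p α 0).x₁ - (autTuple p α 1).x₁ * (autTuple p α 0).x₂ ≠ 0 ∧
      baseEquiv p (α (baseGen p 3)) = ⟨0, 0, 0, (autTuple p α 1).x₂ * (autTuple p α 0).x₁ -
        (autTuple p α 1).x₁ * (autTuple p α 0).x₂⟩ := by
  have h : baseEquiv p (α (baseGen p 3)) = ⟨0, 0, 0, (autTuple p α 1).x₂ * (autTuple p α 0).x₁ -
      (autTuple p α 1).x₁ * (autTuple p α 0).x₂⟩ := by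
    rw [← comm_baseGen_one_zero, ← BaseModel.comm_def]
    exact map_comm ((baseEquiv p).toMonoidHom.comp α.toMonoidHom) _ _
  refine ⟨fun hd => ?_, h⟩
  rw [hd, ← BaseModel.one_def, map_eq_one_iff _ (baseEquiv p).injective,
    map_eq_one_iff _ α.injective] at h
  have h3 := baseEquiv_gen p 3
  rw [h, map_one] at h3
  simpa [BaseModel.gen, BaseModel.one_def] using congrArg BaseModel.x₄ h3

theorem autTuple_two_x₃_ne_zero (α : MulAut (BaseGroup p)) : (autTuple p α 2).x₃ ≠ 0 := by
  intro hz
  obtain ⟨h₁, h₂⟩ := autTuple_two p α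
  obtain ⟨hd, h⟩ := autTuple_det p α
  set d := (autTuple p α 1).x₂ * (autTuple p α 0).x₁ - (autTuple p α 1).x₁ * (autTuple p α 0).x₂
  -- If x₃ vanished, α(a₃) would lie in the span of a₄, hence equal α(a₄ᵏ) with k = x₄/d,
  -- contradicting injectivity.
  obtain ⟨k, hk⟩ := ZMod.natCast_zmod_surjective ((autTuple p α 2).x₄ * d⁻¹)
  have h5 : baseEquiv p (α (baseGen p 2)) = baseEquiv p (α (baseGen p 3 ^ k)) := by
    rw [map_pow, map_pow, h, BaseModel.pow_def]
    change autTuple p α 2 = _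
    ext
    · simpa using h₁
    · simpa using h₂
    · simpa using hz
    · simp only [hk]
      field_simp
  have h6 := α.injective ((baseEquiv p).injective h5)
  have h7 := congrArg (fun x => (baseEquiv p x).x₃) h6
  simp [map_pow, baseEquiv_gen, BaseModel.gen, BaseModel.pow_def] at h7

/-- The dual action in coordinates. -/
def actVec {K : Type*} [Field K] (k a b c d y₁ y₂ z s : K) (v : Fin 7 → K) : Fin 7 → K :=
  ![k * ((a * d - b * c) * (a * v 0 + b * v 1)), k * ((a * d - b * c) * (c * v 0 + d * v 1)),
    k * (s * (a * v 0 + b * v 1) + z * (a * v 2 + b * v 3)),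
    k * (s * (c * v 0 + d * v 1) + z * (c * v 2 + d * v 3)),
    k * (a * v 4 + b * v 5 + y₁ * v 6), k * (c * v 4 + d * v 5 + y₂ * v 6), k * (z * v 6)]

theorem vecMul_tupleMatrix (n : Fin 3 → BaseModel (ZMod p)) (k : ZMod p) (v : Fin 7 → ZMod p) :
    v ᵥ* (k • (tupleMatrix p n)ᵀ) = actVec k (n 0).x₁ (n 0).x₂ (n 1).x₁ (n 1).x₂ (n 0).x₃ (n 1).x₃
      (n 2).x₃ (n 2).x₄ v := by
  ext j
  fin_cases j <;>
    simp [Matrix.vecMul, dotProduct, Fin.sum_univ_succ, tupleMatrix, actVec] <;> ring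

theorem mem_dualOrbit_iff (v u : Fin 7 → ZMod p) : u ∈ dualOrbit p v ↔
    ∃ k a b c d y₁ y₂ z s : ZMod p, k ≠ 0 ∧ a * d - b * c ≠ 0 ∧ z ≠ 0 ∧
      u = actVec k a b c d y₁ y₂ z s v := by
  constructor
  · rintro ⟨_, ⟨k, α, M, hM, rfl⟩, rfl⟩
    rw [isActionMatrix_iff] at hM
    subst hM
    refine ⟨_, _, _, _, _, _, _, _, _, k.ne_zero, ?_, autTuple_two_x₃_ne_zero p α,
      vecMul_tupleMatrix p _ _ _⟩
    intro h
    apply (autTuple_det p α).1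
    linear_combination h
  · rintro ⟨k, a, b, c, d, y₁, y₂, z, s, hk, hd, hz, rfl⟩
    obtain ⟨α, hα⟩ := exists_aut p ![⟨a, b, y₁, 0⟩, ⟨c, d, y₂, 0⟩, ⟨0, 0, z, s⟩] rfl rfl rfl rfl hz
      (by simp; intro h; apply hd; linear_combination h)
    refine ⟨_, ⟨Units.mk0 k hk, α, _, (isActionMatrix_iff p α _).2 rfl, rfl⟩, ?_⟩
    rw [hα]
    exact (vecMul_tupleMatrix p ![⟨a, b, y₁, 0⟩, ⟨c, d, y₂, 0⟩, ⟨0, 0, z, s⟩] k v).symm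

end Automorphisms

/-! ### Square classes modulo p -/

section Squares

variable {p : ℕ} [Fact p.Prime]

theorem isSquare_mul_iff_of_not_isSquare {w x : ZMod p} (hw : ¬ IsSquare w) (hx : x ≠ 0) :
    IsSquare (x * w) ↔ ¬ IsSquare x := by
  have hw0 : w ≠ 0 := by
    rintro rfl
    exact hw IsSquare.zero
  rw [← quadraticChar_one_iff_isSquare (mul_ne_zero hx hw0), ← quadraticChar_neg_one_iff_not_isSquare,
    map_mul, quadraticChar_neg_one_iff_not_isSquare.2 hw]
  constructor <;> intro h <;> linarith

end Squares

/-! ### Invariants that characterise the sixteen orbits -/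

section Orbits

variable {p : ℕ} [Fact p.Prime] [NeZero (12 : ZMod p)]

theorem exists_det_eq {K : Type*} [Field K] {e₁ e₂ : K} (he : ¬(e₁ = 0 ∧ e₂ = 0)) (t : K) :
    ∃ p₁ p₂ : K, p₁ * e₂ - e₁ * p₂ = t := by
  by_cases h : e₁ = 0
  · have h2 : e₂ ≠ 0 := fun h2 => he ⟨h, h2⟩
    exact ⟨t / e₂, 0, by field_simp; simp⟩
  · exact ⟨0, -t / e₁, by field_simp; simp⟩

theorem exists_scale {K : Type*} [Field K] {φ α : K} (h : α = 0 ↔ φ = 0) :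
    ∃ z : K, z ≠ 0 ∧ z * φ = α := by
  by_cases hφ : φ = 0
  · exact ⟨1, one_ne_zero, by rw [h.2 hφ, hφ, mul_zero]⟩
  · exact ⟨α / φ, div_ne_zero (mt h.1 hφ) hφ, by field_simp⟩

/-- A nonzero v₆ lets the parameters y₁, y₂ produce any c, so the only remaining invariant is
whether F = v₂v₁ - v₃v₀ vanishes. -/
theorem mem_dualOrbit_e_c₃ (φ : ZMod p) (v : Fin 7 → ZMod p) :
    v ∈ dualOrbit p ![0, 1, φ, 0, 0, 0, 1] ↔
      ¬(v 0 = 0 ∧ v 1 = 0) ∧ (v 2 * v 1 - v 3 * v 0 = 0 ↔ φ = 0) ∧ v 6 ≠ 0 := by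
  rw [mem_dualOrbit_iff]
  constructor
  · rintro ⟨k, a, b, c, d, y₁, y₂, z, s, hk, hd, hz, rfl⟩
    have hF : k * (s * b + z * (a * φ)) * (k * ((a * d - b * c) * d)) -
      k * (s * d + z * (c * φ)) * (k * ((a * d - b * c) * b)) =
      k ^ 2 * (a * d - b * c) ^ 2 * z * φ := by ring
    simp [actVec, hk, hd, hz, hF]
    rintro rfl rfl
    simp at hd
  · rintro ⟨he, hF, h6⟩
    -- The determinant t and the scalar k = t⁻¹ cancel in e. Then kz = v₆ forces z = tv₆, so t must
    -- be chosen to match F; finally s adjusts f along e.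
    have ht : ∃ t : ZMod p, t ≠ 0 ∧ t * φ * v 6 = v 2 * v 1 - v 3 * v 0 := by
      obtain ⟨t, ht, ht'⟩ := exists_scale (φ := φ * v 6) (α := v 2 * v 1 - v 3 * v 0)
        (by simp [h6, hF])
      exact ⟨t, ht, by rw [← ht']; ring⟩
    obtain ⟨t, ht, hF'⟩ := ht
    obtain ⟨a, c, hac⟩ := exists_det_eq he t
    refine ⟨t⁻¹, a, v 0, c, v 1, t * v 4, t * v 5, t * v 6, a * v 3 - c * v 2, inv_ne_zero ht,
      by rwa [hac], mul_ne_zero ht h6, ?_⟩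
    ext j
    fin_cases j <;> simp [actVec, hac]
    · field_simp
    · field_simp
    · field_simp
      linear_combination (-v 2) * hac - a * hF'
    · field_simp
      linear_combination (-v 3) * hac - c * hF'
    · field_simp
    · field_simp
    · field_simp

theorem mem_dualOrbit_e (φ : ZMod p) (v : Fin 7 → ZMod p) :
    v ∈ dualOrbit p ![0, 1, φ, 0, 0, 0, 0] ↔
      ¬(v 0 = 0 ∧ v 1 = 0) ∧ (v 2 * v 1 - v 3 * v 0 = 0 ↔ φ = 0) ∧ v 6 = 0 ∧
        v 4 = 0 ∧ v 5 = 0 := by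
  rw [mem_dualOrbit_iff]
  constructor
  · rintro ⟨k, a, b, c, d, y₁, y₂, z, s, hk, hd, hz, rfl⟩
    have hF : k * (s * b + z * (a * φ)) * (k * ((a * d - b * c) * d)) -
      k * (s * d + z * (c * φ)) * (k * ((a * d - b * c) * b)) =
      k ^ 2 * (a * d - b * c) ^ 2 * z * φ := by ring
    simp [actVec, hk, hd, hz, hF]
    rintro rfl rfl
    simp at hd
  · rintro ⟨he, hF, h6, h4, h5⟩
    obtain ⟨z, hz, hF'⟩ := exists_scale hF
    obtain ⟨a, c, hac⟩ := exists_det_eq he 1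
    refine ⟨1, a, v 0, c, v 1, 0, 0, z, a * v 3 - c * v 2, one_ne_zero,
      by simp [hac], hz, ?_⟩
    ext j
    fin_cases j <;> simp [actVec, hac, h4, h5, h6]
    · linear_combination (-v 2) * hac - a * hF'
    · linear_combination (-v 3) * hac - c * hF'

theorem mem_dualOrbit_e_c₂ (φ : ZMod p) (v : Fin 7 → ZMod p) :
    v ∈ dualOrbit p ![0, 1, φ, 0, 0, 1, 0] ↔
      ¬(v 0 = 0 ∧ v 1 = 0) ∧ (v 2 * v 1 - v 3 * v 0 = 0 ↔ φ = 0) ∧ v 6 = 0 ∧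
        v 4 * v 1 - v 5 * v 0 = 0 ∧ ¬(v 4 = 0 ∧ v 5 = 0) := by
  rw [mem_dualOrbit_iff]
  constructor
  · rintro ⟨k, a, b, c, d, y₁, y₂, z, s, hk, hd, hz, rfl⟩
    have hF : k * (s * b + z * (a * φ)) * (k * ((a * d - b * c) * d)) -
      k * (s * d + z * (c * φ)) * (k * ((a * d - b * c) * b)) =
      k ^ 2 * (a * d - b * c) ^ 2 * z * φ := by ring
    have hbd : b = 0 → ¬ d = 0 := by
      rintro rfl rfl
      simp at hd
    simp [actVec, hk, hd, hz, hF]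
    refine ⟨hbd, ?_, hbd⟩
    ring
  · rintro ⟨he, hF, h6, hC, hc⟩
    obtain ⟨q₁, q₂, hq⟩ := exists_det_eq he 1
    -- Since e ≠ 0 and c∧e = 0, c = m e. Taking k = m and determinant m⁻¹ produces e and c at the
    -- same time.
    obtain ⟨m, hm4, hm5⟩ : ∃ m, v 4 = m * v 0 ∧ v 5 = m * v 1 :=
      ⟨q₁ * v 5 - v 4 * q₂, by linear_combination (-v 4) * hq + q₁ * hC,
        by linear_combination (-v 5) * hq + q₂ * hC⟩
    have hm : m ≠ 0 := by
      rintro rfl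
      exact hc ⟨by simpa using hm4, by simpa using hm5⟩
    obtain ⟨z, hz, hF'⟩ := exists_scale hF
    refine ⟨m, q₁ * m⁻¹, v 0, q₂ * m⁻¹, v 1, 0, 0, z, (q₁ * v 3 - q₂ * v 2) * m⁻¹, hm, ?_, hz, ?_⟩
    · intro h
      apply hm
      field_simp at h
      rw [hq] at h
      simp at h
    have hq' : q₁ * m⁻¹ * v 1 - v 0 * (q₂ * m⁻¹) = m⁻¹ := by linear_combination m⁻¹ * hq
    ext j
    fin_cases j <;> simp [actVec, hq', h6, hm, hm4, hm5]
    · field_simp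
      linear_combination (-v 2) * hq - q₁ * hF'
    · field_simp
      linear_combination (-v 3) * hq - q₂ * hF'

/-- The value c∧e is multiplied by (k det A)², so its square class is invariant. General ε and η
also cover the vectors with w in position 1 that come from the presentations of G₅ and G₁₀. -/
theorem mem_dualOrbit_e_c₁ (φ ε η : ZMod p) (hε : ε ≠ 0) (hη : η ≠ 0) (v : Fin 7 → ZMod p) :
    v ∈ dualOrbit p ![0, ε, φ, 0, η, 0, 0] ↔
      ¬(v 0 = 0 ∧ v 1 = 0) ∧ (v 2 * v 1 - v 3 * v 0 = 0 ↔ φ = 0) ∧ v 6 = 0 ∧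
        v 4 * v 1 - v 5 * v 0 ≠ 0 ∧ IsSquare ((v 4 * v 1 - v 5 * v 0) * (ε * η)) := by
  rw [mem_dualOrbit_iff]
  constructor
  · rintro ⟨k, a, b, c, d, y₁, y₂, z, s, hk, hd, hz, rfl⟩
    have hF : k * (s * (b * ε) + z * (a * φ)) * (k * ((a * d - b * c) * (d * ε))) -
      k * (s * (d * ε) + z * (c * φ)) * (k * ((a * d - b * c) * (b * ε))) =
      k ^ 2 * (a * d - b * c) ^ 2 * z * φ * ε := by ring
    have hC : k * (a * η) * (k * ((a * d - b * c) * (d * ε))) -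
      k * (c * η) * (k * ((a * d - b * c) * (b * ε))) =
      k ^ 2 * (a * d - b * c) ^ 2 * (ε * η) := by ring
    have hbd : b = 0 → ¬ d = 0 := by
      rintro rfl rfl
      simp at hd
    simp [actVec, hk, hd, hz, hF, hC, hε, hη]
    exact ⟨hbd, k * (a * d - b * c) * (ε * η), by ring⟩
  · rintro ⟨he, hF, h6, hC, r, hr⟩
    obtain ⟨C, hCdef⟩ : ∃ C, C = v 4 * v 1 - v 5 * v 0 := ⟨_, rfl⟩
    rw [← hCdef] at hC hr
    have hr0 : r ≠ 0 := by
      rintro rfl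
      simp [hC, hε, hη] at hr
    obtain ⟨z, hz, hF'⟩ := exists_scale (φ := φ) (α := (v 2 * v 1 - v 3 * v 0) * η / C)
      (by simp [hC, hη, hF])
    have hD : v 4 / η * (η / r * v 1) - η / r * v 0 * (v 5 / η) = C / r := by
      rw [hCdef]
      field_simp
    have hF2 : z * φ * C = (v 2 * v 1 - v 3 * v 0) * η := by
      rw [hF']
      field_simp
    -- The columns of A are c/η and (η/r)e, with determinant C/r; the factor on e is then Cεη/r² =
    -- 1, where r² = Cεη.
    refine ⟨1, v 4 / η, η / r * v 0, v 5 / η, η / r * v 1, 0, 0, z,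
      (v 4 * v 3 - v 5 * v 2) * r / (C * η * ε), one_ne_zero, ?_, hz, ?_⟩
    · rw [hD]
      exact div_ne_zero hC hr0
    ext j
    fin_cases j <;> simp [actVec, hD, h6]
    · field_simp
      linear_combination (-v 0) * hr
    · field_simp
      linear_combination (-v 1) * hr
    · field_simp
      linear_combination (η * v 2) * hCdef - v 4 * hF2
    · field_simp
      linear_combination (η * v 3) * hCdef - v 5 * hF2
    · field_simp
    · field_simp

theorem mem_dualOrbit_c₃ (v : Fin 7 → ZMod p) :
    v ∈ dualOrbit p ![0, 0, 0, 0, 0, 0, 1] ↔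
      (v 0 = 0 ∧ v 1 = 0) ∧ (v 2 = 0 ∧ v 3 = 0) ∧ v 6 ≠ 0 := by
  rw [mem_dualOrbit_iff]
  constructor
  · rintro ⟨k, a, b, c, d, y₁, y₂, z, s, hk, hd, hz, rfl⟩
    simp [actVec, hk, hz]
  · rintro ⟨⟨h0, h1⟩, ⟨h2, h3⟩, h6⟩
    refine ⟨1, 1, 0, 0, 1, v 4, v 5, v 6, 0, one_ne_zero, by simp, h6, ?_⟩
    ext j
    fin_cases j <;> simp [actVec, *]

theorem mem_dualOrbit_c₂ (v : Fin 7 → ZMod p) :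
    v ∈ dualOrbit p ![0, 0, 0, 0, 0, 1, 0] ↔
      (v 0 = 0 ∧ v 1 = 0) ∧ (v 2 = 0 ∧ v 3 = 0) ∧ v 6 = 0 ∧ ¬(v 4 = 0 ∧ v 5 = 0) := by
  rw [mem_dualOrbit_iff]
  constructor
  · rintro ⟨k, a, b, c, d, y₁, y₂, z, s, hk, hd, hz, rfl⟩
    simp [actVec, hk]
    rintro rfl rfl
    simp at hd
  · rintro ⟨⟨h0, h1⟩, ⟨h2, h3⟩, h6, hc⟩
    obtain ⟨a, c, hac⟩ := exists_det_eq hc 1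
    refine ⟨1, a, v 4, c, v 5, 0, 0, 1, 0, one_ne_zero, by simp [hac], one_ne_zero, ?_⟩
    ext j
    fin_cases j <;> simp [actVec, h0, h1, h2, h3, h6]

theorem mem_dualOrbit_f (v : Fin 7 → ZMod p) :
    v ∈ dualOrbit p ![0, 0, 0, 1, 0, 0, 0] ↔
      (v 0 = 0 ∧ v 1 = 0) ∧ ¬(v 2 = 0 ∧ v 3 = 0) ∧ v 6 = 0 ∧ v 4 = 0 ∧ v 5 = 0 := by
  rw [mem_dualOrbit_iff]
  constructor
  · rintro ⟨k, a, b, c, d, y₁, y₂, z, s, hk, hd, hz, rfl⟩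
    simp [actVec, hk, hz]
    rintro rfl rfl
    simp at hd
  · rintro ⟨⟨h0, h1⟩, hf, h6, h4, h5⟩
    obtain ⟨a, c, hac⟩ := exists_det_eq hf 1
    refine ⟨1, a, v 2, c, v 3, 0, 0, 1, 0, one_ne_zero, by simp [hac], one_ne_zero, ?_⟩
    ext j
    fin_cases j <;> simp [actVec, h0, h1, h4, h5, h6]

theorem mem_dualOrbit_f_c₃ (v : Fin 7 → ZMod p) :
    v ∈ dualOrbit p ![0, 0, 0, 1, 0, 0, 1] ↔
      (v 0 = 0 ∧ v 1 = 0) ∧ ¬(v 2 = 0 ∧ v 3 = 0) ∧ v 6 ≠ 0 := by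
  rw [mem_dualOrbit_iff]
  constructor
  · rintro ⟨k, a, b, c, d, y₁, y₂, z, s, hk, hd, hz, rfl⟩
    simp [actVec, hk, hz]
    rintro rfl rfl
    simp at hd
  · rintro ⟨⟨h0, h1⟩, hf, h6⟩
    obtain ⟨a, c, hac⟩ := exists_det_eq hf 1
    refine ⟨1, a, v 2 / v 6, c, v 3 / v 6, v 4, v 5, v 6, 0, one_ne_zero, ?_, h6, ?_⟩
    · rw [show a * (v 3 / v 6) - v 2 / v 6 * c = (a * v 3 - v 2 * c) / v 6 by ring, hac]
      exact div_ne_zero one_ne_zero h6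
    ext j
    fin_cases j <;> simp [actVec, h0, h1] <;> field_simp

theorem mem_dualOrbit_f_c₂ (v : Fin 7 → ZMod p) :
    v ∈ dualOrbit p ![0, 0, 0, 1, 0, 1, 0] ↔
      (v 0 = 0 ∧ v 1 = 0) ∧ ¬(v 2 = 0 ∧ v 3 = 0) ∧ v 6 = 0 ∧
        v 4 * v 3 - v 5 * v 2 = 0 ∧ ¬(v 4 = 0 ∧ v 5 = 0) := by
  rw [mem_dualOrbit_iff]
  constructor
  · rintro ⟨k, a, b, c, d, y₁, y₂, z, s, hk, hd, hz, rfl⟩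
    have hbd : b = 0 → ¬ d = 0 := by
      rintro rfl rfl
      simp at hd
    simp [actVec, hk, hz]
    exact ⟨hbd, by ring, hbd⟩
  · rintro ⟨⟨h0, h1⟩, hf, h6, hC, hc⟩
    obtain ⟨a, c, hac⟩ := exists_det_eq hc 1
    -- Here f is parallel to c ≠ 0; pairing f with a vector of determinant 1 against c gives the
    -- factor, which serves as z.
    have hm2 : v 2 = (a * v 3 - c * v 2) * v 4 := by linear_combination (-v 2) * hac - a * hC
    have hm3 : v 3 = (a * v 3 - c * v 2) * v 5 := by linear_combination (-v 3) * hac - c * hC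
    have hm : a * v 3 - c * v 2 ≠ 0 := by
      intro h
      rw [h] at hm2 hm3
      exact hf ⟨by simpa using hm2, by simpa using hm3⟩
    refine ⟨1, a, v 4, c, v 5, 0, 0, _, 0, one_ne_zero, by simp [hac], hm, ?_⟩
    ext j
    fin_cases j <;> simp [actVec, h0, h1, h6]
    · exact hm2
    · exact hm3

/-- With e = 0 the value c∧f is multiplied by k² z det A, an arbitrary nonzero scalar, so square
classes play no role; c and f themselves serve as the columns of A. -/
theorem mem_dualOrbit_f_c₁ (v : Fin 7 → ZMod p) :
    v ∈ dualOrbit p ![0, 0, 0, 1, 1, 0, 0] ↔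
      (v 0 = 0 ∧ v 1 = 0) ∧ ¬(v 2 = 0 ∧ v 3 = 0) ∧ v 6 = 0 ∧ v 4 * v 3 - v 5 * v 2 ≠ 0 := by
  rw [mem_dualOrbit_iff]
  constructor
  · rintro ⟨k, a, b, c, d, y₁, y₂, z, s, hk, hd, hz, rfl⟩
    have hbd : b = 0 → ¬ d = 0 := by
      rintro rfl rfl
      simp at hd
    simp [actVec, hk, hz]
    refine ⟨hbd, fun h => ?_⟩
    have : k ^ 2 * z * (a * d - b * c) = 0 := by linear_combination h
    simp [hk, hz, hd] at this
  · rintro ⟨⟨h0, h1⟩, hf, h6, hC⟩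
    refine ⟨1, v 4, v 2, v 5, v 3, 0, 0, 1, 0, one_ne_zero, ?_, one_ne_zero, ?_⟩
    · intro h
      apply hC
      linear_combination h
    ext j
    fin_cases j <;> simp [actVec, h0, h1, h6]

open Classical in
/-- The index of the orbit that contains a nonzero vector. -/
noncomputable def orbitIndex (v : Fin 7 → ZMod p) : Fin 16 :=
  if v 0 = 0 ∧ v 1 = 0 then
    if v 2 = 0 ∧ v 3 = 0 then if v 6 = 0 then 11 else 10
    else if v 6 = 0 then
      if v 4 * v 3 - v 5 * v 2 = 0 then if v 4 = 0 ∧ v 5 = 0 then 12 else 14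
      else 15
    else 13
  else if v 2 * v 1 - v 3 * v 0 = 0 then
    if v 6 = 0 then
      if v 4 * v 1 - v 5 * v 0 = 0 then if v 4 = 0 ∧ v 5 = 0 then 0 else 2
      else if IsSquare (v 4 * v 1 - v 5 * v 0) then 3 else 4
    else 1
  else
    if v 6 = 0 then
      if v 4 * v 1 - v 5 * v 0 = 0 then if v 4 = 0 ∧ v 5 = 0 then 5 else 7
      else if IsSquare (v 4 * v 1 - v 5 * v 0) then 8 else 9
    else 6

theorem not_isSquare_of_generator (hp : p ≠ 2) {w : (ZMod p)ˣ}
    (hw : ∀ x : (ZMod p)ˣ, x ∈ Subgroup.zpowers w) : ¬ IsSquare (w : ZMod p) := by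
  intro h
  obtain ⟨a, ha⟩ := FiniteField.exists_nonsquare (F := ZMod p) (by rwa [ZMod.ringChar_zmod_n])
  have ha0 : a ≠ 0 := by
    rintro rfl
    exact ha (IsSquare.zero)
  -- If w were a square, then every unit, being a power of w, would be one, but a nonsquare a exists
  -- in odd characteristic.
  obtain ⟨n, hn⟩ := hw (Units.mk0 a ha0)
  apply ha
  have : a = (w : ZMod p) ^ n := by
    rw [← Units.val_zpow_eq_zpow_val]
    exact (congrArg Units.val hn).symm
  rw [this]
  exact h.zpow n

-- Each orbit has been described by invariants, and these descriptions are the leaves of the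
-- decision tree `orbitIndex`. The orbits therefore partition the nonzero vectors.
set_option maxHeartbeats 1000000 in
theorem mem_dualOrbit_orbitRep (w : ZMod p) (hw : ¬ IsSquare w) (i : Fin 16)
    (v : Fin 7 → ZMod p) : v ∈ dualOrbit p (orbitRep p w i) ↔ v ≠ 0 ∧ orbitIndex v = i := by
  have hw0 : w ≠ 0 := by
    rintro rfl
    exact hw IsSquare.zero
  have hv : v = 0 ↔ (v 0 = 0 ∧ v 1 = 0) ∧ (v 2 = 0 ∧ v 3 = 0) ∧ (v 4 = 0 ∧ v 5 = 0) ∧ v 6 = 0 := by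
    rw [funext_iff]
    simp [Fin.forall_fin_succ, and_assoc]
  have hsq : ∀ x : ZMod p, (x ≠ 0 ∧ IsSquare (x * (1 * w))) ↔ (x ≠ 0 ∧ ¬ IsSquare x) := fun x =>
    and_congr_right fun hx => by
      rw [one_mul]
      exact isSquare_mul_iff_of_not_isSquare hw hx
  have h1 : (1 : ZMod p) ≠ 0 := one_ne_zero
  rw [Ne, hv]
  unfold orbitIndex
  clear hv hw
  fin_cases i
  · refine (mem_dualOrbit_e 0 v).trans ?_
    split_ifs <;> simp [*]
    -- In these branches c∧e ≠ 0, which excludes c = 0.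
    all_goals
      intro h4 h5
      rename_i hC _
      exact hC (by rw [h4, h5]; ring)
  · refine (mem_dualOrbit_e_c₃ 0 v).trans ?_
    split_ifs <;> simp [*]
  · refine (mem_dualOrbit_e_c₂ 0 v).trans ?_
    split_ifs <;> simp [*]
  · refine (mem_dualOrbit_e_c₁ 0 1 1 h1 h1 v).trans ?_
    split_ifs <;> simp [*]
  · refine (mem_dualOrbit_e_c₁ 0 1 w h1 hw0 v).trans ?_
    rw [hsq]
    split_ifs <;> simp [*]
  · refine (mem_dualOrbit_e 1 v).trans ?_
    split_ifs <;> simp [*]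
    all_goals
      intro h4 h5
      rename_i hC _
      exact hC (by rw [h4, h5]; ring)
  · refine (mem_dualOrbit_e_c₃ 1 v).trans ?_
    split_ifs <;> simp [*]
  · refine (mem_dualOrbit_e_c₂ 1 v).trans ?_
    split_ifs <;> simp [*]
  · refine (mem_dualOrbit_e_c₁ 1 1 1 h1 h1 v).trans ?_
    split_ifs <;> simp [*]
  · refine (mem_dualOrbit_e_c₁ 1 1 w h1 hw0 v).trans ?_
    rw [hsq]
    split_ifs <;> simp [*]
  · refine (mem_dualOrbit_c₃ v).trans ?_
    split_ifs <;> simp [*]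
  · refine (mem_dualOrbit_c₂ v).trans ?_
    split_ifs <;> simp [*]
  · refine (mem_dualOrbit_f v).trans ?_
    split_ifs <;> simp [*]
    all_goals
      intro h4 h5
      rename_i hC
      exact hC (by rw [h4, h5]; ring)
  · refine (mem_dualOrbit_f_c₃ v).trans ?_
    split_ifs <;> simp [*]
  · refine (mem_dualOrbit_f_c₂ v).trans ?_
    split_ifs <;> simp [*]
  · refine (mem_dualOrbit_f_c₁ v).trans ?_
    split_ifs <;> simp [*]

end Orbits

/-! ### Lengths of the orbits -/

section Counting

variable {p : ℕ} [Fact p.Prime]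

theorem ncard_ne_zero : ({x : ZMod p | x ≠ 0}.ncard : ℚ) = p - 1 := by
  have h := Set.ncard_add_ncard_compl ({0} : Set (ZMod p))
  rw [Set.ncard_singleton, Nat.card_zmod] at h
  have h2 : ({0} : Set (ZMod p))ᶜ = {x | x ≠ 0} := rfl
  have h3 := congrArg (Nat.cast : ℕ → ℚ) h
  push_cast at h3
  rw [← h2]
  linarith

theorem ncard_pair_ne_zero :
    ({x : ZMod p × ZMod p | ¬(x.1 = 0 ∧ x.2 = 0)}.ncard : ℚ) = (p : ℚ) ^ 2 - 1 := by
  have h := Set.ncard_add_ncard_compl ({0} : Set (ZMod p × ZMod p))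
  rw [Set.ncard_singleton, Nat.card_prod, Nat.card_zmod] at h
  have h2 : ({0} : Set (ZMod p × ZMod p))ᶜ = {x | ¬(x.1 = 0 ∧ x.2 = 0)} := by
    ext x
    simp [Prod.ext_iff]
  have h3 := congrArg (Nat.cast : ℕ → ℚ) h
  push_cast at h3
  rw [← h2]
  linarith

theorem ncard_univ_zmod : ((Set.univ : Set (ZMod p)).ncard : ℚ) = p := by
  rw [Set.ncard_univ, Nat.card_zmod]

/-- Multiplication by w exchanges nonzero squares and nonsquares, so each class has half of the p -
1 units. -/
theorem ncard_isSquare_mul {w : ZMod p} (hw : ¬ IsSquare w) :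
    ({x : ZMod p | x ≠ 0 ∧ IsSquare (x * (1 * 1))}.ncard : ℚ) = 1 / 2 * (p - 1) ∧
    ({x : ZMod p | x ≠ 0 ∧ IsSquare (x * (1 * w))}.ncard : ℚ) = 1 / 2 * (p - 1) := by
  have hw0 : w ≠ 0 := by
    rintro rfl
    exact hw IsSquare.zero
  set S := {x : ZMod p | x ≠ 0 ∧ IsSquare (x * (1 * 1))}
  set N := {x : ZMod p | x ≠ 0 ∧ IsSquare (x * (1 * w))}
  have hN : ∀ x, x ∈ N ↔ x ≠ 0 ∧ ¬ IsSquare x := fun x => and_congr_right fun hx => by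
    rw [one_mul]
    exact isSquare_mul_iff_of_not_isSquare hw hx
  have hS : ∀ x, x ∈ S ↔ x ≠ 0 ∧ IsSquare x := fun x => by simp [S]
  have h1 : (fun x => w * x) '' N = S := by
    ext x
    constructor
    · rintro ⟨y, hy, rfl⟩
      refine ⟨mul_ne_zero hw0 hy.1, ?_⟩
      have := hy.2
      rw [one_mul, mul_comm] at this
      simpa using this
    · rintro ⟨hx, hx2⟩
      refine ⟨x / w, ⟨div_ne_zero hx hw0, ?_⟩, by simp only; field_simp⟩
      convert hx2 using 1
      field_simp
  have h2 : S.ncard = N.ncard := by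
    rw [← h1]
    exact Set.ncard_image_of_injective _ (mul_right_injective₀ hw0)
  have h3 : S ∪ N = {x | x ≠ 0} := by
    ext x
    rw [Set.mem_union, hS, hN]
    simp only [Set.mem_ofPred_eq]
    tauto
  have h4 : Disjoint S N := by
    rw [Set.disjoint_left]
    intro x hx hx'
    rw [hS] at hx
    rw [hN] at hx'
    exact hx'.2 hx.2
  have h5 := Set.ncard_union_eq h4
  rw [h3] at h5
  have h6 := ncard_ne_zero (p := p)
  rw [h5, h2] at h6
  push_cast at h6
  rw [h2]
  constructor <;> linarith

/-- A vector that has determinant 1 with a given nonzero vector. -/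
theorem exists_section (K : Type*) [Field K] : ∃ n : K × K → K × K,
    ∀ e : K × K, ¬(e.1 = 0 ∧ e.2 = 0) → (n e).1 * e.2 - e.1 * (n e).2 = 1 := by
  have : ∀ e : K × K, ∃ n : K × K, ¬(e.1 = 0 ∧ e.2 = 0) → n.1 * e.2 - e.1 * n.2 = 1 := by
    intro e
    by_cases he : e.1 = 0 ∧ e.2 = 0
    · exact ⟨0, fun h => absurd he h⟩
    · obtain ⟨a, b, h⟩ := exists_det_eq he 1
      exact ⟨(a, b), fun _ => h⟩
  choose n hn using this
  exact ⟨n, hn⟩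

/-- For each e ≠ 0 choose n with n∧e = 1 and write f = s e + F n, c = t e + C n. The coefficients F
and C are the orbit invariants, and s is free. Membership thus becomes a product condition: p² - 1
choices of e, then F in A with s arbitrary, then (C, t, c₃) in T. -/
theorem ncard_of_e_ne_zero (S : Set (Fin 7 → ZMod p)) (A : Set (ZMod p))
    (T : Set (ZMod p × ZMod p × ZMod p)) (hS : ∀ v ∈ S, ¬(v 0 = 0 ∧ v 1 = 0))
    (hST : ∀ e₁ e₂ f₁ f₂ c₁ c₂ c₃ s t F C n₁ n₂ : ZMod p, ¬(e₁ = 0 ∧ e₂ = 0) →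
      n₁ * e₂ - e₁ * n₂ = 1 → f₁ = s * e₁ + F * n₁ → f₂ = s * e₂ + F * n₂ →
      c₁ = t * e₁ + C * n₁ → c₂ = t * e₂ + C * n₂ → f₁ * e₂ - f₂ * e₁ = F →
      c₁ * e₂ - c₂ * e₁ = C →
      (![e₁, e₂, f₁, f₂, c₁, c₂, c₃] ∈ S ↔ F ∈ A ∧ (C, t, c₃) ∈ T)) :
    (S.ncard : ℚ) = (p ^ 2 - 1) * (A.ncard * p) * T.ncard := by
  obtain ⟨n, hn⟩ := exists_section (ZMod p)
  let Θ : (ZMod p × ZMod p) × (ZMod p × ZMod p) × (ZMod p × ZMod p × ZMod p) → Fin 7 → ZMod p :=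
    fun x => ![x.1.1, x.1.2, x.2.1.2 * x.1.1 + x.2.1.1 * (n x.1).1,
      x.2.1.2 * x.1.2 + x.2.1.1 * (n x.1).2, x.2.2.2.1 * x.1.1 + x.2.2.1 * (n x.1).1,
      x.2.2.2.1 * x.1.2 + x.2.2.1 * (n x.1).2, x.2.2.2.2]
  set D : Set ((ZMod p × ZMod p) × (ZMod p × ZMod p) × (ZMod p × ZMod p × ZMod p)) :=
    {e | ¬(e.1 = 0 ∧ e.2 = 0)} ×ˢ (A ×ˢ Set.univ) ×ˢ T
  have hmem : ∀ x, ¬(x.1.1 = 0 ∧ x.1.2 = 0) → (Θ x ∈ S ↔ x.2.1.1 ∈ A ∧ x.2.2 ∈ T) := by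
    rintro ⟨⟨e₁, e₂⟩, ⟨F, s⟩, C, t, c₃⟩ he
    have h1 := hn (e₁, e₂) he
    refine hST e₁ e₂ _ _ _ _ c₃ s t F C _ _ he h1 rfl rfl rfl rfl ?_ ?_
    · simp only at h1 ⊢
      linear_combination F * h1
    · simp only at h1 ⊢
      linear_combination C * h1
  have hinj : Set.InjOn Θ D := by
    rintro ⟨⟨e₁, e₂⟩, ⟨F, s⟩, C, t, c₃⟩ ⟨he, -⟩ ⟨⟨e₁', e₂'⟩, ⟨F', s'⟩, C', t', c₃'⟩ - h
    have h0 : e₁ = e₁' := congrFun h 0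
    have h1 : e₂ = e₂' := congrFun h 1
    subst h0 h1
    have h2 := congrFun h 2
    have h3 := congrFun h 3
    have h4 := congrFun h 4
    have h5 := congrFun h 5
    have h6 : c₃ = c₃' := congrFun h 6
    have hd := hn (e₁, e₂) he
    simp [Θ] at h2 h3 h4 h5 hd
    have hF : F = F' := by linear_combination e₂ * h2 - e₁ * h3 - (F - F') * hd
    have hC : C = C' := by linear_combination e₂ * h4 - e₁ * h5 - (C - C') * hd
    have hs : s = s' := by
      linear_combination (n (e₁, e₂)).1 * h3 - (n (e₁, e₂)).2 * h2 - (s - s') * hd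
    have ht : t = t' := by
      linear_combination (n (e₁, e₂)).1 * h5 - (n (e₁, e₂)).2 * h4 - (t - t') * hd
    rw [hF, hC, hs, ht, h6]
  have himg : S = Θ '' D := by
    ext v
    constructor
    · intro hv
      have he := hS v hv
      have hd := hn (v 0, v 1) he
      have hx : Θ ((v 0, v 1), (v 2 * v 1 - v 3 * v 0,
          (n (v 0, v 1)).1 * v 3 - (n (v 0, v 1)).2 * v 2), v 4 * v 1 - v 5 * v 0,
          (n (v 0, v 1)).1 * v 5 - (n (v 0, v 1)).2 * v 4, v 6) = v := by
        simp only at hd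
        ext j
        fin_cases j <;> simp [Θ]
        · linear_combination v 2 * hd
        · linear_combination v 3 * hd
        · linear_combination v 4 * hd
        · linear_combination v 5 * hd
      rw [← hx] at hv
      rw [hmem _ he] at hv
      refine ⟨_, ⟨?_, ⟨hv.1, Set.mem_univ _⟩, hv.2⟩, hx⟩
      exact he
    · rintro ⟨x, ⟨he, ⟨hA, -⟩, hT⟩, rfl⟩
      exact (hmem x he).2 ⟨hA, hT⟩
  rw [himg, hinj.ncard_image, Set.ncard_prod, Set.ncard_prod, Set.ncard_prod]
  push_cast
  rw [ncard_pair_ne_zero, ncard_univ_zmod]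
  ring

/-- The same count with e = 0, where f takes over the role of the nonzero vector (it is called e₁,
e₂ here). -/
theorem ncard_of_f_ne_zero (S : Set (Fin 7 → ZMod p))
    (T : Set (ZMod p × ZMod p × ZMod p))
    (hS : ∀ v ∈ S, (v 0 = 0 ∧ v 1 = 0) ∧ ¬(v 2 = 0 ∧ v 3 = 0))
    (hST : ∀ e₁ e₂ c₁ c₂ c₃ t C n₁ n₂ : ZMod p, ¬(e₁ = 0 ∧ e₂ = 0) →
      n₁ * e₂ - e₁ * n₂ = 1 → c₁ = t * e₁ + C * n₁ → c₂ = t * e₂ + C * n₂ →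
      c₁ * e₂ - c₂ * e₁ = C →
      (![0, 0, e₁, e₂, c₁, c₂, c₃] ∈ S ↔ (C, t, c₃) ∈ T)) :
    (S.ncard : ℚ) = (p ^ 2 - 1) * T.ncard := by
  obtain ⟨n, hn⟩ := exists_section (ZMod p)
  let Θ : (ZMod p × ZMod p) × (ZMod p × ZMod p × ZMod p) → Fin 7 → ZMod p :=
    fun x => ![0, 0, x.1.1, x.1.2, x.2.2.1 * x.1.1 + x.2.1 * (n x.1).1,
      x.2.2.1 * x.1.2 + x.2.1 * (n x.1).2, x.2.2.2]
  set D : Set ((ZMod p × ZMod p) × (ZMod p × ZMod p × ZMod p)) :=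
    {e | ¬(e.1 = 0 ∧ e.2 = 0)} ×ˢ T
  have hmem : ∀ x, ¬(x.1.1 = 0 ∧ x.1.2 = 0) → (Θ x ∈ S ↔ x.2 ∈ T) := by
    rintro ⟨⟨e₁, e₂⟩, C, t, c₃⟩ he
    have h1 := hn (e₁, e₂) he
    refine hST e₁ e₂ _ _ c₃ t C _ _ he h1 rfl rfl ?_
    simp only at h1 ⊢
    linear_combination C * h1
  have hinj : Set.InjOn Θ D := by
    rintro ⟨⟨e₁, e₂⟩, C, t, c₃⟩ ⟨he, -⟩ ⟨⟨e₁', e₂'⟩, C', t', c₃'⟩ - h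
    have h0 : e₁ = e₁' := congrFun h 2
    have h1 : e₂ = e₂' := congrFun h 3
    subst h0 h1
    have h4 := congrFun h 4
    have h5 := congrFun h 5
    have h6 : c₃ = c₃' := congrFun h 6
    have hd := hn (e₁, e₂) he
    simp [Θ] at h4 h5 hd
    have hC : C = C' := by linear_combination e₂ * h4 - e₁ * h5 - (C - C') * hd
    have ht : t = t' := by
      linear_combination (n (e₁, e₂)).1 * h5 - (n (e₁, e₂)).2 * h4 - (t - t') * hd
    rw [hC, ht, h6]
  have himg : S = Θ '' D := by
    ext v
    constructor
    · intro hv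
      obtain ⟨⟨h0, h1⟩, he⟩ := hS v hv
      have hd := hn (v 2, v 3) he
      have hx : Θ ((v 2, v 3), v 4 * v 3 - v 5 * v 2,
          (n (v 2, v 3)).1 * v 5 - (n (v 2, v 3)).2 * v 4, v 6) = v := by
        simp only at hd
        ext j
        fin_cases j <;> simp [Θ, h0, h1]
        · linear_combination v 4 * hd
        · linear_combination v 5 * hd
      rw [← hx] at hv
      rw [hmem _ he] at hv
      refine ⟨_, ⟨?_, hv⟩, hx⟩
      exact he
    · rintro ⟨x, ⟨he, hT⟩, rfl⟩
      exact (hmem x he).2 hT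
  rw [himg, hinj.ncard_image, Set.ncard_prod]
  push_cast
  rw [ncard_pair_ne_zero]

theorem ncard_of_f_eq_zero (S : Set (Fin 7 → ZMod p)) (T : Set ((ZMod p × ZMod p) × ZMod p))
    (hS : ∀ v ∈ S, (v 0 = 0 ∧ v 1 = 0) ∧ (v 2 = 0 ∧ v 3 = 0))
    (hST : ∀ c₁ c₂ c₃ : ZMod p, ![0, 0, 0, 0, c₁, c₂, c₃] ∈ S ↔ ((c₁, c₂), c₃) ∈ T) :
    S.ncard = T.ncard := by
  let Θ : (ZMod p × ZMod p) × ZMod p → Fin 7 → ZMod p :=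
    fun x => ![0, 0, 0, 0, x.1.1, x.1.2, x.2]
  have hinj : Function.Injective Θ := by
    rintro ⟨⟨c₁, c₂⟩, c₃⟩ ⟨⟨c₁', c₂'⟩, c₃'⟩ h
    have h4 : c₁ = c₁' := congrFun h 4
    have h5 : c₂ = c₂' := congrFun h 5
    have h6 : c₃ = c₃' := congrFun h 6
    rw [h4, h5, h6]
  have himg : S = Θ '' T := by
    ext v
    constructor
    · intro hv
      obtain ⟨⟨h0, h1⟩, h2, h3⟩ := hS v hv
      have hx : Θ ((v 4, v 5), v 6) = v := by
        ext j
        fin_cases j <;> simp [Θ, *]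
      rw [← hx] at hv
      exact ⟨_, (hST _ _ _).1 hv, hx⟩
    · rintro ⟨x, hT, rfl⟩
      exact (hST _ _ _).2 hT
  rw [himg, Set.ncard_image_of_injective _ hinj]

variable [NeZero (12 : ZMod p)]

/-- The admissible values of the invariant `f₁ e₂ - f₂ e₁`. -/
theorem ncard_iff_zero : ({F : ZMod p | F = 0 ↔ (0 : ZMod p) = 0}.ncard : ℚ) = 1 ∧
    ({F : ZMod p | F = 0 ↔ (1 : ZMod p) = 0}.ncard : ℚ) = p - 1 := by
  constructor
  · simp
  · simpa using ncard_ne_zero (p := p)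

theorem ncard_dualOrbit_e_c₃ (φ : ZMod p) :
    ((dualOrbit p ![0, 1, φ, 0, 0, 0, 1]).ncard : ℚ) =
      (p ^ 2 - 1) * ({F : ZMod p | F = 0 ↔ φ = 0}.ncard * p) * (p * (p * (p - 1))) := by
  rw [ncard_of_e_ne_zero _ {F : ZMod p | F = 0 ↔ φ = 0} (Set.univ ×ˢ Set.univ ×ˢ {x | x ≠ 0})
    (fun v hv => ((mem_dualOrbit_e_c₃ φ v).1 hv).1), Set.ncard_prod, Set.ncard_prod]
  · push_cast
    rw [ncard_univ_zmod, ncard_ne_zero]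
  · intro e₁ e₂ f₁ f₂ c₁ c₂ c₃ s t F C n₁ n₂ he hn hf₁ hf₂ hc₁ hc₂ hF hC
    rw [mem_dualOrbit_e_c₃]
    simp [hF, he]

theorem ncard_dualOrbit_e (φ : ZMod p) :
    ((dualOrbit p ![0, 1, φ, 0, 0, 0, 0]).ncard : ℚ) =
      (p ^ 2 - 1) * ({F : ZMod p | F = 0 ↔ φ = 0}.ncard * p) := by
  rw [ncard_of_e_ne_zero _ {F : ZMod p | F = 0 ↔ φ = 0} {(0, 0, 0)}
    (fun v hv => ((mem_dualOrbit_e φ v).1 hv).1), Set.ncard_singleton]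
  · push_cast
    ring
  · intro e₁ e₂ f₁ f₂ c₁ c₂ c₃ s t F C n₁ n₂ he hn hf₁ hf₂ hc₁ hc₂ hF hC
    rw [mem_dualOrbit_e]
    -- The vectors e and n form a basis, so c vanishes exactly when both of its coefficients do.
    have : c₁ = 0 ∧ c₂ = 0 ↔ C = 0 ∧ t = 0 := by
      constructor
      · rintro ⟨rfl, rfl⟩
        have hC0 : C = 0 := by rw [← hC]; ring
        subst hC0
        refine ⟨rfl, ?_⟩
        linear_combination n₂ * hc₁ - n₁ * hc₂ - t * hn
      · rintro ⟨rfl, rfl⟩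
        simp [hc₁, hc₂]
    simp [hF, he, this]
    tauto

theorem ncard_dualOrbit_e_c₂ (φ : ZMod p) :
    ((dualOrbit p ![0, 1, φ, 0, 0, 1, 0]).ncard : ℚ) =
      (p ^ 2 - 1) * ({F : ZMod p | F = 0 ↔ φ = 0}.ncard * p) * (p - 1) := by
  rw [ncard_of_e_ne_zero _ {F : ZMod p | F = 0 ↔ φ = 0} ({0} ×ˢ {x | x ≠ 0} ×ˢ {0})
    (fun v hv => ((mem_dualOrbit_e_c₂ φ v).1 hv).1), Set.ncard_prod, Set.ncard_prod,
    Set.ncard_singleton]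
  · push_cast
    rw [ncard_ne_zero]
    ring
  · intro e₁ e₂ f₁ f₂ c₁ c₂ c₃ s t F C n₁ n₂ he hn hf₁ hf₂ hc₁ hc₂ hF hC
    rw [mem_dualOrbit_e_c₂]
    have : C = 0 → (¬(c₁ = 0 ∧ c₂ = 0) ↔ t ≠ 0) := by
      rintro rfl
      rw [hc₁, hc₂]
      simp
      tauto
    simp [hF, hC, he]
    tauto

theorem ncard_dualOrbit_e_c₁ (φ ε η : ZMod p) (hε : ε ≠ 0) (hη : η ≠ 0) :
    ((dualOrbit p ![0, ε, φ, 0, η, 0, 0]).ncard : ℚ) =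
      (p ^ 2 - 1) * ({F : ZMod p | F = 0 ↔ φ = 0}.ncard * p) *
        ({x : ZMod p | x ≠ 0 ∧ IsSquare (x * (ε * η))}.ncard * p) := by
  rw [ncard_of_e_ne_zero _ {F : ZMod p | F = 0 ↔ φ = 0}
    ({x : ZMod p | x ≠ 0 ∧ IsSquare (x * (ε * η))} ×ˢ Set.univ ×ˢ {0})
    (fun v hv => ((mem_dualOrbit_e_c₁ φ ε η hε hη v).1 hv).1), Set.ncard_prod, Set.ncard_prod,
    Set.ncard_singleton]
  · push_cast
    rw [ncard_univ_zmod]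
    ring
  · intro e₁ e₂ f₁ f₂ c₁ c₂ c₃ s t F C n₁ n₂ he hn hf₁ hf₂ hc₁ hc₂ hF hC
    rw [mem_dualOrbit_e_c₁ φ ε η hε hη]
    simp [hF, hC, he]
    tauto

theorem ncard_dualOrbit_c₃ :
    ((dualOrbit p ![0, 0, 0, 0, 0, 0, 1]).ncard : ℚ) = p * p * (p - 1) := by
  rw [ncard_of_f_eq_zero _ ((Set.univ ×ˢ Set.univ) ×ˢ {x | x ≠ 0}) (fun v hv => by
    have := (mem_dualOrbit_c₃ v).1 hv; exact ⟨this.1, this.2.1⟩), Set.ncard_prod, Set.ncard_prod]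
  · push_cast
    rw [ncard_univ_zmod, ncard_ne_zero]
  · intro c₁ c₂ c₃
    rw [mem_dualOrbit_c₃]
    simp

theorem ncard_dualOrbit_c₂ :
    ((dualOrbit p ![0, 0, 0, 0, 0, 1, 0]).ncard : ℚ) = p ^ 2 - 1 := by
  rw [ncard_of_f_eq_zero _ ({x | ¬(x.1 = 0 ∧ x.2 = 0)} ×ˢ {0}) (fun v hv => by
    have := (mem_dualOrbit_c₂ v).1 hv; exact ⟨this.1, this.2.1⟩), Set.ncard_prod,
    Set.ncard_singleton]
  · push_cast
    rw [ncard_pair_ne_zero, mul_one]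
  · intro c₁ c₂ c₃
    rw [mem_dualOrbit_c₂]
    simp
    tauto

theorem ncard_dualOrbit_f :
    ((dualOrbit p ![0, 0, 0, 1, 0, 0, 0]).ncard : ℚ) = p ^ 2 - 1 := by
  rw [ncard_of_f_ne_zero _ {(0, 0, 0)} (fun v hv => by
    have := (mem_dualOrbit_f v).1 hv; exact ⟨this.1, this.2.1⟩), Set.ncard_singleton]
  · push_cast
    ring
  · intro e₁ e₂ c₁ c₂ c₃ t C n₁ n₂ he hn hc₁ hc₂ hC
    rw [mem_dualOrbit_f]
    have : c₁ = 0 ∧ c₂ = 0 ↔ C = 0 ∧ t = 0 := by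
      constructor
      · rintro ⟨rfl, rfl⟩
        have hC0 : C = 0 := by rw [← hC]; ring
        subst hC0
        refine ⟨rfl, ?_⟩
        linear_combination n₂ * hc₁ - n₁ * hc₂ - t * hn
      · rintro ⟨rfl, rfl⟩
        simp [hc₁, hc₂]
    simp [he, this]
    tauto

theorem ncard_dualOrbit_f_c₃ :
    ((dualOrbit p ![0, 0, 0, 1, 0, 0, 1]).ncard : ℚ) = (p ^ 2 - 1) * (p * (p * (p - 1))) := by
  rw [ncard_of_f_ne_zero _ (Set.univ ×ˢ Set.univ ×ˢ {x | x ≠ 0}) (fun v hv => by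
    have := (mem_dualOrbit_f_c₃ v).1 hv; exact ⟨this.1, this.2.1⟩), Set.ncard_prod, Set.ncard_prod]
  · push_cast
    rw [ncard_univ_zmod, ncard_ne_zero]
  · intro e₁ e₂ c₁ c₂ c₃ t C n₁ n₂ he hn hc₁ hc₂ hC
    rw [mem_dualOrbit_f_c₃]
    simp [he]

theorem ncard_dualOrbit_f_c₂ :
    ((dualOrbit p ![0, 0, 0, 1, 0, 1, 0]).ncard : ℚ) = (p ^ 2 - 1) * (p - 1) := by
  rw [ncard_of_f_ne_zero _ ({0} ×ˢ {x | x ≠ 0} ×ˢ {0}) (fun v hv => by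
    have := (mem_dualOrbit_f_c₂ v).1 hv; exact ⟨this.1, this.2.1⟩), Set.ncard_prod, Set.ncard_prod,
    Set.ncard_singleton]
  · push_cast
    rw [ncard_ne_zero]
    ring
  · intro e₁ e₂ c₁ c₂ c₃ t C n₁ n₂ he hn hc₁ hc₂ hC
    rw [mem_dualOrbit_f_c₂]
    have : C = 0 → (¬(c₁ = 0 ∧ c₂ = 0) ↔ t ≠ 0) := by
      rintro rfl
      rw [hc₁, hc₂]
      simp
      tauto
    simp [he, hC]
    tauto

theorem ncard_dualOrbit_f_c₁ :
    ((dualOrbit p ![0, 0, 0, 1, 1, 0, 0]).ncard : ℚ) = (p ^ 2 - 1) * ((p - 1) * p) := by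
  rw [ncard_of_f_ne_zero _ ({x | x ≠ 0} ×ˢ Set.univ ×ˢ {0}) (fun v hv => by
    have := (mem_dualOrbit_f_c₁ v).1 hv; exact ⟨this.1, this.2.1⟩), Set.ncard_prod, Set.ncard_prod,
    Set.ncard_singleton]
  · push_cast
    rw [ncard_ne_zero, ncard_univ_zmod]
    ring
  · intro e₁ e₂ c₁ c₂ c₃ t C n₁ n₂ he hn hc₁ hc₂ hC
    rw [mem_dualOrbit_f_c₁]
    simp [he, hC]
    tauto

theorem ncard_dualOrbit_orbitRep {w : ZMod p} (hw : ¬ IsSquare w) (i : Fin 16) :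
    ((dualOrbit p (orbitRep p w i)).ncard : ℚ) = orbitLength p i := by
  have hw0 : w ≠ 0 := by
    rintro rfl
    exact hw IsSquare.zero
  have h1 : (1 : ZMod p) ≠ 0 := one_ne_zero
  obtain ⟨hF0, hF1⟩ := ncard_iff_zero (p := p)
  obtain ⟨hS, hN⟩ := ncard_isSquare_mul hw
  fin_cases i
  · refine (ncard_dualOrbit_e 0).trans ?_
    rw [hF0]; simp only [orbitLength]; simp; ring
  · refine (ncard_dualOrbit_e_c₃ 0).trans ?_
    rw [hF0]; simp [orbitLength]; ring
  · refine (ncard_dualOrbit_e_c₂ 0).trans ?_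
    rw [hF0]; simp [orbitLength]; ring
  · refine (ncard_dualOrbit_e_c₁ 0 1 1 h1 h1).trans ?_
    rw [hF0, hS]; simp [orbitLength]; ring
  · refine (ncard_dualOrbit_e_c₁ 0 1 w h1 hw0).trans ?_
    rw [hF0, hN]; simp [orbitLength]; ring
  · refine (ncard_dualOrbit_e 1).trans ?_
    rw [hF1]; simp [orbitLength]; ring
  · refine (ncard_dualOrbit_e_c₃ 1).trans ?_
    rw [hF1]; simp [orbitLength]; ring
  · refine (ncard_dualOrbit_e_c₂ 1).trans ?_
    rw [hF1]; simp [orbitLength]; ring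
  · refine (ncard_dualOrbit_e_c₁ 1 1 1 h1 h1).trans ?_
    rw [hF1, hS]; simp [orbitLength]; ring
  · refine (ncard_dualOrbit_e_c₁ 1 1 w h1 hw0).trans ?_
    rw [hF1, hN]; simp [orbitLength]; ring
  · refine ncard_dualOrbit_c₃.trans ?_
    change _ = (p : ℚ) ^ 2 * (p - 1)
    ring
  · exact ncard_dualOrbit_c₂
  · exact ncard_dualOrbit_f
  · refine ncard_dualOrbit_f_c₃.trans ?_
    simp [orbitLength]; ring
  · refine ncard_dualOrbit_f_c₂.trans ?_
    simp [orbitLength]; ring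
  · refine ncard_dualOrbit_f_c₁.trans ?_
    simp [orbitLength]; ring

end Counting

/-! ### The lower exponent-p central series -/

section LowerPCentral

variable (p : ℕ) {G H : Type*} [Group G] [Group H]

theorem lowerPCentral_succ (i : ℕ) : lowerPCentral p G (i + 1) = Subgroup.closure
    {x | ∃ h ∈ lowerPCentral p G i, ∃ k ∈ lowerPCentral p G i, ∃ g : G, x = comm h g * k ^ p} :=
  rfl

theorem lowerPCentral_succ_le {i : ℕ} {S : Subgroup G}
    (hc : ∀ h ∈ lowerPCentral p G i, ∀ g, comm h g ∈ S)
    (hp : ∀ k ∈ lowerPCentral p G i, k ^ p ∈ S) : lowerPCentral p G (i + 1) ≤ S := by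
  rw [lowerPCentral_succ, Subgroup.closure_le]
  rintro _ ⟨h, hh, k, hk, g, rfl⟩
  exact mul_mem (hc h hh g) (hp k hk)

theorem comm_mem_lowerPCentral {i : ℕ} {h : G} (hh : h ∈ lowerPCentral p G i) (g : G) :
    comm h g ∈ lowerPCentral p G (i + 1) :=
  Subgroup.subset_closure ⟨h, hh, 1, one_mem _, g, by simp⟩

theorem map_lowerPCentral (f : G →* H) (hf : Function.Surjective f) (i : ℕ) :
    (lowerPCentral p G i).map f = lowerPCentral p H i := by
  induction i with
  | zero => simpa [lowerPCentral] using Subgroup.map_top_of_surjective f hf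
  | succ i ih =>
    rw [lowerPCentral_succ, lowerPCentral_succ, MonoidHom.map_closure]
    congr 1
    ext x
    constructor
    · rintro ⟨_, ⟨h, hh, k, hk, g, rfl⟩, rfl⟩
      refine ⟨f h, ?_, f k, ?_, f g, by rw [map_mul, map_comm, map_pow]⟩
      · rw [← ih]; exact Subgroup.mem_map_of_mem f hh
      · rw [← ih]; exact Subgroup.mem_map_of_mem f hk
    · rintro ⟨h, hh, k, hk, g, rfl⟩
      rw [← ih] at hh hk
      obtain ⟨h, hh, rfl⟩ := hh
      obtain ⟨k, hk, rfl⟩ := hk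
      obtain ⟨g, rfl⟩ := hf g
      exact ⟨_, ⟨h, hh, k, hk, g, rfl⟩, by rw [map_mul, map_comm, map_pow]⟩

theorem lowerPCentral_succ_eq_bot_of_le {i : ℕ} (h : lowerPCentral p G i ≤ torsionCenter p G) :
    lowerPCentral p G (i + 1) = ⊥ :=
  le_bot_iff.1 (lowerPCentral_succ_le p
    (fun _ hx g => Subgroup.mem_bot.2 ((comm_eq_one_iff _ _).2 ((h hx).1 g)))
    (fun _ hk => Subgroup.mem_bot.2 (h hk).2))

/-- Setting k = 1 in a generator [h, g]kᵖ isolates the commutators, and setting h = g = 1 isolates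
the p-th powers. -/
theorem lowerPCentral_le_torsionCenter {i : ℕ} (h : lowerPCentral p G (i + 1) = ⊥) :
    lowerPCentral p G i ≤ torsionCenter p G := fun x hx =>
  ⟨fun g => (comm_eq_one_iff _ _).1 (Subgroup.mem_bot.1 (h ▸ comm_mem_lowerPCentral p hx g)),
    Subgroup.mem_bot.1 (h ▸ Subgroup.subset_closure ⟨1, one_mem _, x, hx, 1, by simp [comm]⟩)⟩

theorem hasPClass_of {c : ℕ} (h : lowerPCentral p G (c + 1) = ⊥) (h' : lowerPCentral p G c ≠ ⊥) :
    HasPClass p G (c + 1) := by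
  have mono : ∀ i, lowerPCentral p G i = ⊥ → lowerPCentral p G (i + 1) = ⊥ := fun i hi =>
    lowerPCentral_succ_eq_bot_of_le p (hi ▸ bot_le)
  refine ⟨h, fun i hi => ?_⟩
  by_contra! hlt
  have : ∀ k, lowerPCentral p G (i + k) = ⊥ := fun k => by
    induction k with
    | zero => exact hi
    | succ k ih => exact mono _ ih
  apply h'
  have hk := this (c - i)
  rwa [Nat.add_sub_cancel' (by omega)] at hk

end LowerPCentral

/-! ### Linear forms on the multiplicator and the corresponding quotients of the p-cover -/

section Kernels

variable (p : ℕ) [Fact p.Prime] [NeZero (12 : ZMod p)]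

/-- The linear form on the multiplicator with coefficients `v`. -/
def dotHom (v : Fin 7 → ZMod p) : Multiplicative (Fin 7 → ZMod p) →* Multiplicative (ZMod p) where
  toFun u := Multiplicative.ofAdd (v ⬝ᵥ u.toAdd)
  map_one' := by simp
  map_mul' u u' := by simp [dotProduct_add]

/-- The kernel of the linear form `v`, as a subgroup of the `p`-cover. -/
noncomputable def formKernel (v : Fin 7 → ZMod p) : Subgroup (PCover p (baseMap p)) :=
  (dotHom p v).ker.map (multHom p)

theorem multHom_mem_formKernel {v u : Fin 7 → ZMod p} :
    multHom p (Multiplicative.ofAdd u) ∈ formKernel p v ↔ v ⬝ᵥ u = 0 :=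
  Subgroup.mem_map_iff_mem (multHom_injective p)

theorem formKernel_le (v : Fin 7 → ZMod p) : formKernel p v ≤ multiplicator p (baseMap p) := by
  rintro _ ⟨u, -, rfl⟩
  exact multHom_mem p u

theorem mem_multiplicator_iff {x : PCover p (baseMap p)} :
    x ∈ multiplicator p (baseMap p) ↔ ∃ u, multHom p (Multiplicative.ofAdd u) = x := by
  rw [← range_multHom]
  rfl

instance formKernel_normal (v : Fin 7 → ZMod p) : (formKernel p v).Normal :=
  normal_of_le_torsionCenter ((formKernel_le p v).trans (multiplicator_le_torsionCenter p))

theorem dotProduct_single_eq (v : Fin 7 → ZMod p) (j : Fin 7) (a : ZMod p) :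
    v ⬝ᵥ Pi.single j a = v j * a := by
  simp

/-- The multiplicator has index p⁴ as the kernel of the map onto G, and the kernel of a nonzero form
has index p in it. -/
theorem index_formKernel {v : Fin 7 → ZMod p} (hv : v ≠ 0) : (formKernel p v).index = p ^ 5 := by
  rw [← Subgroup.relIndex_mul_index (formKernel_le p v)]
  have h1 : (multiplicator p (baseMap p)).index = p ^ 4 := by
    rw [multiplicator_eq_ker, Subgroup.index_ker, MonoidHom.range_eq_top.2 (baseProj_surjective p),
      Subgroup.card_top, card_baseGroup]
  have h2 : (formKernel p v).relIndex (multiplicator p (baseMap p)) = p := by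
    rw [← range_multHom, MonoidHom.range_eq_map, formKernel,
      Subgroup.relIndex_map_map_of_injective _ _ (multHom_injective p), Subgroup.relIndex_top_right,
      Subgroup.index_ker, MonoidHom.range_eq_top.2, Subgroup.card_top]
    · simp
    · obtain ⟨j, hj⟩ := Function.ne_iff.1 hv
      intro a
      refine ⟨Multiplicative.ofAdd (Pi.single j ((v j)⁻¹ * a.toAdd)), ?_⟩
      apply Multiplicative.toAdd.injective
      exact (dotProduct_single_eq p v j _).trans (mul_inv_cancel_left₀ hj _)
  rw [h1, h2]
  ring

/-- The group `H` is the quotient of the `p`-cover by the kernel of the linear form `v`. -/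
def IsFormQuotient (H : Type*) [Group H] (v : Fin 7 → ZMod p) : Prop :=
  ∃ f : PCover p (baseMap p) →* H, Function.Surjective f ∧ f.ker = formKernel p v

variable {p} {H H' : Type*} [Group H] [Group H'] {v u : Fin 7 → ZMod p}

theorem IsFormQuotient.mulEquiv (h : IsFormQuotient p H v) (h' : IsFormQuotient p H' v) :
    Nonempty (H ≃* H') := by
  obtain ⟨f, hf, hk⟩ := h
  obtain ⟨f', hf', hk'⟩ := h'
  exact ⟨(QuotientGroup.quotientKerEquivOfSurjective f hf).symm.trans
    ((QuotientGroup.quotientMulEquivOfEq (hk.trans hk'.symm)).trans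
      (QuotientGroup.quotientKerEquivOfSurjective f' hf'))⟩

theorem IsFormQuotient.congr (h : IsFormQuotient p H v) (e : H ≃* H') : IsFormQuotient p H' v := by
  obtain ⟨f, hf, hk⟩ := h
  refine ⟨e.toMonoidHom.comp f, e.surjective.comp hf, ?_⟩
  rw [← hk]
  ext x
  simp [MonoidHom.mem_ker]

theorem IsFormQuotient.card (h : IsFormQuotient p H v) (hv : v ≠ 0) : Nat.card H = p ^ 5 := by
  obtain ⟨f, hf, hk⟩ := h
  rw [← index_formKernel p hv, ← hk, Subgroup.index_ker, MonoidHom.range_eq_top.2 hf,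
    Subgroup.card_top]

theorem extension_multHom {α : MulAut (BaseGroup p)}
    {αs : PCover p (baseMap p) →* PCover p (baseMap p)}
    (h : ∀ x, baseProj p (αs x) = α (baseProj p x)) (w : Fin 7 → ZMod p) :
    αs (multHom p (Multiplicative.ofAdd w)) =
      multHom p (Multiplicative.ofAdd (w ᵥ* tupleMatrix p (autTuple p α))) := by
  let M : Multiplicative (Fin 7 → ZMod p) →* Multiplicative (Fin 7 → ZMod p) :=
    AddMonoidHom.toMultiplicative
      (Matrix.vecMulLinear (tupleMatrix p (autTuple p α))).toAddMonoidHom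
  have : αs.comp (multHom p) = (multHom p).comp M := by
    apply tuple_hom_ext
    intro j
    rw [MonoidHom.comp_apply, MonoidHom.comp_apply, multHom_single, extension_multGen p h]
    congr 1
    change _ = Pi.single j 1 ᵥ* _
    rw [Matrix.single_one_vecMul]
    rfl
  exact DFunLike.congr_fun this _

/-- An extension acts on exponent vectors by w ↦ wM, so pulling back the form v gives vMᵀ; this is
the origin of the transposes. No element outside the multiplicator enters the preimage, because α is
injective on G. -/
theorem comap_formKernel {α : MulAut (BaseGroup p)}
    {αs : PCover p (baseMap p) →* PCover p (baseMap p)}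
    (h : ∀ x, baseProj p (αs x) = α (baseProj p x)) (v : Fin 7 → ZMod p) :
    (formKernel p v).comap αs = formKernel p (v ᵥ* (tupleMatrix p (autTuple p α))ᵀ) := by
  have key : ∀ w, multHom p (Multiplicative.ofAdd w) ∈ (formKernel p v).comap αs ↔
      multHom p (Multiplicative.ofAdd w) ∈
        formKernel p (v ᵥ* (tupleMatrix p (autTuple p α))ᵀ) := fun w => by
    rw [Subgroup.mem_comap, extension_multHom h, multHom_mem_formKernel, multHom_mem_formKernel,
      Matrix.vecMul_transpose, dotProduct_comm, ← Matrix.dotProduct_mulVec, dotProduct_comm]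
  ext x
  constructor
  · intro hx
    have h1 : x ∈ multiplicator p (baseMap p) := by
      have h2 := formKernel_le p v hx
      rw [multiplicator_eq_ker, MonoidHom.mem_ker] at h2 ⊢
      rwa [h, map_eq_one_iff _ α.injective] at h2
    obtain ⟨w, rfl⟩ := (mem_multiplicator_iff p).1 h1
    exact (key w).1 hx
  · intro hx
    obtain ⟨w, rfl⟩ := (mem_multiplicator_iff p).1 (formKernel_le p _ hx)
    exact (key w).2 hx

theorem formKernel_smul {k : ZMod p} (hk : k ≠ 0) (v : Fin 7 → ZMod p) :
    formKernel p (k • v) = formKernel p v := by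
  have : ∀ w, multHom p (Multiplicative.ofAdd w) ∈ formKernel p (k • v) ↔
      multHom p (Multiplicative.ofAdd w) ∈ formKernel p v := fun w => by
    rw [multHom_mem_formKernel, multHom_mem_formKernel, smul_dotProduct, smul_eq_mul]
    simp [hk]
  ext x
  constructor
  · intro hx
    obtain ⟨w, rfl⟩ := (mem_multiplicator_iff p).1 (formKernel_le p _ hx)
    exact (this w).1 hx
  · intro hx
    obtain ⟨w, rfl⟩ := (mem_multiplicator_iff p).1 (formKernel_le p _ hx)
    exact (this w).2 hx

theorem mem_dualOrbit_iff_exists : u ∈ dualOrbit p v ↔ ∃ k : (ZMod p)ˣ, ∃ α : MulAut (BaseGroup p),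
    u = (k : ZMod p) • (v ᵥ* (tupleMatrix p (autTuple p α))ᵀ) := by
  constructor
  · rintro ⟨_, ⟨k, α, M, hM, rfl⟩, rfl⟩
    rw [isActionMatrix_iff] at hM
    exact ⟨k, α, by rw [hM, Matrix.vecMul_smul]⟩
  · rintro ⟨k, α, rfl⟩
    exact ⟨_, ⟨k, α, _, (isActionMatrix_iff p α _).2 rfl, rfl⟩, by rw [Matrix.vecMul_smul]⟩

theorem exists_extension' (α : MulAut (BaseGroup p)) :
    ∃ αs : PCover p (baseMap p) →* PCover p (baseMap p),
      ∀ x, baseProj p (αs x) = α (baseProj p x) := by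
  choose q hq using fun i : Fin 3 => baseProj_surjective p (α (baseGen p i.castSucc))
  obtain ⟨αs, -, h⟩ := exists_extension p α q hq
  exact ⟨αs, h⟩

/-- Composing the quotient map with an extension of α changes the kernel from that of v to that of
u. Surjectivity follows by counting: the new kernel has index p⁵, the order of H. -/
theorem IsFormQuotient.of_mem_dualOrbit (h : IsFormQuotient p H v) (hv : v ≠ 0) (hu : u ≠ 0)
    (huv : u ∈ dualOrbit p v) : IsFormQuotient p H u := by
  have hcard := h.card hv
  have : Finite H := Nat.finite_of_card_ne_zero (by
    rw [hcard]; exact pow_ne_zero _ (Fact.out : p.Prime).ne_zero)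
  obtain ⟨k, α, rfl⟩ := mem_dualOrbit_iff_exists.1 huv
  obtain ⟨f, hf, hk⟩ := h
  obtain ⟨αs, hαs⟩ := exists_extension' α
  have hker : (f.comp αs).ker =
      formKernel p ((k : ZMod p) • (v ᵥ* (tupleMatrix p (autTuple p α))ᵀ)) := by
    rw [← MonoidHom.comap_ker, hk, comap_formKernel hαs, formKernel_smul k.ne_zero]
  refine ⟨f.comp αs, ?_, hker⟩
  rw [← MonoidHom.range_eq_top]
  apply Subgroup.eq_top_of_card_eq
  rw [← Subgroup.index_ker, hker, index_formKernel p hu, hcard]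

end Kernels

/-! ### The lower exponent-p series of the p-cover and of the base group -/

section Series

variable (p : ℕ) [Fact p.Prime] [NeZero (12 : ZMod p)]

theorem pow_char_pi (n : ℕ) (x : Multiplicative (Fin n → ZMod p)) : x ^ p = 1 := by
  apply Multiplicative.toAdd.injective
  ext i
  simp

theorem lowerPCentral_one_cover : lowerPCentral p (PCover p (baseMap p)) 1 ≤
    ((BaseModel.abel.comp CoverModel.toBase).comp (coverHom p)).ker ⊓
      ((powMonoidHom p).comp (abelHom p)).ker := by
  have hpow : ∀ x : Multiplicative (Fin 3 → ZMod (p ^ 2)), (x ^ p) ^ p = 1 := fun x => by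
    rw [← pow_mul, ← pow_two]
    apply Multiplicative.toAdd.injective
    ext i
    simp
  refine lowerPCentral_succ_le p (fun h _ g => Subgroup.mem_inf.2 ⟨?_, ?_⟩)
    (fun k _ => Subgroup.mem_inf.2 ⟨?_, ?_⟩) <;> rw [MonoidHom.mem_ker]
  · rw [map_comm, comm_eq_one_of_commGroup]
  · rw [map_comm, comm_eq_one_of_commGroup]
  · rw [map_pow, pow_char_pi]
  · rw [MonoidHom.comp_apply, map_pow]
    exact hpow _

/-- The elements of the cover model with vanishing coordinates outside of positions 5 and 6. -/
def CoverModel.lastTerm : Subgroup (CoverModel (ZMod p)) where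
  carrier := {x | x.x₁ = 0 ∧ x.x₂ = 0 ∧ x.x₃ = 0 ∧ x.x₄ = 0 ∧ x.x₇ = 0 ∧ x.x₈ = 0}
  one_mem' := by simp [CoverModel.one_def]
  mul_mem' := by
    rintro x y ⟨h1, h2, h3, h4, h7, h8⟩ ⟨h1', h2', h3', h4', h7', h8'⟩
    simp [CoverModel.mul_def, *]
  inv_mem' := by
    rintro x ⟨h1, h2, h3, h4, h7, h8⟩
    simp [CoverModel.inv_def, *]

/-- Elements of the preceding term have x₁ = x₂ = x₃ = 0 in the cover model, so their commutators
live in positions 5 and 6. Their p-th powers die in both quotients and their commutators die in the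
abelian one. -/
theorem lowerPCentral_two_cover_le : lowerPCentral p (PCover p (baseMap p)) 2 ≤
    (CoverModel.lastTerm p).comap (coverHom p) ⊓ (abelHom p).ker := by
  have h1 : ∀ x ∈ lowerPCentral p (PCover p (baseMap p)) 1, (coverHom p x).x₁ = 0 ∧
      (coverHom p x).x₂ = 0 ∧ (coverHom p x).x₃ = 0 ∧ abelHom p x ^ p = 1 := fun x hx => by
    obtain ⟨ha, hb⟩ := lowerPCentral_one_cover p hx
    have ha' : ![(coverHom p x).x₁, (coverHom p x).x₂, (coverHom p x).x₃] = 0 := ha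
    exact ⟨congrFun ha' 0, congrFun ha' 1, congrFun ha' 2, hb⟩
  refine lowerPCentral_succ_le p (fun h hh g => Subgroup.mem_inf.2 ⟨?_, ?_⟩)
    (fun k hk => Subgroup.mem_inf.2 ⟨?_, ?_⟩)
  · obtain ⟨e1, e2, e3, -⟩ := h1 h hh
    rw [Subgroup.mem_comap, map_comm, CoverModel.comm_of_x₁_x₂ _ _ e1 e2, e3]
    simp [CoverModel.lastTerm]
  · rw [MonoidHom.mem_ker, map_comm, comm_eq_one_of_commGroup]
  · rw [Subgroup.mem_comap, map_pow, CoverModel.pow_char]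
    exact one_mem _
  · rw [MonoidHom.mem_ker, map_pow]
    exact (h1 k hk).2.2.2

theorem mem_lowerPCentral_two_cover_iff {x : PCover p (baseMap p)} :
    x ∈ lowerPCentral p (PCover p (baseMap p)) 2 ↔
      ∃ a b, x = multHom p (Multiplicative.ofAdd ![a, b, 0, 0, 0, 0, 0]) := by
  constructor
  · intro hx
    obtain ⟨⟨h1, h2, h3, h4, h7, h8⟩, h⟩ := lowerPCentral_two_cover_le p hx
    have hM : x ∈ multiplicator p (baseMap p) := by
      rw [multiplicator_eq_ker, MonoidHom.mem_ker, ← map_eq_one_iff _ (baseEquiv p).injective,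
        ← toBase_coverHom, CoverModel.toBase_apply, h1, h2, h3, h4, BaseModel.one_def]
    obtain ⟨u, rfl⟩ := (mem_multiplicator_iff p).1 hM
    have h' : (abelHom p (multHom p (Multiplicative.ofAdd u))).toAdd = 0 := h
    rw [coverHom_multHom] at h7 h8
    rw [abelHom_multHom] at h'
    simp only at h7 h8
    have h4 := val_mul_injective p (b := 0) ((congrFun h' 0).trans (by simp))
    have h5 := val_mul_injective p (b := 0) ((congrFun h' 1).trans (by simp))
    have h6 := val_mul_injective p (b := 0) ((congrFun h' 2).trans (by simp))
    refine ⟨u 0, u 1, ?_⟩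
    congr 2
    ext j
    fin_cases j <;> simp [*]
  · rintro ⟨a, b, rfl⟩
    have h4 : comm (coverGen p 1) (coverGen p 0) ∈ lowerPCentral p (PCover p (baseMap p)) 1 :=
      comm_mem_lowerPCentral p (i := 0) (Subgroup.mem_top _) _
    have h5 : multGen p 0 ∈ lowerPCentral p (PCover p (baseMap p)) 2 :=
      comm_mem_lowerPCentral p (i := 1) h4 _
    have h6 : multGen p 1 ∈ lowerPCentral p (PCover p (baseMap p)) 2 :=
      comm_mem_lowerPCentral p (i := 1) h4 _
    refine list_prod_mem fun x hx => ?_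
    obtain ⟨k, rfl⟩ := (List.mem_ofFn' _ _).1 hx
    fin_cases k
    · exact pow_mem h5 _
    · exact pow_mem h6 _
    all_goals
      simp

theorem lowerPCentral_two_cover_le_multiplicator :
    lowerPCentral p (PCover p (baseMap p)) 2 ≤ multiplicator p (baseMap p) := fun x hx => by
  obtain ⟨a, b, rfl⟩ := (mem_lowerPCentral_two_cover_iff p).1 hx
  exact multHom_mem p _

theorem hasPClass_baseGroup : HasPClass p (BaseGroup p) 2 := by
  apply hasPClass_of
  · rw [← map_lowerPCentral p (baseProj p) (baseProj_surjective p), eq_bot_iff]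
    rintro _ ⟨x, hx, rfl⟩
    have := lowerPCentral_two_cover_le_multiplicator p hx
    rwa [multiplicator_eq_ker] at this
  · intro h
    have h1 := comm_mem_lowerPCentral p (i := 0) (Subgroup.mem_top (baseGen p 1)) (baseGen p 0)
    rw [h, comm_baseGen_one_zero, Subgroup.mem_bot, ← map_eq_one_iff _ (baseEquiv p).injective,
      baseEquiv_gen] at h1
    simpa [BaseModel.gen, BaseModel.one_def] using congrArg BaseModel.x₄ h1

theorem three_le_rank_baseGroup [Group.FG (BaseGroup p)] : 3 ≤ Group.rank (BaseGroup p) := by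
  let f : BaseGroup p →* Multiplicative (Fin 3 → ZMod p) :=
    BaseModel.abel.comp (baseEquiv p).toMonoidHom
  have hf : Function.Surjective f := by
    intro y
    obtain ⟨x, hx⟩ := (baseEquiv p).surjective ⟨y.toAdd 0, y.toAdd 1, y.toAdd 2, 0⟩
    refine ⟨x, (congrArg BaseModel.abel hx).trans ?_⟩
    apply Multiplicative.toAdd.injective
    ext i
    fin_cases i <;> rfl
  have h1 := Group.rank_le_of_surjective f hf
  -- The quotient (Z/p)³ has exponent p, so its order p³ divides p to the power of its rank.
  have h2 := card_dvd_exponent_pow_rank' (Multiplicative (Fin 3 → ZMod p)) (pow_char_pi p 3)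
  have h3 : Nat.card (Multiplicative (Fin 3 → ZMod p)) = p ^ 3 := by
    rw [Nat.card_congr Multiplicative.toAdd]
    simp
  rw [h3, Nat.pow_dvd_pow_iff_le_right (Fact.out : p.Prime).one_lt] at h2
  exact h2.trans h1

end Series

/-! ### Immediate descendants of order p⁵ correspond to forms not vanishing on a₅ and a₆ -/

section Quotients

variable {p : ℕ} [Fact p.Prime] [NeZero (12 : ZMod p)] {H : Type*} [Group H] {v u : Fin 7 → ZMod p}

theorem closure_coverGen : Subgroup.closure (Set.range (coverGen p)) = ⊤ := by
  have h := FreeGroup.closure_range_of (Fin 3)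
  have h2 := congrArg (Subgroup.map (QuotientGroup.mk' (relStar p (baseMap p)))) h
  rw [MonoidHom.map_closure, ← Set.range_comp,
    Subgroup.map_top_of_surjective _ (QuotientGroup.mk'_surjective _)] at h2
  exact h2

theorem form_ne_zero (hv : ¬(v 0 = 0 ∧ v 1 = 0)) : v ≠ 0 := by
  rintro rfl
  exact hv ⟨rfl, rfl⟩

/-- The last nontrivial term of the lower exponent-`p` central series of a quotient. -/
theorem comap_lowerPCentral_two {f : PCover p (baseMap p) →* H} (hf : Function.Surjective f)
    (hk : f.ker = formKernel p v) (hv : ¬(v 0 = 0 ∧ v 1 = 0)) :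
    (lowerPCentral p H 2).comap f = multiplicator p (baseMap p) := by
  have hle : f.ker ≤ multiplicator p (baseMap p) := hk ▸ formKernel_le p v
  rw [← map_lowerPCentral p f hf, Subgroup.comap_map_eq]
  apply le_antisymm
  · exact sup_le (lowerPCentral_two_cover_le_multiplicator p) hle
  · intro x hx
    obtain ⟨w, rfl⟩ := (mem_multiplicator_iff p).1 hx
    -- As v does not vanish on the span of a₅ and a₆, some element there has the same value as w;
    -- the difference lies in the kernel of v.
    obtain ⟨a, b, hab⟩ : ∃ a b, a * v 0 + b * v 1 = v ⬝ᵥ w := by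
      by_cases h0 : v 0 = 0
      · have h1 : v 1 ≠ 0 := fun h1 => hv ⟨h0, h1⟩
        exact ⟨0, (v ⬝ᵥ w) / v 1, by field_simp; simp⟩
      · exact ⟨(v ⬝ᵥ w) / v 0, 0, by field_simp; simp⟩
    have h1 : multHom p (Multiplicative.ofAdd ![a, b, 0, 0, 0, 0, 0]) ∈
        lowerPCentral p (PCover p (baseMap p)) 2 :=
      (mem_lowerPCentral_two_cover_iff p).2 ⟨a, b, rfl⟩
    have h2 : multHom p (Multiplicative.ofAdd (w - ![a, b, 0, 0, 0, 0, 0])) ∈ f.ker := by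
      rw [hk, multHom_mem_formKernel, dotProduct_sub, ← hab]
      simp [dotProduct, Fin.sum_univ_succ]
      ring
    have h3 : multHom p (Multiplicative.ofAdd w) =
        multHom p (Multiplicative.ofAdd ![a, b, 0, 0, 0, 0, 0]) *
        multHom p (Multiplicative.ofAdd (w - ![a, b, 0, 0, 0, 0, 0])) := by
      rw [← map_mul, ← ofAdd_add, add_sub_cancel]
    rw [h3]
    exact mul_mem (Subgroup.mem_sup_left h1) (Subgroup.mem_sup_right h2)

theorem lowerPCentral_two_le_torsionCenter {f : PCover p (baseMap p) →* H}
    (hf : Function.Surjective f) (hk : f.ker = formKernel p v) (hv : ¬(v 0 = 0 ∧ v 1 = 0)) :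
    lowerPCentral p H 2 ≤ torsionCenter p H := fun x hx => by
  obtain ⟨x, rfl⟩ := hf x
  have hx' : x ∈ (lowerPCentral p H 2).comap f := hx
  rw [comap_lowerPCentral_two hf hk hv] at hx'
  obtain ⟨h1, h2⟩ := multiplicator_le_torsionCenter p hx'
  refine ⟨fun y => ?_, by rw [← map_pow, h2, map_one]⟩
  obtain ⟨y, rfl⟩ := hf y
  exact (h1 y).map f

theorem IsFormQuotient.isImmediateDescendant (h : IsFormQuotient p H v)
    (hv : ¬(v 0 = 0 ∧ v 1 = 0)) : IsImmediateDescendant p H (BaseGroup p) := by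
  have hcard := h.card (form_ne_zero hv)
  have hp0 := (Fact.out : p.Prime).ne_zero
  have hfin : Finite H := Nat.finite_of_card_ne_zero (by rw [hcard]; exact pow_ne_zero _ hp0)
  have hfin' : Finite (BaseGroup p) :=
    Nat.finite_of_card_ne_zero (by rw [card_baseGroup]; exact pow_ne_zero _ hp0)
  obtain ⟨f, hf, hk⟩ := h
  have hker : ((QuotientGroup.mk' (lowerPCentral p H 2)).comp f).ker = (baseProj p).ker := by
    rw [← MonoidHom.comap_ker, QuotientGroup.ker_mk', comap_lowerPCentral_two hf hk hv,
      multiplicator_eq_ker]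
  have hs : Function.Surjective ((QuotientGroup.mk' (lowerPCentral p H 2)).comp f) := by
    rw [MonoidHom.coe_comp]
    exact (QuotientGroup.mk'_surjective _).comp hf
  let e : (H ⧸ lowerPCentral p H 2) ≃* BaseGroup p :=
    (QuotientGroup.quotientKerEquivOfSurjective _ hs).symm.trans
    ((QuotientGroup.quotientMulEquivOfEq hker).trans
      (QuotientGroup.quotientKerEquivOfSurjective _ (baseProj_surjective p)))
  refine ⟨hfin', IsPGroup.of_card (card_baseGroup p), hfin, IsPGroup.of_card hcard, ?_, 2,
    hasPClass_baseGroup p, ?_, ⟨e⟩⟩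
  · apply le_antisymm
    · refine le_trans ?_ (three_le_rank_baseGroup p)
      classical
      have hS : Subgroup.closure ((Finset.univ.image fun i => f (coverGen p i) : Finset H) : Set H)
          = ⊤ := by
        rw [Finset.coe_image, Finset.coe_univ, Set.image_univ]
        have := congrArg (Subgroup.map f) (closure_coverGen (p := p))
        rwa [MonoidHom.map_closure, Subgroup.map_top_of_surjective f hf, ← Set.range_comp] at this
      exact (Group.rank_le hS).trans Finset.card_image_le
    · exact Group.rank_le_of_surjective
        (e.toMonoidHom.comp (QuotientGroup.mk' (lowerPCentral p H 2)))
        (e.surjective.comp (QuotientGroup.mk'_surjective _))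
  · apply hasPClass_of
    · exact lowerPCentral_succ_eq_bot_of_le p (lowerPCentral_two_le_torsionCenter hf hk hv)
    · intro hbot
      have h1 := comap_lowerPCentral_two hf hk hv
      rw [hbot, MonoidHom.comap_bot, hk] at h1
      have h2 := fun j => h1.symm ▸ multGen_mem p j
      -- If the third term were trivial, v would vanish on the whole multiplicator, in particular on
      -- a₅ and a₆.
      simp only [← multHom_single, multHom_mem_formKernel, dotProduct_single_eq, mul_one] at h2
      exact hv ⟨h2 0, h2 1⟩

theorem exists_smul_eq_of_forall_dotProduct {K : Type*} [Field K] {n : ℕ} {x u : Fin n → K}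
    (hu : u ≠ 0) (h : ∀ w, u ⬝ᵥ w = 0 ↔ x ⬝ᵥ w = 0) : ∃ k : Kˣ, u = (k : K) • x := by
  obtain ⟨j, hj⟩ := Function.ne_iff.1 hu
  have hxj : x j ≠ 0 := fun hx => by
    have := (h (Pi.single j 1)).2 (by simpa using hx)
    exact hj (by simpa using this)
  refine ⟨Units.mk0 (u j / x j) (div_ne_zero hj hxj), ?_⟩
  ext i
  -- The test vector x_j e_i - x_i e_j is killed by x, hence by u.
  have := (h (Pi.single i (x j) - Pi.single j (x i))).2 (by
    rw [dotProduct_sub, dotProduct_single, dotProduct_single]; ring)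
  rw [dotProduct_sub, dotProduct_single, dotProduct_single] at this
  simp only [Units.val_mk0, Pi.smul_apply, smul_eq_mul]
  field_simp
  linear_combination this

theorem exists_lift_of_surjective {A B C : Type*} [Group A] [Group B] [Group C] (f : A →* B)
    (hf : Function.Surjective f) (g : A →* C) (h : f.ker ≤ g.ker) :
    ∃ l : B →* C, ∀ x, l (f x) = g x :=
  ⟨MonoidHom.liftOfRightInverse f _ (Function.rightInverse_surjInv hf) ⟨g, h⟩, fun x =>
    MonoidHom.liftOfRightInverse_comp_apply f _ (Function.rightInverse_surjInv hf) ⟨g, h⟩ x⟩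

/-- In both presentations of H as a quotient, the multiplicator is the preimage of the same
characteristic subgroup of H. Comparing the two resulting maps onto G gives an automorphism α.
Extending α by preimages of the generators makes one quotient map factor through the other, so the
kernels match up to α and the forms up to α and a scalar. -/
theorem IsFormQuotient.mem_dualOrbit (h : IsFormQuotient p H v) (h' : IsFormQuotient p H u)
    (hv : ¬(v 0 = 0 ∧ v 1 = 0)) (hu : ¬(u 0 = 0 ∧ u 1 = 0)) : u ∈ dualOrbit p v := by
  obtain ⟨f, hf, hk⟩ := h
  obtain ⟨g, hg, hl⟩ := h'
  have hfM := comap_lowerPCentral_two hf hk hv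
  have hgM := comap_lowerPCentral_two hg hl hu
  have hfin' : Finite (BaseGroup p) := Nat.finite_of_card_ne_zero (by
    rw [card_baseGroup]; exact pow_ne_zero _ (Fact.out : p.Prime).ne_zero)
  obtain ⟨π, hπ⟩ := exists_lift_of_surjective f hf (baseProj p) (by
    rw [hk, ← multiplicator_eq_ker]; exact formKernel_le p v)
  obtain ⟨a, ha⟩ := exists_lift_of_surjective (baseProj p) (baseProj_surjective p) (π.comp g)
    (fun x hx => by
      rw [← multiplicator_eq_ker, ← hgM] at hx
      obtain ⟨y, hy⟩ := hf (g x)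
      have hy' : y ∈ (lowerPCentral p H 2).comap f := by
        rw [Subgroup.mem_comap, hy]; exact hx
      rw [hfM, multiplicator_eq_ker, MonoidHom.mem_ker] at hy'
      rw [MonoidHom.mem_ker, MonoidHom.comp_apply, ← hy, hπ, hy'])
  have hasurj : Function.Surjective a := fun y => by
    obtain ⟨y, rfl⟩ := baseProj_surjective p y
    obtain ⟨z, hz⟩ := hg (f y)
    exact ⟨baseProj p z, by rw [ha, MonoidHom.comp_apply, hz, hπ]⟩
  let α : MulAut (BaseGroup p) :=
    MulEquiv.ofBijective a ⟨Finite.injective_iff_surjective.2 hasurj, hasurj⟩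
  have hα : ∀ x, α (baseProj p x) = π (g x) := ha
  choose q hq using fun i => hf (g (coverGen p i))
  obtain ⟨αs, hαs, hext⟩ := exists_extension p α q fun i => by
    rw [← baseProj_coverGen, hα, ← hq, hπ]
  have hcomp : f.comp αs = g := cover_hom_ext p fun i => by
    rw [MonoidHom.comp_apply, hαs, hq]
  have hker : formKernel p u = formKernel p (v ᵥ* (tupleMatrix p (autTuple p α))ᵀ) := by
    rw [← comap_formKernel hext, ← hk, MonoidHom.comap_ker, hcomp, hl]
  obtain ⟨k, hk⟩ := exists_smul_eq_of_forall_dotProduct (form_ne_zero hu)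
    (x := v ᵥ* (tupleMatrix p (autTuple p α))ᵀ) fun w => by
      rw [← multHom_mem_formKernel, ← multHom_mem_formKernel, hker]
  exact mem_dualOrbit_iff_exists.2 ⟨k, α, hk⟩

/-- The last term Z of the series of H is central of order p, and lifting the generators of G gives
f : P → H whose image together with Z is all of H. Commutators and p-th powers ignore factors from
Z, so the image contains the second term of the series, hence Z, and f is onto. -/
theorem IsImmediateDescendant.isFormQuotient (hH : IsImmediateDescendant p H (BaseGroup p))
    (hcard : Nat.card H = p ^ 5) : ∃ v : Fin 7 → ZMod p, ¬(v 0 = 0 ∧ v 1 = 0) ∧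
      IsFormQuotient p H v := by
  have hp := (Fact.out : p.Prime)
  obtain ⟨c, hc, hc', ⟨e⟩⟩ := hH.exists_class
  obtain rfl : c = 2 := hc.unique (hasPClass_baseGroup p)
  set Z := lowerPCentral p H 2 with hZ
  have hZc : Z ≤ torsionCenter p H := lowerPCentral_le_torsionCenter p hc'.1
  have hZcard : Nat.card Z = p := by
    have h1 := Subgroup.card_eq_card_quotient_mul_card_subgroup Z
    rw [hcard, Nat.card_congr e.toEquiv, card_baseGroup] at h1
    exact (Nat.eq_of_mul_eq_mul_left (pow_pos hp.pos 4) (by rw [← h1]; ring)).symm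
  let π : H →* BaseGroup p := e.toMonoidHom.comp (QuotientGroup.mk' Z)
  have hπ : Function.Surjective π := e.surjective.comp (QuotientGroup.mk'_surjective _)
  have hπk : ∀ x, π x = 1 ↔ x ∈ Z := fun x => by
    rw [← QuotientGroup.eq_one_iff]
    exact map_eq_one_iff _ e.injective
  choose h hh using fun i : Fin 3 => hπ (baseGen p i.castSucc)
  have hlift : π.comp (FreeGroup.lift h) = baseMap p := by
    ext i
    simp [hh, baseMap_of]
  obtain ⟨f, hf⟩ := cover_exists_lift p h fun r hr => hZc ((hπk _).1 (by
    rw [← MonoidHom.comp_apply, hlift]; exact hr))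
  have hπf : ∀ x, π (f x) = baseProj p x := DFunLike.congr_fun
    (show π.comp f = baseProj p from cover_hom_ext p fun i => by
      rw [MonoidHom.comp_apply, hf, hh, baseProj_coverGen])
  have hdec : ∀ x : H, ∃ k ∈ f.range, ∃ z ∈ Z, x = k * z := fun x => by
    obtain ⟨y, hy⟩ := baseProj_surjective p (π x)
    refine ⟨f y, ⟨y, rfl⟩, (f y)⁻¹ * x, ?_, by simp⟩
    rw [← hπk, map_mul, map_inv, hπf, hy, inv_mul_cancel]
  have hγ : lowerPCentral p H 1 ≤ f.range := by
    refine lowerPCentral_succ_le p (fun x _ y => ?_) (fun x _ => ?_)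
    · obtain ⟨k, hk, z, hz, rfl⟩ := hdec x
      obtain ⟨k', hk', z', hz', rfl⟩ := hdec y
      have c1 := (hZc hz).1
      have c2 := (hZc hz').1
      have : comm (k * z) (k' * z') = comm k k' := by
        simp only [comm, mul_inv_rev]
        rw [← (c1 k).eq, ← (c2 k').eq]
        have e1 : z⁻¹ * k⁻¹ = k⁻¹ * z⁻¹ := ((c1 k⁻¹).inv_left).eq
        have e2 : z'⁻¹ * k'⁻¹ = k'⁻¹ * z'⁻¹ := ((c2 k'⁻¹).inv_left).eq
        have e3 : z⁻¹ * (k'⁻¹ * z'⁻¹) * z = k'⁻¹ * z'⁻¹ := by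
          rw [((c1 (k'⁻¹ * z'⁻¹)).inv_left).eq, inv_mul_cancel_right]
        calc z⁻¹ * k⁻¹ * (z'⁻¹ * k'⁻¹) * (z * k) * (z' * k')
            = k⁻¹ * (z⁻¹ * (k'⁻¹ * z'⁻¹) * z) * k * (z' * k') := by rw [e1, e2]; group
          _ = k⁻¹ * k'⁻¹ * (z'⁻¹ * k * z') * k' := by rw [e3]; group
          _ = k⁻¹ * k'⁻¹ * k * k' := by
            rw [((c2 k).inv_left).eq, inv_mul_cancel_right]
      rw [this]
      exact mul_mem (mul_mem (mul_mem (inv_mem hk) (inv_mem hk')) hk) hk'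
    · obtain ⟨k, hk, z, hz, rfl⟩ := hdec x
      rw [((hZc hz).1 k).symm.mul_pow, (hZc hz).2, mul_one]
      exact pow_mem hk _
  have hZr : Z ≤ f.range := by
    have hn : f.range.Normal := ⟨fun x hx y => by
      obtain ⟨k, hk, z, hz, rfl⟩ := hdec y
      have : k * z * x * (k * z)⁻¹ = k * x * k⁻¹ := by
        rw [mul_inv_rev, mul_assoc k z x, ((hZc hz).1 x).eq]
        group
      rw [this]
      exact mul_mem (mul_mem hk hx) (inv_mem hk)⟩
    refine lowerPCentral_succ_le p (fun x hx y => ?_) (fun x hx => pow_mem (hγ hx) _)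
    have h1 : comm x y = x⁻¹ * (y⁻¹ * x * y⁻¹⁻¹) := by simp [comm, mul_assoc]
    rw [h1]
    exact mul_mem (inv_mem (hγ hx)) (hn.conj_mem x (hγ hx) y⁻¹)
  have hfs : Function.Surjective f := fun x => by
    obtain ⟨k, hk, z, hz, rfl⟩ := hdec x
    exact mul_mem hk (hZr hz)
  have hfM : ∀ x, f x ∈ Z ↔ x ∈ multiplicator p (baseMap p) := fun x => by
    rw [← hπk, hπf, multiplicator_eq_ker, MonoidHom.mem_ker]
  have : IsCyclic Z := isCyclic_of_prime_card hZcard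
  have hZe : Nonempty (Z ≃* Multiplicative (ZMod p)) :=
    ⟨mulEquivOfCyclicCardEq (by rw [hZcard]; simp)⟩
  obtain ⟨ε⟩ := hZe
  -- The restriction of f to the multiplicator takes values in Z ≅ F_p, so it is a linear form, and
  -- its coefficients are v.
  let χ : Multiplicative (Fin 7 → ZMod p) →* Multiplicative (ZMod p) :=
    ε.toMonoidHom.comp ((f.comp (multHom p)).codRestrict Z fun w => (hfM _).2 (multHom_mem p w))
  let v : Fin 7 → ZMod p := fun j => (χ (Multiplicative.ofAdd (Pi.single j 1))).toAdd
  have hχ : χ = dotHom p v := by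
    apply tuple_hom_ext
    intro j
    apply Multiplicative.toAdd.injective
    change v j = v ⬝ᵥ Pi.single j 1
    simp
  have hfv : ∀ w : Fin 7 → ZMod p, f (multHom p (Multiplicative.ofAdd w)) = 1 ↔ v ⬝ᵥ w = 0 := by
    intro w
    have h1 : χ (Multiplicative.ofAdd w) = 1 ↔ v ⬝ᵥ w = 0 := by
      rw [hχ]
      exact Iff.rfl
    rw [← h1]
    change _ = _ ↔ ε _ = 1
    rw [map_eq_one_iff _ ε.injective, Subtype.ext_iff]
    rfl
  have hfk : f.ker = formKernel p v := by
    ext x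
    constructor
    · intro hx
      obtain ⟨w, rfl⟩ := (mem_multiplicator_iff p).1 ((hfM x).1 (by
        rw [MonoidHom.mem_ker.1 hx]; exact one_mem _))
      rw [multHom_mem_formKernel, ← hfv]
      exact hx
    · intro hx
      obtain ⟨w, rfl⟩ := (mem_multiplicator_iff p).1 (formKernel_le p v hx)
      rw [multHom_mem_formKernel, ← hfv] at hx
      exact hx
  refine ⟨v, ?_, f, hfs, hfk⟩
  rintro ⟨h0, h1⟩
  -- If v vanished on a₅ and a₆, then Z, the image of their span, would be trivial.
  have hbot : Z = ⊥ := by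
    rw [hZ, ← map_lowerPCentral p f hfs, eq_bot_iff]
    rintro _ ⟨x, hx, rfl⟩
    obtain ⟨a, b, rfl⟩ := (mem_lowerPCentral_two_cover_iff p).1 hx
    rw [Subgroup.mem_bot, hfv]
    simp [dotProduct, Fin.sum_univ_succ, h0, h1]
  rw [hbot, Subgroup.card_bot] at hZcard
  exact hp.one_lt.ne hZcard

end Quotients

/-! ### The ten presentations as quotients of the p-cover -/

section Descendants

variable (p : ℕ) [Fact p.Prime] [NeZero (12 : ZMod p)]

/-- The p-cover embeds in the product of the cover model and (Z/p²)³, so relations in it can be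
checked in these two groups. -/
theorem eq_one_of_coords {x : PCover p (baseMap p)} (h : coverHom p x = 1) (h' : abelHom p x = 1) :
    x = 1 := by
  have hM : x ∈ multiplicator p (baseMap p) := by
    rw [multiplicator_eq_ker, MonoidHom.mem_ker, ← map_eq_one_iff _ (baseEquiv p).injective,
      ← toBase_coverHom, h, map_one]
  obtain ⟨u, rfl⟩ := (mem_multiplicator_iff p).1 hM
  have : u = 0 := multHom_eq_of_coords p (by rw [h, ofAdd_zero, map_one, map_one])
    (by rw [h', ofAdd_zero, map_one, map_one])
  rw [this, ofAdd_zero, map_one]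

theorem comm_coverGen_pow : comm (coverGen p 1) (coverGen p 0) ^ p = 1 :=
  eq_one_of_coords p (by rw [map_pow, CoverModel.pow_char])
    (by rw [map_pow, map_comm, comm_eq_one_of_commGroup, one_pow])

theorem comm_comm_coverGen_two : comm (comm (coverGen p 1) (coverGen p 0)) (coverGen p 2) = 1 := by
  refine eq_one_of_coords p ?_ (by rw [map_comm, comm_eq_one_of_commGroup])
  rw [map_comm, map_comm, CoverModel.comm_comm]
  simp [coverHom_coverGen, CoverModel.gen, CoverModel.one_def]

/-- The linear form that belongs to a group of the list. -/
def descForm (w : ℕ) (t : Fin 10) : Fin 7 → ZMod p :=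
  ![0, exponents w t 0, exponents w t 1, 0, exponents w t 2, exponents w t 3, exponents w t 4]

variable {p} {w : ℕ} {t : Fin 10}

/-- The generators of the groups of the list. -/
def descGen (p w : ℕ) (t : Fin 10) (i : Fin 5) : Descendant p w t := PresentedGroup.of i

theorem descGen_four_mem : descGen p w t 4 ∈ torsionCenter p (Descendant p w t) := by
  constructor
  · refine PCGroup.commute_of_gens fun i => ?_
    have key : ∀ i : Fin 5, i < 4 → Commute (descGen p w t 4) (descGen p w t i) := fun i hi => by
      rw [← comm_eq_one_iff]
      refine (PCGroup.comm_eq _ _ hi).trans ?_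
      simp
    fin_cases i
    · exact key 0 (by decide)
    · exact key 1 (by decide)
    · exact key 2 (by decide)
    · exact key 3 (by decide)
    · exact Commute.refl _
  · exact (PCGroup.pow_eq _ _ 4).trans (by simp)

theorem relTuple_descGen : relTuple p ![descGen p w t 0, descGen p w t 1, descGen p w t 2] =
    fun j => descGen p w t 4 ^ ![0, exponents w t 0, exponents w t 1, 0, exponents w t 2,
      exponents w t 3, exponents w t 4] j := by
  have h3 : comm (descGen p w t 1) (descGen p w t 0) = descGen p w t 3 :=
    (PCGroup.comm_eq _ _ (i := 0) (j := 1) (by decide)).trans (by simp; rfl)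
  funext j
  fin_cases j
  · change comm (comm (descGen p w t 1) (descGen p w t 0)) (descGen p w t 0) = _
    rw [h3]
    exact (PCGroup.comm_eq _ _ (i := 0) (j := 3) (by decide)).trans (by simp)
  · change comm (comm (descGen p w t 1) (descGen p w t 0)) (descGen p w t 1) = _
    rw [h3]
    exact (PCGroup.comm_eq _ _ (i := 1) (j := 3) (by decide)).trans (by simp; rfl)
  · exact (PCGroup.comm_eq _ _ (i := 0) (j := 2) (by decide)).trans (by simp; rfl)
  · exact (PCGroup.comm_eq _ _ (i := 1) (j := 2) (by decide)).trans (by simp)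
  · exact (PCGroup.pow_eq _ _ 0).trans (by simp; rfl)
  · exact (PCGroup.pow_eq _ _ 1).trans (by simp; rfl)
  · exact (PCGroup.pow_eq _ _ 2).trans (by simp; rfl)

/-- The natural map f from the p-cover sends the exponent vector u in the multiplicator to g₅ to the
power v·u, so it kills the kernel of v. Conversely, the relations of the presentation hold modulo
that kernel, which yields a map back and shows that f kills nothing more. The order p⁵ then follows
without a collection argument. -/
theorem isFormQuotient_descendant (ha : (exponents w t 0 : ZMod p) ≠ 0) :
    IsFormQuotient p (Descendant p w t) (descForm p w t) := by
  set v := descForm p w t with hv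
  have hz := descGen_four_mem (p := p) (w := w) (t := t)
  have hn : ∀ j, v j = ((![0, exponents w t 0, exponents w t 1, 0, exponents w t 2,
      exponents w t 3, exponents w t 4] j : ℕ) : ZMod p) := fun j => by
    fin_cases j <;> simp [hv, descForm]
  obtain ⟨f, hf⟩ := cover_exists_lift_of_relTuple p
    ![descGen p w t 0, descGen p w t 1, descGen p w t 2] fun j => by
      rw [relTuple_descGen]
      exact pow_mem hz _
  let τ : Multiplicative (Fin 1 → ZMod p) →* Descendant p w t :=
    tupleHom (fun _ => descGen p w t 4) (fun _ => hz)
  let δ : Multiplicative (Fin 7 → ZMod p) →* Multiplicative (Fin 1 → ZMod p) :=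
    { toFun := fun u => Multiplicative.ofAdd fun _ => v ⬝ᵥ u.toAdd
      map_one' := by
        apply Multiplicative.toAdd.injective
        ext i
        simp
      map_mul' := fun x y => by
        apply Multiplicative.toAdd.injective
        ext i
        simp [dotProduct_add] }
  have hτ : ∀ x : ZMod p, τ (Multiplicative.ofAdd fun _ => x) = descGen p w t 4 ^ x.val :=
    fun x => by
      change (List.ofFn _).prod = _
      simp
  have hfm : f.comp (multHom p) = τ.comp δ := by
    apply tuple_hom_ext
    intro j
    rw [MonoidHom.comp_apply, multHom_single, multGen_eq, map_relTuple]
    simp only [hf]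
    change relTuple p ![descGen p w t 0, descGen p w t 1, descGen p w t 2] j =
      τ (Multiplicative.ofAdd fun _ => v ⬝ᵥ Pi.single j 1)
    rw [relTuple_descGen, hτ, dotProduct_single_eq, mul_one, hn, ZMod.val_natCast]
    exact pow_eq_pow_mod _ hz.2
  have hfm' : ∀ u : Fin 7 → ZMod p, f (multHom p (Multiplicative.ofAdd u)) =
      descGen p w t 4 ^ (v ⬝ᵥ u).val := fun u => by
    rw [← hτ]
    exact DFunLike.congr_fun hfm _
  have hv1 : v 1 = exponents w t 0 := hn 1
  -- This vector has v·m = 1: it provides a preimage of g₅, and its class modulo the kernel of v is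
  -- the image of g₅ under the map back.
  set m : Fin 7 → ZMod p := Pi.single 1 (v 1)⁻¹ with hm
  have hvm : v ⬝ᵥ m = 1 := by
    rw [hm, dotProduct_single_eq]
    exact mul_inv_cancel₀ (by rwa [hv1])
  have hsurj : Function.Surjective f := by
    rw [← MonoidHom.range_eq_top]
    refine PCGroup.induction _ fun i => ?_
    have h0 : descGen p w t 0 ∈ f.range := ⟨_, hf 0⟩
    have h1 : descGen p w t 1 ∈ f.range := ⟨_, hf 1⟩
    fin_cases i
    · exact h0
    · exact h1
    · exact ⟨_, hf 2⟩
    · have h3 : comm (descGen p w t 1) (descGen p w t 0) = descGen p w t 3 :=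
        (PCGroup.comm_eq _ _ (i := 0) (j := 1) (by decide)).trans (by simp; rfl)
      change descGen p w t 3 ∈ _
      rw [← h3]
      exact mul_mem (mul_mem (mul_mem (inv_mem h1) (inv_mem h0)) h1) h0
    · refine ⟨multHom p (Multiplicative.ofAdd m), ?_⟩
      rw [hfm', hvm, ZMod.val_one, pow_one]
      rfl
  refine ⟨f, hsurj, le_antisymm ?_ ?_⟩
  · let q := QuotientGroup.mk' (formKernel p v)
    have hq : ∀ (u : Fin 7 → ZMod p) (n : ℕ), v ⬝ᵥ u = n →
        q (multHom p (Multiplicative.ofAdd u)) = q (multHom p (Multiplicative.ofAdd m)) ^ n := by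
      intro u n hun
      rw [← map_pow, ← map_pow, ← ofAdd_nsmul, ← div_eq_one, ← map_div, ← map_div, ← ofAdd_sub]
      refine (QuotientGroup.eq_one_iff _).2 ((multHom_mem_formKernel p).2 ?_)
      rw [dotProduct_sub, dotProduct_smul, hvm, hun]
      simp
    have hqj : ∀ j, q (multGen p j) = q (multHom p (Multiplicative.ofAdd m)) ^
        ![0, exponents w t 0, exponents w t 1, 0, exponents w t 2, exponents w t 3,
          exponents w t 4] j := fun j => by
      rw [← multHom_single]
      exact hq _ _ (by rw [dotProduct_single_eq, mul_one, hn])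
    have hmc := multiplicator_le_torsionCenter p (multHom_mem p (Multiplicative.ofAdd m))
    have hcen : ∀ x, comm (q (multHom p (Multiplicative.ofAdd m))) (q x) = 1 := fun x => by
      rw [← map_comm, (comm_eq_one_iff _ _).2 (hmc.1 x), map_one]
    obtain ⟨s, hs⟩ : ∃ s : Descendant p w t →* PCover p (baseMap p) ⧸ formKernel p v,
        ∀ i, s (PresentedGroup.of i) = ![q (coverGen p 0), q (coverGen p 1), q (coverGen p 2),
          q (comm (coverGen p 1) (coverGen p 0)), q (multHom p (Multiplicative.ofAdd m))] i := by
      refine PCGroup.exists_lift _ (fun i => ?_) (fun i j hij => ?_)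
      · fin_cases i
        · simpa [multGen] using hqj 4
        · simpa [multGen] using hqj 5
        · simpa [multGen] using hqj 6
        · change q _ ^ p = _
          rw [← map_pow, comm_coverGen_pow]
          simp
        · change q _ ^ p = _
          rw [← map_pow, hmc.2]
          simp
      · fin_cases i <;> fin_cases j <;> first
          | exact absurd hij (by decide)
          | skip
        · exact (map_comm q _ _).symm.trans (by simp)
        · exact (map_comm q _ _).symm.trans ((hqj 2).trans (by simp))
        · exact (map_comm q _ _).symm.trans ((hqj 0).trans (by simp))
        · exact (hcen _).trans (by simp)
        · exact (map_comm q _ _).symm.trans ((hqj 3).trans (by simp))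
        · exact (map_comm q _ _).symm.trans ((hqj 1).trans (by simp))
        · exact (hcen _).trans (by simp)
        · exact (map_comm q _ _).symm.trans ((congrArg q (comm_comm_coverGen_two p)).trans (by simp))
        · exact (hcen _).trans (by simp)
        · exact (hcen _).trans (by simp)
    have hsf : s.comp f = q := cover_hom_ext p fun i => by
      rw [MonoidHom.comp_apply, hf]
      fin_cases i
      · exact hs 0
      · exact hs 1
      · exact hs 2
    intro x hx
    rw [← QuotientGroup.ker_mk' (formKernel p v)]
    change q x = 1
    rw [← hsf, MonoidHom.comp_apply, MonoidHom.mem_ker.1 hx, map_one]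
  · intro x hx
    obtain ⟨u, rfl⟩ := (mem_multiplicator_iff p).1 (formKernel_le p _ hx)
    rw [multHom_mem_formKernel] at hx
    rw [MonoidHom.mem_ker, hfm', hx, ZMod.val_zero, pow_zero]

end Descendants

/-! ### Matching the ten presentations with the first ten orbits -/

section Main

variable {p : ℕ} [Fact p.Prime] [NeZero (12 : ZMod p)] {w : ZMod p}

theorem exponents_zero_ne_zero (hw : w ≠ 0) (t : Fin 10) :
    (exponents w.val t 0 : ZMod p) ≠ 0 := by
  fin_cases t <;> simp [exponents, hw]

theorem descForm_ne_zero (hw : w ≠ 0) (t : Fin 10) :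
    ¬(descForm p w.val t 0 = 0 ∧ descForm p w.val t 1 = 0) := fun h =>
  exponents_zero_ne_zero hw t h.2

/-- Only G₅ and G₁₀ need an argument: their forms have w in position 1 and 1 in position 4, and the
representatives have these exchanged. The product εη, which fixes the square class, is w in both
cases. -/
theorem dualOrbit_descForm (hw : w ≠ 0) (t : Fin 10) : dualOrbit p (descForm p w.val t) =
    dualOrbit p (orbitRep p w (t.castLE (by decide))) := by
  have h1 : (1 : ZMod p) ≠ 0 := one_ne_zero
  by_cases h4 : t = 4
  · subst h4
    have h : descForm p w.val 4 = ![0, w, 0, 0, 1, 0, 0] := by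
      simp [descForm, exponents]
    ext v
    change v ∈ dualOrbit p (descForm p w.val 4) ↔ v ∈ dualOrbit p ![0, 1, 0, 0, w, 0, 0]
    rw [h, mem_dualOrbit_e_c₁ 0 w 1 hw h1, mem_dualOrbit_e_c₁ 0 1 w h1 hw, mul_comm w 1]
  by_cases h9 : t = 9
  · subst h9
    have h : descForm p w.val 9 = ![0, w, w, 0, 1, 0, 0] := by
      simp [descForm, exponents]
    ext v
    change v ∈ dualOrbit p (descForm p w.val 9) ↔ v ∈ dualOrbit p ![0, 1, 1, 0, w, 0, 0]
    rw [h, mem_dualOrbit_e_c₁ w w 1 hw h1, mem_dualOrbit_e_c₁ 1 1 w h1 hw, mul_comm w 1]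
    simp [hw]
  congr 1
  ext j
  fin_cases t <;> first
    | exact absurd rfl h4
    | exact absurd rfl h9
    | fin_cases j <;> simp [descForm, exponents, orbitRep]

theorem orbitIndex_lt_ten {v : Fin 7 → ZMod p} (hv : ¬(v 0 = 0 ∧ v 1 = 0)) :
    orbitIndex v < 10 := by
  unfold orbitIndex
  rw [if_neg hv]
  split_ifs <;> decide

theorem exists_descForm (hw : ¬ IsSquare w) {v : Fin 7 → ZMod p} (hv : ¬(v 0 = 0 ∧ v 1 = 0)) :
    ∃ t, v ∈ dualOrbit p (descForm p w.val t) := by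
  have hw0 : w ≠ 0 := by
    rintro rfl
    exact hw IsSquare.zero
  refine ⟨⟨(orbitIndex v).val, orbitIndex_lt_ten hv⟩, ?_⟩
  rw [dualOrbit_descForm hw0, mem_dualOrbit_orbitRep w hw]
  exact ⟨form_ne_zero hv, rfl⟩

/-- The two memberships evaluate `orbitIndex` at the same vector, once as t and once as s. -/
theorem descForm_injective (hw : ¬ IsSquare w) {s t : Fin 10}
    (h : descForm p w.val s ∈ dualOrbit p (descForm p w.val t))
    (h' : descForm p w.val s ∈ dualOrbit p (descForm p w.val s)) : s = t := by
  have hw0 : w ≠ 0 := by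
    rintro rfl
    exact hw IsSquare.zero
  rw [dualOrbit_descForm hw0, mem_dualOrbit_orbitRep w hw] at h h'
  exact Fin.castLE_injective (by decide) (h'.2.symm.trans h.2)

theorem twelve_ne_zero {p : ℕ} [Fact p.Prime] (hp : 3 < p) : (12 : ZMod p) ≠ 0 := by
  intro h
  have h1 : ((12 : ℕ) : ZMod p) = 0 := by exact_mod_cast h
  rw [ZMod.natCast_eq_zero_iff] at h1
  have hpp : p.Prime := Fact.out
  have h2 : p ∣ 2 * (2 * 3) := h1
  rw [hpp.dvd_mul, hpp.dvd_mul, Nat.prime_dvd_prime_iff_eq hpp Nat.prime_two,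
    Nat.prime_dvd_prime_iff_eq hpp Nat.prime_three] at h2
  omega

end Main

end PGroupDescendants

theorem mainTheorem9 (p : ℕ) [Fact p.Prime] (hp : 3 < p)
    (w : (ZMod p)ˣ) (hw : ∀ x : (ZMod p)ˣ, x ∈ Subgroup.zpowers w) :
    -- the base group is the direct product of a cyclic group of order `p` and a Heisenberg group
    Nonempty (PGroupDescendants.BaseGroup p ≃*
      Multiplicative (ZMod p) × PGroupDescendants.heisenberg p) ∧
    -- the ten groups are immediate descendants of order `p ^ 5`
    (∀ t : Fin 10, Nat.card (PGroupDescendants.Descendant p (w : ZMod p).val t) = p ^ 5 ∧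
      PGroupDescendants.IsImmediateDescendant p
        (PGroupDescendants.Descendant p (w : ZMod p).val t) (PGroupDescendants.BaseGroup p)) ∧
    -- they are pairwise non-isomorphic
    (∀ s t : Fin 10, s ≠ t → IsEmpty (PGroupDescendants.Descendant p (w : ZMod p).val s ≃*
      PGroupDescendants.Descendant p (w : ZMod p).val t)) ∧
    -- every immediate descendant of order `p ^ 5` is isomorphic to one of them
    (∀ (H : Type*) [Group H], Nat.card H = p ^ 5 →
      PGroupDescendants.IsImmediateDescendant p H (PGroupDescendants.BaseGroup p) →
      ∃ t : Fin 10, Nonempty (H ≃* PGroupDescendants.Descendant p (w : ZMod p).val t)) ∧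
    -- the multiplicator is identified with the space of row vectors of length 7 over `ZMod p`
    (∃ ψ : Multiplicative (Fin 7 → ZMod p) ≃*
        PGroupDescendants.multiplicator p (PGroupDescendants.baseMap p),
      ∀ j, (ψ (Multiplicative.ofAdd (Pi.single j 1)) :
        PGroupDescendants.PCover p (PGroupDescendants.baseMap p)) =
          PGroupDescendants.multGen p j) ∧
    -- every automorphism acts on it by a unique matrix
    (∀ α : MulAut (PGroupDescendants.BaseGroup p),
      ∃! M, PGroupDescendants.IsActionMatrix p α M) ∧
    -- the orbits of nonzero vectors under the dual action enlarged by scalars, and their lengths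
    (∀ v : Fin 7 → ZMod p, v ≠ 0 → ∃! i : Fin 16,
      v ∈ PGroupDescendants.dualOrbit p (PGroupDescendants.orbitRep p (w : ZMod p) i)) ∧
    (∀ i : Fin 16,
      ((PGroupDescendants.dualOrbit p (PGroupDescendants.orbitRep p (w : ZMod p) i)).ncard : ℚ) =
        PGroupDescendants.orbitLength p i) := by
  have : NeZero (12 : ZMod p) := ⟨PGroupDescendants.twelve_ne_zero hp⟩
  have hsq : ¬ IsSquare (w : ZMod p) :=
    PGroupDescendants.not_isSquare_of_generator (by omega) hw
  have hw0 : (w : ZMod p) ≠ 0 := w.ne_zero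
  have hD := fun t => PGroupDescendants.isFormQuotient_descendant
    (PGroupDescendants.exponents_zero_ne_zero hw0 t)
  have hne := PGroupDescendants.descForm_ne_zero hw0
  refine ⟨PGroupDescendants.base_equiv_prod p, fun t => ⟨?_, ?_⟩, fun s t hst => ⟨fun e => hst ?_⟩,
    fun H _ hcard hH => ?_, ⟨PGroupDescendants.multEquiv p, fun j => ?_⟩, fun α => ?_,
    fun v hv => ?_, PGroupDescendants.ncard_dualOrbit_orbitRep hsq⟩
  · exact (hD t).card (PGroupDescendants.form_ne_zero (hne t))
  · exact (hD t).isImmediateDescendant (hne t)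
  · exact PGroupDescendants.descForm_injective hsq
      ((hD t).mem_dualOrbit ((hD s).congr e) (hne t) (hne s))
      ((hD s).mem_dualOrbit (hD s) (hne s) (hne s))
  · obtain ⟨v, hv, hHv⟩ := hH.isFormQuotient hcard
    obtain ⟨t, ht⟩ := PGroupDescendants.exists_descForm hsq hv
    exact ⟨t, hHv.mulEquiv ((hD t).of_mem_dualOrbit (PGroupDescendants.form_ne_zero (hne t))
      (PGroupDescendants.form_ne_zero hv) ht)⟩
  · exact PGroupDescendants.multHom_single p j
  · exact ⟨_, (PGroupDescendants.isActionMatrix_iff p α _).2 rfl,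
      fun M hM => (PGroupDescendants.isActionMatrix_iff p α M).1 hM⟩
  · refine ⟨PGroupDescendants.orbitIndex v,
      (PGroupDescendants.mem_dualOrbit_orbitRep _ hsq _ v).2 ⟨hv, rfl⟩, fun i hi => ?_⟩
    exact ((PGroupDescendants.mem_dualOrbit_orbitRep _ hsq i v).1 hi).2.symm
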